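/- Let $k$ be an algebraically closed field of characteristic $0$ with a fixed compatible family of primitive roots of unity $\xi_m\in k$ ($m\ge 1$, $\xi_{\ell m}^{\ell}=\xi_m$). Let $\mathcal R=(k[t,t^{-1}],\frac{d}{dt})$ and $\widehat{\mathcal S}=(k[t^q\mid q\in\mathbb Q],\frac{d}{dt})$. For a commutative $k$-algebra $R$ with a $k$-linear derivation $\delta$, an $(R,\delta)$-conformal superalgebra is an $R$-module $\mathcal A=\mathcal A_{\bar 0}\oplus\mathcal A_{\bar 1}$ with a parity-preserving $k$-linear map $\partial$ and $k$-bilinear products $a_{(n)}b$, $n\ge 0$, such that $a_{(n)}b=0$ for $n\gg0$; $(\partial a)_{(n)}b=-n\,a_{(n-1)}b$; $a_{(n)}\partial b=\partial(a_{(n)}b)+n\,a_{(n-1)}b$; $\partial(ra)=r\,\partial a+\delta(r)a$; $a_{(n)}(rb)=r(a_{(n)}b)$; and $(ra)_{(n)}b=\sum_{j\ge0}\frac{1}{j!}\delta^j(r)\,(a_{(n+j)}b)$. Isomorphisms are $R$-linear bijections that preserve parity, $\partial$ and all products. A $k$-conformal superalgebra is one over $(k,0)$; every $(R,\delta)$-conformal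 superalgebra is one by restriction of scalars. For an extension $(R,\delta_R)\to(S,\delta_S)$ of differential $k$-algebras, the base change $\mathcal A\otimes_R S$ has $\partial(a\otimes s)=\partial a\otimes s+a\otimes\delta_S(s)$ and $(a\otimes r)_{(n)}(b\otimes s)=\sum_{j\ge0}(a_{(n+j)}b)\otimes\frac{1}{j!}\delta_S^j(r)s$. For a $k$-conformal superalgebra $\mathcal A$ and an automorphism $\sigma$ of $\mathcal A$ with $\sigma^m=\mathrm{id}$, $m\ge1$, the twisted loop algebra is $$L(\mathcal A,\sigma)=\bigoplus_{i\in\mathbb Z}\{a\in\mathcal A\mid\sigma(a)=\xi_m^i a\}\otimes t^{i/m}\subseteq\mathcal A\otimes_k k[t^q\mid q\in\mathbb Q],$$ which is an $\mathcal R$-conformal, hence also a $k$-conformal, superalgebra. An $\widehat{\mathcal S}/\mathcal R$-form of $\mathcal A$ is an $\mathcal R$-conformal superalgebra $\mathcal F$ with $\mathcal F\otimes_{\mathcal R}\widehat{\mathcal S}\cong(\mathcal A\otimes_k\mathcal R)\otimes_{\mathcal R}\widehat{\mathcal S}$ as $\widehat{\mathcal S}$-conformal superalgebras. Let $\mathcal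 A$ be the classical $N=2$ $k$-conformal superalgebra: the free $k[\partial]$-module on the even elements $L,J$ and the odd elements $G^+,G^-$ with the Lie conformal superalgebra structure given, in terms of $[a_\lambda b]=\sum_n\frac{\lambda^n}{n!}a_{(n)}b$, by $[L_\lambda L]=(\partial+2\lambda)L$, $[L_\lambda J]=(\partial+\lambda)J$, $[L_\lambda G^\pm]=(\partial+\tfrac32\lambda)G^\pm$, $[J_\lambda J]=0$, $[J_\lambda G^\pm]=\pm G^\pm$, $[G^\pm{}_\lambda G^\pm]=0$, $[G^+{}_\lambda G^-]=L+\tfrac12(\partial+2\lambda)J$, the remaining brackets being determined by skew-symmetry and sesquilinearity. Let $\omega$ be the automorphism of $\mathcal A$ (of order $2$) with $L\mapsto L$, $J\mapsto-J$, $G^\pm\mapsto G^\mp$. **Theorem.** Up to $k$-conformal isomorphism there are exactly two twisted loop algebras of $\mathcal A$, namely $L(\mathcal A,\mathrm{id})$ and $L(\mathcal A,\omega)$: every $L(\mathcal A,\sigma)$ with $\sigma$ of finite order is isomorphic to one of them as a $k$-conformal superalgebra, and these two are not isomorphic as $k$-conformal superalgebras. Furthermore, every $\widehat{\mathcal S}/\mathcal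 R$-form of $\mathcal A$ is isomorphic, as an $\mathcal R$-conformal superalgebra, to $L(\mathcal A,\mathrm{id})$ or to $L(\mathcal A,\omega)$. -/

import Mathlib

open scoped TensorProduct

noncomputable section

/-- The divided power `T^{(j)} = T^j / j!` of a linear endomorphism. -/
def dividedPow {k V : Type*} [Field k] [AddCommGroup V] [Module k V]
    (T : V →ₗ[k] V) (j : ℕ) : V →ₗ[k] V :=
  ((j.factorial : k)⁻¹) • T ^ j

/-- An `(R, δ)`-conformal superalgebra structure on the `R`-module `A`, where `(R, δ)` is a
commutative `k`-algebra with a `k`-linear derivation. -/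
structure ConformalSuperalgebra (k : Type*) [Field k] {R : Type*} [CommRing R] [Algebra k R]
    (δ : Derivation k R R) (A : Type*) [AddCommGroup A] [Module k A] [Module R A]
    [IsScalarTower k R A] where
  /-- The even part. -/
  even : Submodule R A
  /-- The odd part. -/
  odd : Submodule R A
  /-- `A` is the direct sum of its even and odd parts. -/
  isCompl : IsCompl even odd
  /-- The derivation `∂`. -/
  der : A →ₗ[k] A
  der_even : ∀ a ∈ even, der a ∈ even
  der_odd : ∀ a ∈ odd, der a ∈ odd
  /-- The `n`-products `a_(n) b`. -/
  prod : ℕ → A →ₗ[k] A →ₗ[k] A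
  /-- (CS0) -/
  prod_eventually_zero : ∀ a b, ∃ N, ∀ n, N ≤ n → prod n a b = 0
  /-- (CS1), first half. -/
  der_prod : ∀ n a b, prod n (der a) b = -((n : k) • prod (n - 1) a b)
  /-- (CS1), second half. -/
  prod_der : ∀ n a b,
    prod n a (der b) = der (prod n a b) + (n : k) • prod (n - 1) a b
  /-- (CS2) -/
  der_smul : ∀ (r : R) a, der (r • a) = r • der a + δ r • a
  /-- (CS3), first half. -/
  prod_smul : ∀ n (r : R) a b, prod n a (r • b) = r • prod n a b
  /-- (CS3), second half; by (CS0) only finitely many terms are nonzero. -/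
  smul_prod : ∀ n (r : R) a b,
    prod n (r • a) b = ∑ᶠ j : ℕ, dividedPow (δ : R →ₗ[k] R) j r • prod (n + j) a b

/-- An isomorphism of `(R, δ)`-conformal superalgebras. -/
structure ConformalEquiv {k : Type*} [Field k] {R : Type*} [CommRing R] [Algebra k R]
    {δ : Derivation k R R}
    {A : Type*} [AddCommGroup A] [Module k A] [Module R A] [IsScalarTower k R A]
    {B : Type*} [AddCommGroup B] [Module k B] [Module R B] [IsScalarTower k R B]
    (SA : ConformalSuperalgebra k δ A) (SB : ConformalSuperalgebra k δ B)
    extends A ≃ₗ[R] B where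
  map_even : ∀ a ∈ SA.even, toFun a ∈ SB.even
  map_odd : ∀ a ∈ SA.odd, toFun a ∈ SB.odd
  map_prod : ∀ n a b, toFun (SA.prod n a b) = SB.prod n (toFun a) (toFun b)
  map_der : ∀ a, toFun (SA.der a) = SB.der (toFun a)

namespace ConformalSuperalgebra

section Aux

variable {k : Type*} [Field k]

lemma finsum_eq_range {M : Type*} [AddCommMonoid M] (f : ℕ → M) (N : ℕ)
    (h : ∀ n, N ≤ n → f n = 0) : ∑ᶠ j, f j = ∑ j ∈ Finset.range N, f j := by
  apply finsum_eq_sum_of_support_subset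
  intro j hj
  simp only [Finset.coe_range, Set.mem_Iio]
  by_contra hc
  exact hj (h j (not_lt.mp hc))

lemma dividedPow_zero {V : Type*} [AddCommGroup V] [Module k V] (T : V →ₗ[k] V) (v : V) :
    dividedPow T 0 v = v := by
  simp [dividedPow]

lemma apply_dividedPow [CharZero k] {V : Type*} [AddCommGroup V] [Module k V] (T : V →ₗ[k] V)
    (j : ℕ) (v : V) : T (dividedPow T j v) = ((j + 1 : ℕ) : k) • dividedPow T (j + 1) v := by
  have h : ((j.factorial : ℕ) : k) ≠ 0 := by exact_mod_cast j.factorial_ne_zero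
  have h' : ((j + 1 : ℕ) : k) ≠ 0 := by exact_mod_cast j.succ_ne_zero
  simp only [dividedPow, LinearMap.smul_apply, map_smul, smul_smul, Nat.factorial_succ,
    Nat.cast_mul, pow_succ', Module.End.mul_apply]
  congr 1
  field_simp

lemma dividedPow_apply [CharZero k] {V : Type*} [AddCommGroup V] [Module k V] (T : V →ₗ[k] V)
    (j : ℕ) (v : V) : dividedPow T j (T v) = ((j + 1 : ℕ) : k) • dividedPow T (j + 1) v := by
  rw [← apply_dividedPow]
  simp only [dividedPow, LinearMap.smul_apply, map_smul]
  rw [← Module.End.mul_apply, ← Module.End.mul_apply, ← pow_succ, ← pow_succ']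

lemma dividedPow_mul [CharZero k] {R : Type*} [CommRing R] [Algebra k R] (δ : Derivation k R R)
    (j : ℕ) (r s : R) : dividedPow (δ : R →ₗ[k] R) j (r * s) =
      ∑ p ∈ Finset.HasAntidiagonal.antidiagonal j,
        dividedPow (δ : R →ₗ[k] R) p.1 r * dividedPow (δ : R →ₗ[k] R) p.2 s := by
  induction j with
  | zero => simp [dividedPow_zero]
  | succ j ih =>
    have h' : ((j + 1 : ℕ) : k) ≠ 0 := by exact_mod_cast j.succ_ne_zero
    apply smul_right_injective R h'
    simp only
    rw [← apply_dividedPow, ih, map_sum]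
    simp only [Derivation.coeFn_coe, Derivation.leibniz, smul_eq_mul]
    have e : ∀ (i : ℕ) (x : R), δ (dividedPow (δ : R →ₗ[k] R) i x) =
        ((i + 1 : ℕ) : k) • dividedPow (δ : R →ₗ[k] R) (i + 1) x :=
      fun i x => apply_dividedPow (δ : R →ₗ[k] R) i x
    simp only [e, Finset.sum_add_distrib]
    have h1 : ∑ p ∈ Finset.HasAntidiagonal.antidiagonal j, dividedPow (δ : R →ₗ[k] R) p.1 r *
        (((p.2 + 1 : ℕ) : k) • dividedPow (δ : R →ₗ[k] R) (p.2 + 1) s) =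
        ∑ p ∈ Finset.HasAntidiagonal.antidiagonal (j + 1), dividedPow (δ : R →ₗ[k] R) p.1 r *
        ((p.2 : k) • dividedPow (δ : R →ₗ[k] R) p.2 s) := by
      rw [Finset.Nat.antidiagonal_succ']
      simp
    have h2 : ∑ p ∈ Finset.HasAntidiagonal.antidiagonal j, dividedPow (δ : R →ₗ[k] R) p.2 s *
        (((p.1 + 1 : ℕ) : k) • dividedPow (δ : R →ₗ[k] R) (p.1 + 1) r) =
        ∑ p ∈ Finset.HasAntidiagonal.antidiagonal (j + 1), dividedPow (δ : R →ₗ[k] R) p.2 s *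
        ((p.1 : k) • dividedPow (δ : R →ₗ[k] R) p.1 r) := by
      rw [Finset.Nat.antidiagonal_succ]
      simp
    rw [h1, h2, ← Finset.sum_add_distrib, Finset.smul_sum]
    apply Finset.sum_congr rfl
    intro p hp
    rw [← Finset.HasAntidiagonal.mem_antidiagonal.mp hp]
    simp only [mul_smul_comm, Nat.cast_add, add_smul]
    rw [mul_comm (dividedPow (δ : R →ₗ[k] R) p.2 s), add_comm]

end Aux

section Ext

variable {k : Type*} [Field k]
  {R : Type*} [CommRing R] [Algebra k R] {δR : Derivation k R R}
  {S : Type*} [CommRing S] [Algebra k S] {δS : Derivation k S S}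
  [Algebra R S] [IsScalarTower k R S]

lemma dividedPow_algebraMap (hδ : ∀ r, δS (algebraMap R S r) = algebraMap R S (δR r)) (j : ℕ)
    (r : R) : dividedPow (δS : S →ₗ[k] S) j (algebraMap R S r) =
      algebraMap R S (dividedPow (δR : R →ₗ[k] R) j r) := by
  have h : ∀ r, ((δS : S →ₗ[k] S) ^ j) (algebraMap R S r) =
      algebraMap R S (((δR : R →ₗ[k] R) ^ j) r) := by
    induction j with
    | zero => simp
    | succ j ih => intro r; simp [pow_succ, hδ, ih]
  simp only [dividedPow, LinearMap.smul_apply, h]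
  exact (map_smul (IsScalarTower.toAlgHom k R S) _ _).symm

/-- Restriction of scalars along an extension `(R, δR) → (S, δS)` of differential rings. -/
def restrict (hδ : ∀ r, δS (algebraMap R S r) = algebraMap R S (δR r))
    {A : Type*} [AddCommGroup A] [Module k A] [Module R A] [Module S A]
    [IsScalarTower k R A] [IsScalarTower k S A] [IsScalarTower R S A]
    (SA : ConformalSuperalgebra k δS A) : ConformalSuperalgebra k δR A where
  even := SA.even.restrictScalars R
  odd := SA.odd.restrictScalars R
  isCompl := by
    have h := SA.isCompl
    refine ⟨?_, ?_⟩
    · rw [Submodule.disjoint_def]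
      exact fun x hx hy => (Submodule.disjoint_def.mp h.disjoint) x hx hy
    · rw [codisjoint_iff, eq_top_iff]
      intro x _
      have hx : x ∈ SA.even ⊔ SA.odd := by rw [h.sup_eq_top]; trivial
      obtain ⟨a, ha, b, hb, rfl⟩ := Submodule.mem_sup.mp hx
      exact Submodule.mem_sup.mpr ⟨a, ha, b, hb, rfl⟩
  der := SA.der
  der_even := SA.der_even
  der_odd := SA.der_odd
  prod := SA.prod
  prod_eventually_zero := SA.prod_eventually_zero
  der_prod := SA.der_prod
  prod_der := SA.prod_der
  der_smul r a := by
    rw [← algebraMap_smul S r a, SA.der_smul, hδ]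
    simp only [algebraMap_smul]
  prod_smul n r a b := by
    rw [← algebraMap_smul S r b, SA.prod_smul]
    simp only [algebraMap_smul]
  smul_prod n r a b := by
    rw [← algebraMap_smul S r a, SA.smul_prod]
    simp only [dividedPow_algebraMap hδ, algebraMap_smul]

/-- The conformal superalgebra structure on a graded submodule that is stable under the
derivation and the `n`-products. -/
def sub {A : Type*} [AddCommGroup A] [Module k A] [Module R A] [IsScalarTower k R A]
    (SA : ConformalSuperalgebra k δR A) (N : Submodule R A)
    (hgr : ∀ x ∈ N, ∃ a ∈ N ⊓ SA.even, ∃ b ∈ N ⊓ SA.odd, a + b = x)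
    (hder : ∀ x ∈ N, SA.der x ∈ N)
    (hprod : ∀ n, ∀ x ∈ N, ∀ y ∈ N, SA.prod n x y ∈ N) :
    ConformalSuperalgebra k δR N where
  even := SA.even.comap N.subtype
  odd := SA.odd.comap N.subtype
  isCompl := by
    refine ⟨?_, ?_⟩
    · rw [Submodule.disjoint_def]
      exact fun x hx hy => Subtype.ext ((Submodule.disjoint_def.mp SA.isCompl.disjoint) x hx hy)
    · rw [codisjoint_iff, eq_top_iff]
      rintro ⟨x, hx⟩ _
      obtain ⟨a, ha, b, hb, rfl⟩ := hgr x hx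
      exact Submodule.mem_sup.mpr ⟨⟨a, ha.1⟩, ha.2, ⟨b, hb.1⟩, hb.2, rfl⟩
  der :=
    { toFun := fun x => ⟨SA.der x, hder x x.2⟩
      map_add' := fun x y => Subtype.ext (by simp)
      map_smul' := fun c x => Subtype.ext (by simp) }
  der_even := fun a ha => SA.der_even a ha
  der_odd := fun a ha => SA.der_odd a ha
  prod n := LinearMap.mk₂ k (fun x y => ⟨SA.prod n x y, hprod n x x.2 y y.2⟩)
    (fun x y z => Subtype.ext (by simp)) (fun c x y => Subtype.ext (by simp))
    (fun x y z => Subtype.ext (by simp)) (fun c x y => Subtype.ext (by simp))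
  prod_eventually_zero a b := by
    obtain ⟨M, hM⟩ := SA.prod_eventually_zero a b
    exact ⟨M, fun n hn => Subtype.ext (hM n hn)⟩
  der_prod n a b := Subtype.ext (SA.der_prod n a b)
  prod_der n a b := Subtype.ext (SA.prod_der n a b)
  der_smul r a := Subtype.ext (SA.der_smul r a)
  prod_smul n r a b := Subtype.ext (SA.prod_smul n r a b)
  smul_prod n r a b := by
    obtain ⟨M, hM⟩ := SA.prod_eventually_zero a b
    apply Subtype.ext
    have h := SA.smul_prod n r a b
    rw [finsum_eq_range _ M (fun j hj => by rw [hM _ (by omega), smul_zero])] at h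
    rw [finsum_eq_range _ M]
    · simpa using h
    · intro j hj
      apply Subtype.ext
      simp [hM (n + j) (by omega)]

end Ext


section BaseChange

variable {k : Type*} [Field k]
  {R : Type*} [CommRing R] [Algebra k R] {δR : Derivation k R R}
  {S : Type*} [CommRing S] [Algebra k S] {δS : Derivation k S S}
  [Algebra R S] [IsScalarTower k R S]
  {A : Type*} [AddCommGroup A] [Module k A] [Module R A] [IsScalarTower k R A]

/-- The derivation `s ⊗ a ↦ δ(s) ⊗ a + s ⊗ ∂(a)` of the base change. -/
def bcDer (hδ : ∀ r, δS (algebraMap R S r) = algebraMap R S (δR r))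
    (SA : ConformalSuperalgebra k δR A) : S ⊗[R] A →ₗ[k] S ⊗[R] A :=
  let f : S ⊗[R] A →+ S ⊗[R] A := TensorProduct.liftAddHom
    (AddMonoidHom.mk' (fun s => AddMonoidHom.mk' (fun a => δS s ⊗ₜ[R] a + s ⊗ₜ[R] SA.der a)
      (fun a b => by simp only [map_add, TensorProduct.tmul_add]; abel))
      (fun s t => by
        ext a
        simp only [map_add, TensorProduct.add_tmul, AddMonoidHom.mk'_apply,
          AddMonoidHom.add_apply]
        abel))
    (fun r s a => by
      simp only [AddMonoidHom.mk'_apply, SA.der_smul, TensorProduct.tmul_add,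
        TensorProduct.tmul_smul, Algebra.smul_def r s, Derivation.leibniz, hδ,
        TensorProduct.add_tmul]
      simp only [← TensorProduct.smul_tmul', ← Algebra.smul_def, smul_eq_mul]
      simp only [mul_comm s, ← Algebra.smul_def, ← TensorProduct.smul_tmul']
      abel)
  { toFun := f
    map_add' := f.map_add
    map_smul' := fun c x => by
      induction x using TensorProduct.induction_on with
      | zero => simp
      | add x y hx hy => simp only [smul_add, map_add, hx, hy]
      | tmul s a =>
        simp [f, TensorProduct.smul_tmul'] }

lemma bcDer_tmul (hδ : ∀ r, δS (algebraMap R S r) = algebraMap R S (δR r))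
    (SA : ConformalSuperalgebra k δR A) (s : S) (a : A) :
    bcDer hδ SA (s ⊗ₜ a) = δS s ⊗ₜ[R] a + s ⊗ₜ[R] SA.der a := rfl

lemma bcDer_smul (hδ : ∀ r, δS (algebraMap R S r) = algebraMap R S (δR r))
    (SA : ConformalSuperalgebra k δR A) (s : S) (x : S ⊗[R] A) :
    bcDer hδ SA (s • x) = s • bcDer hδ SA x + δS s • x := by
  induction x using TensorProduct.induction_on with
  | zero => simp
  | add x y hx hy => simp only [smul_add, map_add, hx, hy]; abel
  | tmul t a =>
    simp only [TensorProduct.smul_tmul', bcDer_tmul, smul_eq_mul, Derivation.leibniz,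
      TensorProduct.add_tmul, smul_add, mul_comm t]
    abel

lemma support_finite (SA : ConformalSuperalgebra k δR A) (δ : S →ₗ[k] S) (n : ℕ) (s : S)
    (a b : A) :
    (Function.support fun j : ℕ => dividedPow δ j s ⊗ₜ[R] SA.prod (n + j) a b).Finite := by
  obtain ⟨M, hM⟩ := SA.prod_eventually_zero a b
  apply (Set.finite_Iio M).subset
  intro j hj
  by_contra hc
  have hc' : M ≤ j := not_lt.mp hc
  exact hj (by simp [hM (n + j) (by omega)])

/-- For fixed `s` and `a`, the `S`-linear operator
`t ⊗ b ↦ ∑_j δ^{(j)}(s) t ⊗ a_(n+j) b`. -/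
def bcOp (δS : Derivation k S S) (SA : ConformalSuperalgebra k δR A) (n : ℕ) (s : S) (a : A) :
    S ⊗[R] A →ₗ[S] S ⊗[R] A :=
  LinearMap.liftBaseChange S
    { toFun := fun b => ∑ᶠ j : ℕ, dividedPow (δS : S →ₗ[k] S) j s ⊗ₜ[R] SA.prod (n + j) a b
      map_add' := fun b c => by
        rw [← finsum_add_distrib (support_finite SA _ n s a b) (support_finite SA _ n s a c)]
        simp only [map_add, TensorProduct.tmul_add]
      map_smul' := fun r b => by
        rw [RingHom.id_apply, smul_finsum' _ (support_finite SA _ n s a b)]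
        simp only [SA.prod_smul, TensorProduct.tmul_smul] }

lemma bcOp_tmul (SA : ConformalSuperalgebra k δR A) (n : ℕ) (s t : S) (a b : A) :
    bcOp δS SA n s a (t ⊗ₜ b) =
      t • ∑ᶠ j : ℕ, dividedPow (δS : S →ₗ[k] S) j s ⊗ₜ[R] SA.prod (n + j) a b :=
  LinearMap.liftBaseChange_tmul ..

lemma bcOp_ext {f g : S ⊗[R] A →ₗ[S] S ⊗[R] A} (h : ∀ b, f (1 ⊗ₜ b) = g (1 ⊗ₜ b)) : f = g := by
  ext b
  exact h b

lemma bcOp_one_tmul_range (SA : ConformalSuperalgebra k δR A) (n : ℕ) (s : S) (a b : A) (M : ℕ)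
    (hM : ∀ m, M ≤ m → SA.prod m a b = 0) :
    bcOp δS SA n s a (1 ⊗ₜ b) =
      ∑ j ∈ Finset.range M, dividedPow (δS : S →ₗ[k] S) j s ⊗ₜ[R] SA.prod (n + j) a b := by
  rw [bcOp_tmul, one_smul, finsum_eq_range _ M]
  intro j hj
  rw [hM _ (by omega), TensorProduct.tmul_zero]

/-- Rearrangement of a double sum with finitely many nonzero terms along antidiagonals. -/
lemma sum_antidiagonal_range {M : Type*} [AddCommMonoid M] (F : ℕ → ℕ → M) (N : ℕ)
    (h : ∀ i j, N ≤ i + j → F i j = 0) :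
    ∑ m ∈ Finset.range N, ∑ p ∈ Finset.HasAntidiagonal.antidiagonal m, F p.1 p.2 =
      ∑ i ∈ Finset.range N, ∑ j ∈ Finset.range N, F i j := by
  rw [← Finset.sum_product', Finset.sum_sigma']
  apply Finset.sum_bij_ne_zero (fun x _ _ => x.2)
  · rintro ⟨m, p⟩ hx _
    simp only [Finset.mem_sigma, Finset.mem_range, Finset.HasAntidiagonal.mem_antidiagonal] at hx
    simp only [Finset.mem_product, Finset.mem_range]
    omega
  · rintro ⟨m, p⟩ hx _ ⟨m', p'⟩ hx' _ heq
    simp only [Finset.mem_sigma, Finset.mem_range, Finset.HasAntidiagonal.mem_antidiagonal]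
      at hx hx' heq
    subst heq
    obtain ⟨_, rfl⟩ := hx
    obtain ⟨_, rfl⟩ := hx'
    rfl
  · rintro ⟨i, j⟩ _ hne
    refine ⟨⟨i + j, (i, j)⟩, ?_, hne, rfl⟩
    simp only [Finset.mem_sigma, Finset.mem_range, Finset.HasAntidiagonal.mem_antidiagonal,
      and_true]
    by_contra hc
    exact hne (h i j (not_lt.mp hc))
  · intros; rfl

lemma bcOp_mul [CharZero k] (SA : ConformalSuperalgebra k δR A) (n : ℕ) (c s : S) (a b : A)
    (M : ℕ) (hM : ∀ m, M ≤ m → SA.prod m a b = 0) :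
    bcOp δS SA n (c * s) a (1 ⊗ₜ b) =
      ∑ i ∈ Finset.range M, dividedPow (δS : S →ₗ[k] S) i c •
        bcOp δS SA (n + i) s a (1 ⊗ₜ b) := by
  rw [bcOp_one_tmul_range SA n _ a b M hM]
  simp only [bcOp_one_tmul_range SA _ s a b M hM, Finset.smul_sum, TensorProduct.smul_tmul',
    smul_eq_mul]
  rw [← sum_antidiagonal_range
    (fun i j => (dividedPow (δS : S →ₗ[k] S) i c * dividedPow (δS : S →ₗ[k] S) j s) ⊗ₜ[R]
      SA.prod (n + i + j) a b) M
    (fun i j hij => by rw [hM _ (by omega), TensorProduct.tmul_zero])]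
  apply Finset.sum_congr rfl
  intro m _
  rw [dividedPow_mul, TensorProduct.sum_tmul]
  apply Finset.sum_congr rfl
  intro p hp
  rw [← Finset.HasAntidiagonal.mem_antidiagonal.mp hp, add_assoc]

lemma bcOp_balanced [CharZero k] (hδ : ∀ r, δS (algebraMap R S r) = algebraMap R S (δR r))
    (SA : ConformalSuperalgebra k δR A) (n : ℕ) (r : R) (s : S) (a : A) :
    bcOp δS SA n (r • s) a = bcOp δS SA n s (r • a) := by
  apply bcOp_ext
  intro b
  obtain ⟨M, hM⟩ := SA.prod_eventually_zero a b
  have hr : ∀ m, SA.prod m (r • a) b =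
      ∑ j ∈ Finset.range M, dividedPow (δR : R →ₗ[k] R) j r • SA.prod (m + j) a b := by
    intro m
    rw [SA.smul_prod, finsum_eq_range _ M]
    intro j hj
    rw [hM _ (by omega), smul_zero]
  have hM' : ∀ m, M ≤ m → SA.prod m (r • a) b = 0 := by
    intro m hm
    rw [hr]
    exact Finset.sum_eq_zero fun j _ => by rw [hM _ (by omega), smul_zero]
  rw [Algebra.smul_def, bcOp_mul SA n _ s a b M hM, bcOp_one_tmul_range SA n s _ b M hM']
  simp only [bcOp_one_tmul_range SA _ s a b M hM, hr, TensorProduct.tmul_sum, Finset.smul_sum]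
  rw [Finset.sum_comm]
  refine Finset.sum_congr rfl fun j _ => Finset.sum_congr rfl fun i _ => ?_
  rw [dividedPow_algebraMap hδ, algebraMap_smul, TensorProduct.tmul_smul, add_right_comm]

lemma bcOp_add_right (SA : ConformalSuperalgebra k δR A) (n : ℕ) (s : S) (a a' : A) :
    bcOp δS SA n s (a + a') = bcOp δS SA n s a + bcOp δS SA n s a' := by
  apply bcOp_ext
  intro b
  simp only [LinearMap.add_apply, bcOp_tmul, one_smul]
  rw [← finsum_add_distrib (support_finite SA _ n s a b) (support_finite SA _ n s a' b)]
  simp only [map_add, LinearMap.add_apply, TensorProduct.tmul_add]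

lemma bcOp_add_left (SA : ConformalSuperalgebra k δR A) (n : ℕ) (s s' : S) (a : A) :
    bcOp δS SA n (s + s') a = bcOp δS SA n s a + bcOp δS SA n s' a := by
  apply bcOp_ext
  intro b
  simp only [LinearMap.add_apply, bcOp_tmul, one_smul]
  rw [← finsum_add_distrib (support_finite SA _ n s a b) (support_finite SA _ n s' a b)]
  simp only [map_add, TensorProduct.add_tmul]

/-- The `n`-product `(s ⊗ a)_(n) (t ⊗ b) = ∑_j δ^{(j)}(s) t ⊗ a_(n+j) b` of the base change. -/
def bcProd [CharZero k] (hδ : ∀ r, δS (algebraMap R S r) = algebraMap R S (δR r))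
    (SA : ConformalSuperalgebra k δR A) (n : ℕ) :
    S ⊗[R] A →ₗ[k] S ⊗[R] A →ₗ[k] S ⊗[R] A :=
  let f : S ⊗[R] A →+ (S ⊗[R] A →ₗ[S] S ⊗[R] A) := TensorProduct.liftAddHom
    { toFun := fun s =>
        { toFun := fun a => bcOp δS SA n s a
          map_zero' := by
            apply bcOp_ext
            intro b
            simp [bcOp_tmul]
          map_add' := bcOp_add_right SA n s }
      map_zero' := by
        ext1 a
        apply bcOp_ext
        intro b
        simp [bcOp_tmul]
      map_add' := fun s s' => by
        ext1 a
        exact bcOp_add_left SA n s s' a }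
    (fun r s a => bcOp_balanced hδ SA n r s a)
  LinearMap.mk₂ k (fun x y => f x y)
    (fun x x' y => by rw [map_add, LinearMap.add_apply])
    (fun c x y => by
      induction x using TensorProduct.induction_on with
      | zero => simp
      | add x x' hx hx' => simp only [smul_add, map_add, LinearMap.add_apply, hx, hx']
      | tmul s a =>
        have : bcOp δS SA n (c • s) a = c • bcOp δS SA n s a := by
          apply bcOp_ext
          intro b
          rw [LinearMap.smul_apply, bcOp_tmul, bcOp_tmul, one_smul, one_smul,
            smul_finsum' _ (support_finite SA _ n s a b)]
          simp only [map_smul, TensorProduct.smul_tmul']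
        exact congrArg (fun g => g y) this)
    (fun x y y' => map_add _ _ _)
    (fun c x y => by
      rw [← algebraMap_smul S c y, map_smul, algebraMap_smul])

lemma bcProd_tmul [CharZero k] (hδ : ∀ r, δS (algebraMap R S r) = algebraMap R S (δR r))
    (SA : ConformalSuperalgebra k δR A) (n : ℕ) (s : S) (a : A) (y : S ⊗[R] A) :
    bcProd hδ SA n (s ⊗ₜ a) y = bcOp δS SA n s a y := rfl

lemma bcProd_smul [CharZero k] (hδ : ∀ r, δS (algebraMap R S r) = algebraMap R S (δR r))
    (SA : ConformalSuperalgebra k δR A) (n : ℕ) (s : S) (x y : S ⊗[R] A) :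
    bcProd hδ SA n x (s • y) = s • bcProd hδ SA n x y := by
  induction x using TensorProduct.induction_on with
  | zero => simp
  | add x x' hx hx' => simp only [map_add, LinearMap.add_apply, hx, hx', smul_add]
  | tmul t a => simp only [bcProd_tmul, map_smul]

lemma tmul_smul_k (c : k) (s : S) (a : A) : s ⊗ₜ[R] (c • a) = c • (s ⊗ₜ[R] a) := by
  rw [← algebraMap_smul R c a, TensorProduct.tmul_smul, algebraMap_smul]

lemma bcOp_shift [CharZero k] (SA : ConformalSuperalgebra k δR A) (n : ℕ) (s : S) (a b : A)
    (M : ℕ) (hM : ∀ m, M ≤ m → SA.prod m a b = 0) :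
    bcOp δS SA n (δS s) a (1 ⊗ₜ b) + (n : k) • bcOp δS SA (n - 1) s a (1 ⊗ₜ b) =
      ∑ j ∈ Finset.range (M + 1), ((n + j : ℕ) : k) •
        (dividedPow (δS : S →ₗ[k] S) j s ⊗ₜ[R] SA.prod (n + j - 1) a b) := by
  have hM1 : ∀ m, M + 1 ≤ m → SA.prod m a b = 0 := fun m hm => hM m (by omega)
  have e1 : bcOp δS SA n (δS s) a (1 ⊗ₜ b) = ∑ j ∈ Finset.range (M + 1), (j : k) •
      (dividedPow (δS : S →ₗ[k] S) j s ⊗ₜ[R] SA.prod (n + j - 1) a b) := by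
    rw [bcOp_one_tmul_range SA n (δS s) a b M hM, Finset.sum_range_succ', Nat.cast_zero,
      zero_smul, add_zero]
    refine Finset.sum_congr rfl fun j _ => ?_
    have := dividedPow_apply (δS : S →ₗ[k] S) j s
    rw [Derivation.coeFn_coe] at this
    rw [this, TensorProduct.smul_tmul']
    rfl
  rw [e1, bcOp_one_tmul_range SA (n - 1) s a b (M + 1) hM1, Finset.smul_sum,
    ← Finset.sum_add_distrib]
  refine Finset.sum_congr rfl fun j _ => ?_
  rcases Nat.eq_zero_or_pos n with rfl | hn
  · simp
  · rw [show n - 1 + j = n + j - 1 by omega, Nat.cast_add, add_smul, add_comm]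

lemma bcProd_eventually_zero [CharZero k]
    (hδ : ∀ r, δS (algebraMap R S r) = algebraMap R S (δR r))
    (SA : ConformalSuperalgebra k δR A) (x y : S ⊗[R] A) :
    ∃ N, ∀ n, N ≤ n → bcProd hδ SA n x y = 0 := by
  induction x using TensorProduct.induction_on with
  | zero => exact ⟨0, fun n _ => by simp⟩
  | add x x' hx hx' =>
    obtain ⟨M, hM⟩ := hx
    obtain ⟨M', hM'⟩ := hx'
    exact ⟨max M M', fun n hn => by
      rw [map_add, LinearMap.add_apply, hM n (by omega), hM' n (by omega), add_zero]⟩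
  | tmul s a =>
    simp only [bcProd_tmul]
    induction y using TensorProduct.induction_on with
    | zero => exact ⟨0, fun n _ => by simp⟩
    | add y y' hy hy' =>
      obtain ⟨M, hM⟩ := hy
      obtain ⟨M', hM'⟩ := hy'
      exact ⟨max M M', fun n hn => by rw [map_add, hM n (by omega), hM' n (by omega), add_zero]⟩
    | tmul t b =>
      obtain ⟨M, hM⟩ := SA.prod_eventually_zero a b
      refine ⟨M, fun n hn => ?_⟩
      have : ∀ j : ℕ, dividedPow (δS : S →ₗ[k] S) j s ⊗ₜ[R] SA.prod (n + j) a b = 0 :=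
        fun j => by rw [hM _ (by omega), TensorProduct.tmul_zero]
      rw [bcOp_tmul]
      simp only [this, finsum_zero, smul_zero]

/-- The base change `A ⊗_R S` of an `(R, δR)`-conformal superalgebra along an extension
`(R, δR) → (S, δS)` (with the factors written in the order `S ⊗[R] A`). -/
def baseChange [CharZero k] (hδ : ∀ r, δS (algebraMap R S r) = algebraMap R S (δR r))
    (SA : ConformalSuperalgebra k δR A) : ConformalSuperalgebra k δS (S ⊗[R] A) where
  even := SA.even.baseChange S
  odd := SA.odd.baseChange S
  isCompl := by
    refine ⟨?_, ?_⟩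
    · rw [Submodule.disjoint_def]
      intro x hx hy
      let p : A →ₗ[R] A := SA.even.subtype ∘ₗ SA.even.projectionOnto SA.odd SA.isCompl
      have h1 : ∀ x ∈ SA.even.baseChange S, p.baseChange S x = x := by
        intro x hx
        rw [Submodule.baseChange_eq_span] at hx
        induction hx using Submodule.span_induction with
        | mem x h =>
          obtain ⟨a, ha, rfl⟩ := h
          have : p a = a := by
            simpa [p] using congrArg Subtype.val
              (Submodule.projectionOnto_apply_left SA.isCompl ⟨a, ha⟩)
          simp [this]
        | zero => simp
        | add x y _ _ hx hy => rw [map_add, hx, hy]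
        | smul c x _ hx => rw [map_smul, hx]
      have h2 : ∀ x ∈ SA.odd.baseChange S, p.baseChange S x = 0 := by
        intro x hx
        rw [Submodule.baseChange_eq_span] at hx
        induction hx using Submodule.span_induction with
        | mem x h =>
          obtain ⟨a, ha, rfl⟩ := h
          have : p a = 0 := by
            simpa [p] using congrArg Subtype.val
              (Submodule.projectionOnto_apply_right SA.isCompl ⟨a, ha⟩)
          simp [this]
        | zero => simp
        | add x y _ _ hx hy => rw [map_add, hx, hy, add_zero]
        | smul c x _ hx => rw [map_smul, hx, smul_zero]
      rw [← h1 x hx, h2 x hy]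
    · rw [codisjoint_iff, eq_top_iff]
      intro x _
      induction x using TensorProduct.induction_on with
      | zero => exact zero_mem _
      | add x y hx hy => exact add_mem (hx trivial) (hy trivial)
      | tmul s a =>
        have h : a ∈ SA.even ⊔ SA.odd := by rw [SA.isCompl.sup_eq_top]; trivial
        obtain ⟨a, ha, b, hb, rfl⟩ := Submodule.mem_sup.mp h
        rw [TensorProduct.tmul_add]
        exact Submodule.add_mem_sup (Submodule.tmul_mem_baseChange_of_mem s ha)
          (Submodule.tmul_mem_baseChange_of_mem s hb)
  der := bcDer hδ SA
  der_even x hx := by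
    rw [Submodule.baseChange_eq_span] at hx
    induction hx using Submodule.span_induction with
    | mem x h =>
      obtain ⟨a, ha, rfl⟩ := h
      exact add_mem (Submodule.tmul_mem_baseChange_of_mem _ ha)
        (Submodule.tmul_mem_baseChange_of_mem _ (SA.der_even a ha))
    | zero => rw [map_zero]; exact zero_mem _
    | add x y _ _ hx hy => rw [map_add]; exact add_mem hx hy
    | smul c x h hx =>
      rw [bcDer_smul]
      rw [← Submodule.baseChange_eq_span] at h
      exact add_mem (Submodule.smul_mem _ _ hx) (Submodule.smul_mem _ _ h)
  der_odd x hx := by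
    rw [Submodule.baseChange_eq_span] at hx
    induction hx using Submodule.span_induction with
    | mem x h =>
      obtain ⟨a, ha, rfl⟩ := h
      exact add_mem (Submodule.tmul_mem_baseChange_of_mem _ ha)
        (Submodule.tmul_mem_baseChange_of_mem _ (SA.der_odd a ha))
    | zero => rw [map_zero]; exact zero_mem _
    | add x y _ _ hx hy => rw [map_add]; exact add_mem hx hy
    | smul c x h hx =>
      rw [bcDer_smul]
      rw [← Submodule.baseChange_eq_span] at h
      exact add_mem (Submodule.smul_mem _ _ hx) (Submodule.smul_mem _ _ h)
  prod := bcProd hδ SA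
  prod_eventually_zero := bcProd_eventually_zero hδ SA
  der_prod n x y := by
    induction x using TensorProduct.induction_on with
    | zero => simp
    | add x x' hx hx' =>
      simp only [map_add, LinearMap.add_apply, smul_add, hx, hx', neg_add]
    | tmul s a =>
      rw [bcDer_tmul, map_add, LinearMap.add_apply]
      simp only [bcProd_tmul]
      induction y using TensorProduct.induction_on with
      | zero => simp
      | add y y' hy hy' =>
        simp only [map_add, smul_add, neg_add]
        rw [add_add_add_comm, hy, hy']
      | tmul t b =>
        obtain ⟨M, hM⟩ := SA.prod_eventually_zero a b
        have key := bcOp_shift (S := S) (δS := δS) SA n s a b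
        rw [← mul_one t, ← smul_eq_mul, ← TensorProduct.smul_tmul']
        simp only [map_smul, ← smul_add]
        rw [smul_comm (n : k) t]
        refine Eq.trans ?_ (smul_neg t _)
        congr 1
        have hM' : ∀ m, M + 1 ≤ m → SA.prod m (SA.der a) b = 0 := by
          intro m hm
          rw [SA.der_prod, hM _ (by omega), smul_zero, neg_zero]
        have e1 : bcOp δS SA n s (SA.der a) (1 ⊗ₜ b) =
            - ∑ j ∈ Finset.range (M + 1), ((n + j : ℕ) : k) •
              (dividedPow (δS : S →ₗ[k] S) j s ⊗ₜ[R] SA.prod (n + j - 1) a b) := by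
          rw [bcOp_one_tmul_range SA n s _ b (M + 1) hM', ← Finset.sum_neg_distrib]
          refine Finset.sum_congr rfl fun j _ => ?_
          rw [SA.der_prod, TensorProduct.tmul_neg, tmul_smul_k]
        rw [e1, ← key M hM]
        abel
  prod_der n x y := by
    induction x using TensorProduct.induction_on with
    | zero => simp
    | add x x' hx hx' =>
      simp only [map_add, LinearMap.add_apply, smul_add, hx, hx']
      abel
    | tmul s a =>
      simp only [bcProd_tmul]
      induction y using TensorProduct.induction_on with
      | zero => simp
      | add y y' hy hy' =>
        simp only [map_add, smul_add, hy, hy']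
        abel
      | tmul t b =>
        obtain ⟨M, hM⟩ := SA.prod_eventually_zero a b
        have key := bcOp_shift (S := S) (δS := δS) SA n s a b M hM
        have main : bcOp δS SA n s a (1 ⊗ₜ SA.der b) =
            bcDer hδ SA (bcOp δS SA n s a (1 ⊗ₜ b)) +
              (n : k) • bcOp δS SA (n - 1) s a (1 ⊗ₜ b) := by
          have hM' : ∀ m, M + 1 ≤ m → SA.prod m a (SA.der b) = 0 := by
            intro m hm
            rw [SA.prod_der, hM _ (by omega), hM _ (by omega), smul_zero, map_zero, add_zero]
          have hM1 : ∀ m, M + 1 ≤ m → SA.prod m a b = 0 := fun m hm => hM m (by omega)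
          have e1 : bcOp δS SA n s a (1 ⊗ₜ SA.der b) =
              ∑ j ∈ Finset.range (M + 1),
                dividedPow (δS : S →ₗ[k] S) j s ⊗ₜ[R] SA.der (SA.prod (n + j) a b) +
              ∑ j ∈ Finset.range (M + 1), ((n + j : ℕ) : k) •
              (dividedPow (δS : S →ₗ[k] S) j s ⊗ₜ[R] SA.prod (n + j - 1) a b) := by
            rw [bcOp_one_tmul_range SA n s a _ (M + 1) hM', ← Finset.sum_add_distrib]
            refine Finset.sum_congr rfl fun j _ => ?_
            rw [SA.prod_der, TensorProduct.tmul_add, tmul_smul_k]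
          have e2 : bcDer hδ SA (bcOp δS SA n s a (1 ⊗ₜ b)) =
              bcOp δS SA n (δS s) a (1 ⊗ₜ b) + ∑ j ∈ Finset.range (M + 1),
                dividedPow (δS : S →ₗ[k] S) j s ⊗ₜ[R] SA.der (SA.prod (n + j) a b) := by
            rw [bcOp_one_tmul_range SA n s a b (M + 1) hM1,
              bcOp_one_tmul_range SA n (δS s) a b (M + 1) hM1, map_sum,
              ← Finset.sum_add_distrib]
            refine Finset.sum_congr rfl fun j _ => ?_
            rw [bcDer_tmul]
            congr 2
            exact (apply_dividedPow (δS : S →ₗ[k] S) j s).trans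
              (dividedPow_apply (δS : S →ₗ[k] S) j s).symm
          rw [e1, e2, ← key]
          abel
        rw [bcDer_tmul, map_add]
        have h1 : ∀ (u : S) (c : A), u ⊗ₜ[R] c = u • ((1 : S) ⊗ₜ[R] c) := fun u c => by
          rw [TensorProduct.smul_tmul', smul_eq_mul, mul_one]
        rw [h1 (δS t), h1 t (SA.der b), h1 t b]
        simp only [map_smul, bcDer_smul, main, smul_add]
        rw [smul_comm (n : k) t]
        abel
  der_smul := bcDer_smul hδ SA
  prod_smul n s x y := bcProd_smul hδ SA n s x y
  smul_prod n c x y := by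
    obtain ⟨M, hM⟩ := bcProd_eventually_zero hδ SA x y
    have gen : ∀ x y : S ⊗[R] A, ∃ M, ∀ M', M ≤ M' → bcProd hδ SA n (c • x) y =
        ∑ j ∈ Finset.range M', dividedPow (δS : S →ₗ[k] S) j c • bcProd hδ SA (n + j) x y := by
      intro x y
      induction x using TensorProduct.induction_on with
      | zero => exact ⟨0, fun M' _ => by simp⟩
      | add x x' hx hx' =>
        obtain ⟨M, hM⟩ := hx
        obtain ⟨M', hM'⟩ := hx'
        refine ⟨max M M', fun N hN => ?_⟩
        simp only [smul_add, map_add, LinearMap.add_apply, Finset.sum_add_distrib]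
        rw [hM N (by omega), hM' N (by omega)]
      | tmul s a =>
        rw [TensorProduct.smul_tmul', smul_eq_mul]
        simp only [bcProd_tmul]
        induction y using TensorProduct.induction_on with
        | zero => exact ⟨0, fun M' _ => by simp⟩
        | add y y' hy hy' =>
          obtain ⟨M, hM⟩ := hy
          obtain ⟨M', hM'⟩ := hy'
          refine ⟨max M M', fun N hN => ?_⟩
          simp only [map_add, smul_add, Finset.sum_add_distrib]
          rw [hM N (by omega), hM' N (by omega)]
        | tmul t b =>
          obtain ⟨M, hM⟩ := SA.prod_eventually_zero a b
          refine ⟨M, fun N hN => ?_⟩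
          have h1 : t ⊗ₜ[R] b = t • ((1 : S) ⊗ₜ[R] b) := by
            rw [TensorProduct.smul_tmul', smul_eq_mul, mul_one]
          rw [h1]
          simp only [map_smul]
          rw [bcOp_mul SA n c s a b N (fun m hm => hM m (by omega)), Finset.smul_sum]
          exact Finset.sum_congr rfl fun j _ => smul_comm _ _ _
    obtain ⟨M', hM'⟩ := gen x y
    rw [hM' (max M M') (by omega), finsum_eq_range _ (max M M')]
    intro j hj
    rw [hM _ (by omega), smul_zero]

end BaseChange

end ConformalSuperalgebra

section Defs

open ConformalSuperalgebra

variable {k : Type*} [Field k]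

/-- The identity automorphism. -/
def ConformalEquiv.refl {R : Type*} [CommRing R] [Algebra k R] {δ : Derivation k R R}
    {A : Type*} [AddCommGroup A] [Module k A] [Module R A] [IsScalarTower k R A]
    (SA : ConformalSuperalgebra k δ A) : ConformalEquiv SA SA where
  toLinearEquiv := LinearEquiv.refl R A
  map_even _ h := h
  map_odd _ h := h
  map_prod _ _ _ := rfl
  map_der _ := rfl

/-- Two `(R, δ)`-conformal superalgebras are isomorphic over `(R, δ)`. -/
def IsoOver {R : Type*} [CommRing R] [Algebra k R] {δ : Derivation k R R}
    {A : Type*} [AddCommGroup A] [Module k A] [Module R A] [IsScalarTower k R A]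
    {B : Type*} [AddCommGroup B] [Module k B] [Module R B] [IsScalarTower k R B]
    (SA : ConformalSuperalgebra k δ A) (SB : ConformalSuperalgebra k δ B) : Prop :=
  Nonempty (ConformalEquiv SA SB)

/-- Every differential `k`-algebra `(S, δ)` is an extension of `(k, 0)`. -/
lemma der_algebraMap_base {S : Type*} [CommRing S] [Algebra k S] (δ : Derivation k S S) (c : k) :
    δ (algebraMap k S c) = algebraMap k S ((0 : Derivation k k k) c) := by
  simp

/-- Two `(R, δ)`-conformal superalgebras are isomorphic as `k`-conformal superalgebras, after
restriction of scalars to `(k, 0)`. -/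
def IsoOverBase {R : Type*} [CommRing R] [Algebra k R] {δ : Derivation k R R}
    {A : Type*} [AddCommGroup A] [Module k A] [Module R A] [IsScalarTower k R A]
    {B : Type*} [AddCommGroup B] [Module k B] [Module R B] [IsScalarTower k R B]
    (SA : ConformalSuperalgebra k δ A) (SB : ConformalSuperalgebra k δ B) : Prop :=
  IsoOver (SA.restrict (der_algebraMap_base δ)) (SB.restrict (der_algebraMap_base δ))

/-- `F` is an `(S, δS)/(R, δR)`-form of `A`: the base changes of `F` and `A` to `(S, δS)` are
isomorphic `(S, δS)`-conformal superalgebras. -/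
def IsForm [CharZero k] {R : Type*} [CommRing R] [Algebra k R] {δR : Derivation k R R}
    {S : Type*} [CommRing S] [Algebra k S] {δS : Derivation k S S}
    [Algebra R S] [IsScalarTower k R S]
    (hδ : ∀ r, δS (algebraMap R S r) = algebraMap R S (δR r))
    {F : Type*} [AddCommGroup F] [Module k F] [Module R F] [IsScalarTower k R F]
    {A : Type*} [AddCommGroup A] [Module k A] [Module R A] [IsScalarTower k R A]
    (SF : ConformalSuperalgebra k δR F) (SA : ConformalSuperalgebra k δR A) : Prop :=
  IsoOver (SF.baseChange hδ) (SA.baseChange hδ)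

/-! ### The rings `R = k[t, t⁻¹]` and `Ŝ = k[t^q | q ∈ ℚ]` with the derivation `d/dt` -/

/-- The derivation `t^q ↦ q t^{q-1}` of the algebra `k[t^q | q ∈ G]`, for a ring of exponents
`G` mapping to `k`. -/
def powerDer {G : Type*} [CommRing G] (c : G →+* k) :
    Derivation k (AddMonoidAlgebra k G) (AddMonoidAlgebra k G) :=
  Derivation.mk'
    (Finsupp.linearCombination k (fun q : G => AddMonoidAlgebra.single (q - 1) (c q)) ∘ₗ
      (AddMonoidAlgebra.coeffLinearEquiv k).toLinearMap)
    (fun x y => by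
      induction x using AddMonoidAlgebra.induction_linear with
      | zero => simp
      | add x x' hx hx' => rw [add_mul, map_add, hx, hx', map_add]; simp only [smul_eq_mul]; ring
      | single p a =>
        induction y using AddMonoidAlgebra.induction_linear with
        | zero => simp
        | add y y' hy hy' => rw [mul_add, map_add, hy, hy', map_add]; simp only [smul_eq_mul]; ring
        | single q b =>
          simp only [AddMonoidAlgebra.single_mul_single, LinearMap.comp_apply,
            LinearEquiv.coe_coe, AddMonoidAlgebra.coeffLinearEquiv_apply,
            AddMonoidAlgebra.coeff_single, Finsupp.linearCombination_single,
            AddMonoidAlgebra.smul_single, smul_eq_mul, map_add]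
          rw [show p + (q - 1) = p + q - 1 by ring, show q + (p - 1) = p + q - 1 by ring,
            ← AddMonoidAlgebra.single_add]
          congr 1
          ring)

lemma powerDer_single {G : Type*} [CommRing G] (c : G →+* k) (q : G) (a : k) :
    powerDer c (AddMonoidAlgebra.single q a) = AddMonoidAlgebra.single (q - 1) (a * c q) := by
  simp [powerDer]

/-- The ring `Ŝ = k[t^q | q ∈ ℚ]`, the union of the rings `k[t^{1/m}, t^{-1/m}]`. -/
abbrev RatLaurent (k : Type*) [Field k] : Type _ := AddMonoidAlgebra k ℚ

/-- The inclusion `k[t, t⁻¹] → k[t^q | q ∈ ℚ]`. -/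
instance ratLaurentAlgebra : Algebra (LaurentPolynomial k) (RatLaurent k) :=
  (AddMonoidAlgebra.mapDomainRingHom k (Int.castAddHom ℚ)).toAlgebra

lemma algebraMap_ratLaurent_single (n : ℤ) (a : k) :
    algebraMap (LaurentPolynomial k) (RatLaurent k) (AddMonoidAlgebra.single n a) =
      AddMonoidAlgebra.single (n : ℚ) a := by
  rw [RingHom.algebraMap_toAlgebra, AddMonoidAlgebra.mapDomainRingHom_apply,
    AddMonoidAlgebra.mapDomain_single]
  rfl

instance ratLaurentTower : IsScalarTower k (LaurentPolynomial k) (RatLaurent k) :=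
  IsScalarTower.of_algebraMap_eq fun c => by
    rw [AddMonoidAlgebra.coe_algebraMap, AddMonoidAlgebra.coe_algebraMap]
    simp only [Function.comp_apply, algebraMap_ratLaurent_single, Int.cast_zero]

/-- `d/dt` on `k[t, t⁻¹]`. -/
def laurentDer (k : Type*) [Field k] : Derivation k (LaurentPolynomial k) (LaurentPolynomial k) :=
  powerDer (Int.castRingHom k)

/-- `d/dt` on `k[t^q | q ∈ ℚ]`. -/
def ratLaurentDer (k : Type*) [Field k] [CharZero k] :
    Derivation k (RatLaurent k) (RatLaurent k) :=
  powerDer (Rat.castHom k)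

lemma ratLaurentDer_algebraMap [CharZero k] (r : LaurentPolynomial k) :
    ratLaurentDer k (algebraMap (LaurentPolynomial k) (RatLaurent k) r) =
      algebraMap (LaurentPolynomial k) (RatLaurent k) (laurentDer k r) := by
  induction r using AddMonoidAlgebra.induction_linear with
  | zero => simp
  | add x y hx hy => simp only [map_add, hx, hy]
  | single n a =>
    rw [algebraMap_ratLaurent_single, ratLaurentDer, laurentDer, powerDer_single,
      powerDer_single, algebraMap_ratLaurent_single]
    simp

/-! ### Twisted loop algebras -/

section Loop

variable [CharZero k] {A : Type*} [AddCommGroup A] [Module k A]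
  {SA : ConformalSuperalgebra k (0 : Derivation k k k) A}

/-- The elements `a ⊗ t^{i/m}` with `σ(a) = ζ^i a`. -/
def loopGenerators (σ : ConformalEquiv SA SA) (m : ℕ) (ζ : k) : Set (RatLaurent k ⊗[k] A) :=
  {x | ∃ (i : ℤ) (a : A), σ.toLinearEquiv a = ζ ^ i • a ∧
    x = AddMonoidAlgebra.single ((i : ℚ) / (m : ℚ)) 1 ⊗ₜ[k] a}

lemma tmul_mem_loop {σ : ConformalEquiv SA SA} {m : ℕ} (hm : 0 < m) {ζ : k}
    (hζ : IsPrimitiveRoot ζ m) {i : ℤ} {a : A} (ha : σ.toLinearEquiv a = ζ ^ i • a) (n : ℤ)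
    (q : ℚ) (hq : q = (i : ℚ) / (m : ℚ) + n) (c : k) :
    AddMonoidAlgebra.single q c ⊗ₜ[k] a ∈ Submodule.span k (loopGenerators σ m ζ) := by
  have h : (AddMonoidAlgebra.single q c ⊗ₜ[k] a : RatLaurent k ⊗[k] A) =
      c • (AddMonoidAlgebra.single q 1 ⊗ₜ[k] a) := by
    rw [TensorProduct.smul_tmul', AddMonoidAlgebra.smul_single, smul_eq_mul, mul_one]
  rw [h]
  refine Submodule.smul_mem _ _ (Submodule.subset_span ⟨i + m * n, a, ?_, ?_⟩)
  · have h0 : ζ ≠ 0 := hζ.ne_zero hm.ne'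
    rw [ha, zpow_add₀ h0, zpow_mul, zpow_natCast, hζ.pow_eq_one, one_zpow, mul_one]
  · have hm' : (m : ℚ) ≠ 0 := by exact_mod_cast hm.ne'
    congr 2
    rw [hq]
    push_cast
    field_simp

/-- The subspace `⨁_i A_i ⊗ t^{i/m}` of `A ⊗_k Ŝ`, where `A_i` is the `ζ^i`-eigenspace of `σ`;
it is stable under multiplication by `k[t, t⁻¹]`. -/
def loopSubmodule (σ : ConformalEquiv SA SA) (m : ℕ) (hm : 0 < m) (ζ : k)
    (hζ : IsPrimitiveRoot ζ m) : Submodule (LaurentPolynomial k) (RatLaurent k ⊗[k] A) where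
  carrier := Submodule.span k (loopGenerators σ m ζ)
  add_mem' := add_mem
  zero_mem' := zero_mem _
  smul_mem' r x hx := by
    simp only [SetLike.mem_coe] at hx ⊢
    induction r using AddMonoidAlgebra.induction_linear with
    | zero => rw [zero_smul]; exact zero_mem _
    | add r s hr hs => rw [add_smul]; exact add_mem hr hs
    | single n c =>
      induction hx using Submodule.span_induction with
      | zero => rw [smul_zero]; exact zero_mem _
      | add x y _ _ hx hy => rw [smul_add]; exact add_mem hx hy
      | smul d x _ hx => rw [smul_comm]; exact Submodule.smul_mem _ _ hx
      | mem x h =>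
        obtain ⟨i, a, ha, rfl⟩ := h
        rw [TensorProduct.smul_tmul', Algebra.smul_def, algebraMap_ratLaurent_single,
          AddMonoidAlgebra.single_mul_single]
        exact tmul_mem_loop hm hζ ha n _ (add_comm _ _) _

lemma dividedPow_ratLaurentDer_single (j : ℕ) (q : ℚ) (c : k) :
    ∃ d : k, dividedPow (ratLaurentDer k : RatLaurent k →ₗ[k] RatLaurent k) j
      (AddMonoidAlgebra.single q c) = AddMonoidAlgebra.single (q - j) d := by
  have h : ∃ d : k, ((ratLaurentDer k : RatLaurent k →ₗ[k] RatLaurent k) ^ j)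
      (AddMonoidAlgebra.single q c) = AddMonoidAlgebra.single (q - j) d := by
    induction j with
    | zero => exact ⟨c, by simp⟩
    | succ j ih =>
      obtain ⟨d, hd⟩ := ih
      refine ⟨d * Rat.castHom k (q - j), ?_⟩
      rw [pow_succ', Module.End.mul_apply, hd, Derivation.coeFn_coe, ratLaurentDer,
        powerDer_single]
      congr 1
      push_cast
      ring
  obtain ⟨d, hd⟩ := h
  exact ⟨(j.factorial : k)⁻¹ * d, by
    rw [dividedPow, LinearMap.smul_apply, hd, AddMonoidAlgebra.smul_single, smul_eq_mul]⟩

/-- The twisted loop algebra `L(A, σ) = ⨁_i A_i ⊗ t^{i/m}` as a `(k[t, t⁻¹], d/dt)`-conformal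
superalgebra, for an automorphism `σ` of period `m` and a primitive `m`-th root of unity `ζ`. -/
def twistedLoop (σ : ConformalEquiv SA SA) (m : ℕ) (hm : 0 < m) (ζ : k)
    (hζ : IsPrimitiveRoot ζ m) :
    ConformalSuperalgebra k (laurentDer k) (loopSubmodule σ m hm ζ hζ) :=
  ((SA.baseChange (der_algebraMap_base (ratLaurentDer k))).restrict
      (ratLaurentDer_algebraMap (k := k))).sub (loopSubmodule σ m hm ζ hζ)
    (fun x hx => by
      change x ∈ Submodule.span k _ at hx
      induction hx using Submodule.span_induction with
      | zero => exact ⟨0, zero_mem _, 0, zero_mem _, add_zero 0⟩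
      | add x y _ _ hx hy =>
        obtain ⟨a, ha, b, hb, rfl⟩ := hx
        obtain ⟨a', ha', b', hb', rfl⟩ := hy
        exact ⟨a + a', add_mem ha ha', b + b', add_mem hb hb', by abel⟩
      | smul d x _ hx =>
        obtain ⟨a, ha, b, hb, rfl⟩ := hx
        exact ⟨d • a, Submodule.smul_of_tower_mem _ d ha, d • b,
          Submodule.smul_of_tower_mem _ d hb, (smul_add _ _ _).symm⟩
      | mem x h =>
        obtain ⟨i, a, ha, rfl⟩ := h
        have h : a ∈ SA.even ⊔ SA.odd := by rw [SA.isCompl.sup_eq_top]; trivial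
        obtain ⟨a, hae, b, hbo, rfl⟩ := Submodule.mem_sup.mp h
        have h1 : σ.toLinearEquiv a - ζ ^ i • a = -(σ.toLinearEquiv b - ζ ^ i • b) := by
          rw [map_add, smul_add] at ha
          rw [neg_sub, sub_eq_sub_iff_add_eq_add, ha, add_comm]
        have h2 : σ.toLinearEquiv a - ζ ^ i • a ∈ SA.even :=
          sub_mem (σ.map_even a hae) (Submodule.smul_mem _ _ hae)
        have h3 : σ.toLinearEquiv b - ζ ^ i • b ∈ SA.odd :=
          sub_mem (σ.map_odd b hbo) (Submodule.smul_mem _ _ hbo)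
        have h4 : σ.toLinearEquiv a - ζ ^ i • a = 0 :=
          (Submodule.disjoint_def.mp SA.isCompl.disjoint) _ h2 (h1 ▸ neg_mem h3)
        have h5 : σ.toLinearEquiv b - ζ ^ i • b = 0 := by
          rw [h4] at h1; exact neg_eq_zero.mp h1.symm
        exact ⟨_, ⟨Submodule.subset_span ⟨i, a, sub_eq_zero.mp h4, rfl⟩,
            Submodule.tmul_mem_baseChange_of_mem _ hae⟩,
          _, ⟨Submodule.subset_span ⟨i, b, sub_eq_zero.mp h5, rfl⟩,
            Submodule.tmul_mem_baseChange_of_mem _ hbo⟩,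
          (TensorProduct.tmul_add _ _ _).symm⟩)
    (fun x hx => by
      change x ∈ Submodule.span k _ at hx
      change bcDer (der_algebraMap_base (ratLaurentDer k)) SA x ∈ Submodule.span k _
      induction hx using Submodule.span_induction with
      | zero => rw [map_zero]; exact zero_mem _
      | add x y _ _ hx hy => rw [map_add]; exact add_mem hx hy
      | smul d x _ hx => rw [map_smul]; exact Submodule.smul_mem _ _ hx
      | mem x h =>
        obtain ⟨i, a, ha, rfl⟩ := h
        rw [bcDer_tmul, ratLaurentDer, powerDer_single]
        refine add_mem (tmul_mem_loop hm hζ ha (-1) _ (by push_cast; ring) _)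
          (Submodule.subset_span ⟨i, SA.der a, ?_, rfl⟩)
        exact (σ.map_der a).trans (by
          change SA.der (σ.toLinearEquiv a) = _
          rw [ha, map_smul]))
    (fun n x hx y hy => by
      change x ∈ Submodule.span k _ at hx
      change y ∈ Submodule.span k _ at hy
      change bcProd (der_algebraMap_base (ratLaurentDer k)) SA n x y ∈ Submodule.span k _
      induction hx using Submodule.span_induction with
      | zero => rw [map_zero]; exact zero_mem _
      | add x y _ _ hx hy => rw [map_add]; exact add_mem hx hy
      | smul d x _ hx => rw [map_smul]; exact Submodule.smul_mem _ _ hx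
      | mem x h =>
        obtain ⟨i, a, ha, rfl⟩ := h
        induction hy using Submodule.span_induction with
        | zero => rw [map_zero]; exact zero_mem _
        | add x y _ _ hx hy => rw [map_add]; exact add_mem hx hy
        | smul d x _ hx => rw [map_smul]; exact Submodule.smul_mem _ _ hx
        | mem y h' =>
          obtain ⟨i', b, hb, rfl⟩ := h'
          obtain ⟨M, hM⟩ := SA.prod_eventually_zero a b
          rw [bcProd_tmul, bcOp_tmul, finsum_eq_range _ M
            (fun j hj => by rw [hM _ (by omega), TensorProduct.tmul_zero]), Finset.smul_sum]
          refine sum_mem fun j _ => ?_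
          obtain ⟨d, hd⟩ := dividedPow_ratLaurentDer_single (k := k) j ((i : ℚ) / (m : ℚ)) 1
          rw [hd, TensorProduct.smul_tmul', smul_eq_mul, AddMonoidAlgebra.single_mul_single]
          have hab : σ.toLinearEquiv (SA.prod (n + j) a b) =
              ζ ^ (i + i') • SA.prod (n + j) a b := by
            refine (σ.map_prod (n + j) a b).trans ?_
            change SA.prod (n + j) (σ.toLinearEquiv a) (σ.toLinearEquiv b) = _
            rw [ha, hb, map_smul, map_smul, LinearMap.smul_apply, smul_smul,
              zpow_add₀ (hζ.ne_zero hm.ne'), mul_comm]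
          exact tmul_mem_loop hm hζ hab (-(j : ℤ)) _ (by push_cast; ring) _)

end Loop

/-! ### The `N = 2` conformal superalgebra -/

/-- The generators `L, J, G⁺, G⁻` of the `N = 2` conformal superalgebra. -/
inductive N2Gen : Type
  | L | J | Gp | Gm

open N2Gen in
instance : Fintype N2Gen := ⟨⟨[L, J, Gp, Gm], by simp⟩, by rintro (_ | _ | _ | _) <;> simp⟩

open N2Gen in
lemma N2Gen.sum_univ {M : Type*} [AddCommMonoid M] (f : N2Gen → M) :
    ∑ g, f g = f L + (f J + (f Gp + f Gm)) := by
  change (Multiset.map f (↑[L, J, Gp, Gm])).sum = _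
  simp

/-- The underlying space `k[∂] ⊗_k V`, the free `k[∂]`-module on `L, J, G⁺, G⁻`. -/
abbrev N2 (k : Type*) [Field k] : Type _ := N2Gen → Polynomial k

open N2Gen Polynomial in
/-- The structure polynomials: `[a_λ b] = ∑_c (n2Struct a b c) c` for generators `a, b`, where
`λ` is the outer variable `X` and `∂` the inner variable `C X`. The brackets
`[J_λ L]`, `[G^±_λ L]`, `[G^±_λ J]`, `[G⁻_λ G⁺]` are those forced by skew-symmetry
`[b_λ a] = -p(a,b) [a_{-λ-∂} b]`. -/
def n2Struct (k : Type*) [Field k] : N2Gen → N2Gen → N2Gen → Polynomial (Polynomial k)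
  -- `[L_λ L] = (∂ + 2λ) L`
  | L, L, L => C X + 2 * X
  -- `[L_λ J] = (∂ + λ) J`
  | L, J, J => C X + X
  -- `[L_λ G^±] = (∂ + (3/2)λ) G^±`
  | L, Gp, Gp => C X + C (C (3 / 2)) * X
  | L, Gm, Gm => C X + C (C (3 / 2)) * X
  -- `[J_λ L] = λ J`
  | J, L, J => X
  -- `[J_λ G^±] = ± G^±`
  | J, Gp, Gp => 1
  | J, Gm, Gm => -1
  -- `[G^±_λ L] = ((1/2)∂ + (3/2)λ) G^±`
  | Gp, L, Gp => C (C (1 / 2)) * C X + C (C (3 / 2)) * X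
  | Gm, L, Gm => C (C (1 / 2)) * C X + C (C (3 / 2)) * X
  -- `[G^±_λ J] = ∓ G^±`
  | Gp, J, Gp => -1
  | Gm, J, Gm => 1
  -- `[G⁺_λ G⁻] = L + (1/2)(∂ + 2λ) J`
  | Gp, Gm, L => 1
  | Gp, Gm, J => C (C (1 / 2)) * (C X + 2 * X)
  -- `[G⁻_λ G⁺] = L - (1/2)(∂ + 2λ) J`
  | Gm, Gp, L => 1
  | Gm, Gp, J => -(C (C (1 / 2)) * (C X + 2 * X))
  | _, _, _ => 0

open Polynomial in
/-- The `c`-component of the `λ`-bracket, extended from the generators by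
`[p(∂)a_λ q(∂)b] = p(-λ) q(∂ + λ) [a_λ b]`. -/
def n2Bracket (k : Type*) [Field k] (f g : N2 k) (c : N2Gen) : Polynomial (Polynomial k) :=
  ∑ a, ∑ b, aeval (-X : Polynomial (Polynomial k)) (f a) *
    aeval (C X + X : Polynomial (Polynomial k)) (g b) * n2Struct k a b c

open Polynomial in
/-- The classical `N = 2` conformal superalgebra over `k`. Its `n`-products are given by
`[f_λ g] = ∑_n λ^n / n! f_(n) g`. -/
def n2Conformal (k : Type*) [Field k] :
    ConformalSuperalgebra k (0 : Derivation k k k) (N2 k) where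
  even :=
    { carrier := {f | f N2Gen.Gp = 0 ∧ f N2Gen.Gm = 0}
      add_mem' := fun {f g} hf hg => by simp_all
      zero_mem' := by simp
      smul_mem' := fun c f hf => by simp_all }
  odd :=
    { carrier := {f | f N2Gen.L = 0 ∧ f N2Gen.J = 0}
      add_mem' := fun {f g} hf hg => by simp_all
      zero_mem' := by simp
      smul_mem' := fun c f hf => by simp_all }
  isCompl := by
    refine ⟨?_, ?_⟩
    · rw [Submodule.disjoint_def]
      rintro f ⟨h1, h2⟩ ⟨h3, h4⟩
      funext c
      cases c <;> assumption
    · rw [codisjoint_iff, eq_top_iff]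
      intro f _
      refine Submodule.mem_sup.mpr
        ⟨fun | .L => f .L | .J => f .J | _ => 0, ⟨rfl, rfl⟩,
          fun | .Gp => f .Gp | .Gm => f .Gm | _ => 0, ⟨rfl, rfl⟩, ?_⟩
      funext c
      cases c <;> simp
  der :=
    { toFun := fun f c => X * f c
      map_add' := fun f g => by funext c; simp [mul_add]
      map_smul' := fun r f => by funext c; simp }
  der_even := by rintro f ⟨h1, h2⟩; exact ⟨by simp [h1], by simp [h2]⟩
  der_odd := by rintro f ⟨h1, h2⟩; exact ⟨by simp [h1], by simp [h2]⟩
  prod n := LinearMap.mk₂ k (fun f g c => (n.factorial : k) • (n2Bracket k f g c).coeff n)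
    (fun f f' g => by
      funext c
      simp [n2Bracket, add_mul, Finset.sum_add_distrib])
    (fun r f g => by
      funext c
      simp only [n2Bracket, Pi.smul_apply, map_smul, smul_mul_assoc, ← Finset.smul_sum,
        coeff_smul]
      rw [smul_comm])
    (fun f g g' => by
      funext c
      simp [n2Bracket, mul_add, add_mul, Finset.sum_add_distrib])
    (fun r f g => by
      funext c
      simp only [n2Bracket, Pi.smul_apply, map_smul, smul_mul_assoc, mul_smul_comm,
        ← Finset.smul_sum, coeff_smul]
      rw [smul_comm])
  prod_eventually_zero f g := by
    refine ⟨∑ c, ((n2Bracket k f g c).natDegree + 1), fun n hn => ?_⟩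
    funext c
    have h : (n2Bracket k f g c).natDegree + 1 ≤
        ∑ c, ((n2Bracket k f g c).natDegree + 1) :=
      Finset.single_le_sum (f := fun c => (n2Bracket k f g c).natDegree + 1)
        (fun _ _ => Nat.zero_le _) (Finset.mem_univ c)
    simp only [LinearMap.mk₂_apply, Pi.zero_apply]
    rw [coeff_eq_zero_of_natDegree_lt (by omega), smul_zero]
  der_prod n f g := by
    funext c
    have h : n2Bracket k (fun c => X * f c) g c = -(X * n2Bracket k f g c) := by
      simp only [n2Bracket, map_mul, aeval_X, Finset.mul_sum, ← Finset.sum_neg_distrib]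
      refine Finset.sum_congr rfl fun a _ => Finset.sum_congr rfl fun b _ => ?_
      ring
    simp only [LinearMap.coe_mk, AddHom.coe_mk, LinearMap.mk₂_apply, Pi.neg_apply,
      Pi.smul_apply, h, coeff_neg, smul_neg]
    cases n with
    | zero => simp
    | succ n => rw [coeff_X_mul, smul_smul, Nat.factorial_succ, Nat.cast_mul]; rfl
  prod_der n f g := by
    funext c
    have h : n2Bracket k f (fun c => X * g c) c =
        C X * n2Bracket k f g c + X * n2Bracket k f g c := by
      simp only [n2Bracket, map_mul, aeval_X, Finset.mul_sum, ← Finset.sum_add_distrib]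
      refine Finset.sum_congr rfl fun a _ => Finset.sum_congr rfl fun b _ => ?_
      ring
    simp only [LinearMap.coe_mk, AddHom.coe_mk, LinearMap.mk₂_apply, Pi.add_apply,
      Pi.smul_apply, h, coeff_add, coeff_C_mul, smul_add, mul_smul_comm]
    congr 1
    cases n with
    | zero => simp
    | succ n => rw [coeff_X_mul, smul_smul, Nat.factorial_succ, Nat.cast_mul]; rfl
  der_smul r f := by simp
  prod_smul n r f g := by simp
  smul_prod n r f g := by
    rw [finsum_eq_range _ 1]
    · simp [dividedPow_zero]
    · intro j hj
      obtain ⟨i, rfl⟩ : ∃ i, j = i + 1 := ⟨j - 1, by omega⟩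
      simp [dividedPow, pow_succ]

/-- The map `L ↦ L, J ↦ -J, G⁺ ↦ G⁻, G⁻ ↦ G⁺`, extended `k[∂]`-linearly. -/
def n2OmegaFun (k : Type*) [Field k] (f : N2 k) : N2 k
  | .L => f .L
  | .J => -f .J
  | .Gp => f .Gm
  | .Gm => f .Gp

lemma n2OmegaFun_invol (k : Type*) [Field k] (f : N2 k) : n2OmegaFun k (n2OmegaFun k f) = f := by
  funext c
  cases c <;> simp [n2OmegaFun]

lemma n2Bracket_omega (k : Type*) [Field k] (f g : N2 k) :
    n2Bracket k (n2OmegaFun k f) (n2OmegaFun k g) .L = n2Bracket k f g .L ∧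
    n2Bracket k (n2OmegaFun k f) (n2OmegaFun k g) .J = -n2Bracket k f g .J ∧
    n2Bracket k (n2OmegaFun k f) (n2OmegaFun k g) .Gp = n2Bracket k f g .Gm ∧
    n2Bracket k (n2OmegaFun k f) (n2OmegaFun k g) .Gm = n2Bracket k f g .Gp := by
  refine ⟨?_, ?_, ?_, ?_⟩ <;>
  · simp only [n2Bracket, N2Gen.sum_univ, n2OmegaFun, n2Struct, map_neg, mul_zero, add_zero,
      zero_add]
    ring

/-- The automorphism `ω` of the `N = 2` conformal superalgebra. -/
def n2Omega (k : Type*) [Field k] : ConformalEquiv (n2Conformal k) (n2Conformal k) where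
  toFun := n2OmegaFun k
  invFun := n2OmegaFun k
  left_inv := n2OmegaFun_invol k
  right_inv := n2OmegaFun_invol k
  map_add' f g := by
    funext c
    cases c <;> simp [n2OmegaFun, add_comm]
  map_smul' r f := by
    funext c
    cases c <;> simp [n2OmegaFun]
  map_even := by rintro f ⟨h1, h2⟩; exact ⟨h2, h1⟩
  map_odd := by rintro f ⟨h1, h2⟩; exact ⟨h1, by simp [n2OmegaFun, h2]⟩
  map_prod n f g := by
    change n2OmegaFun k (fun c => (n.factorial : k) • (n2Bracket k f g c).coeff n) =
      fun c => (n.factorial : k) • (n2Bracket k (n2OmegaFun k f) (n2OmegaFun k g) c).coeff n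
    funext c
    cases c
    · change (n.factorial : k) • (n2Bracket k f g .L).coeff n = _
      rw [(n2Bracket_omega k f g).1]
    · change -((n.factorial : k) • (n2Bracket k f g .J).coeff n) = _
      rw [(n2Bracket_omega k f g).2.1, Polynomial.coeff_neg, smul_neg]
    · change (n.factorial : k) • (n2Bracket k f g .Gm).coeff n = _
      rw [(n2Bracket_omega k f g).2.2.1]
    · change (n.factorial : k) • (n2Bracket k f g .Gp).coeff n = _
      rw [(n2Bracket_omega k f g).2.2.2]
  map_der f := by
    change n2OmegaFun k (fun c => Polynomial.X * f c) =
      fun c => Polynomial.X * n2OmegaFun k f c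
    funext c
    cases c <;> simp [n2OmegaFun]

/-- `ω` has period `2`. -/
lemma n2Omega_period (k : Type*) [Field k] (f : N2 k) :
    (n2Omega k).toLinearEquiv^[2] f = f :=
  n2OmegaFun_invol k f

end Defs

end

/-! Write Ŝ = k[t^q | q ∈ ℚ] and R = k[t, t⁻¹]. The roots of unity give a character χ(i/m) = ξ_m^i
of ℚ with kernel ℤ, hence an R-automorphism γ of Ŝ, t^q ↦ χ(q) t^q, which commutes with d/dt and has
ring of invariants R. The classification is Galois descent along the procyclic group generated by γ.

Both kinds of objects to be classified embed in A ⊗ Ŝ as the fixed points of an injective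
γ-semilinear endomorphism T that preserves all the conformal structure. For L(A, σ) take T = γ ⊗ σ⁻¹
(`mem_loopSubmodule_iff`). For a form F, transport γ ⊗ 1 from Ŝ ⊗ F through the given isomorphism;
its invariants are F by averaging over finite orbits (`exists_one_tmul_of_twistMap_eq`). In both
cases G⁺ has a finite T-orbit. It remains to conjugate T to γ ⊗ 1 or γ ⊗ ω by an automorphism of A ⊗
Ŝ, since an automorphism carries fixed points to fixed points (`isoOver_id_or_omega`).

The key to T is an intrinsic description of J (`eq_J_or_eq_neg_J`): over a domain, an even x with
[x_λ x] = 0 and a nonzero odd y with [x_λ y] = y must satisfy x = J and y ∈ S G⁺, or x = -J and y ∈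
S G⁻. This follows by comparing leading coefficients in λ. Applied to T(J), it shows that T either
preserves or exchanges the lines of G⁺ and G⁻, with coefficients α and α' inverse to each other
(`isSemiHom_cases`). Units of Ŝ are monomials, so α = c t^q. Since G⁺ and G⁻ generate A, T is now
known completely (`isSemiHom_ext`).

Every unit β gives an automorphism G^± ↦ β^{±1} G^± (`n2Torus`), and conjugating by it normalizes α
(`exists_conj`). If the lines are preserved, the finite orbit forces q = 0 and makes c a root of
unity, so c = χ(p) for some p, and β = t^{-p} conjugates T to γ ⊗ 1. If they are exchanged, the
equation γ(β) α = β⁻¹ is solved by a monomial β of exponent -q/2 whose coefficient is a square root,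
and T becomes γ ⊗ ω.

The two algebras are distinguished by the same description of J, which mentions only parity and
products and so is visible to isomorphisms that are merely k-linear. Such an isomorphism would send
J ∈ L(A, id) to J or -J inside L(A, ω), but neither lies there because ω(J) = -J
(`not_isoOverBase`). -/

noncomputable section

namespace ConformalSuperalgebra

/-! ### Semilinear homomorphisms of conformal superalgebras -/

section SemiHom

variable {k : Type*} [Field k] {S : Type*} [CommRing S] [Algebra k S] {δ : Derivation k S S}
  {A : Type*} [AddCommGroup A] [Module k A] [Module S A] [IsScalarTower k S A]
  {B : Type*} [AddCommGroup B] [Module k B] [Module S B] [IsScalarTower k S B]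
  {C : Type*} [AddCommGroup C] [Module k C] [Module S C] [IsScalarTower k S C]

/-- A homomorphism of `(S, δ)`-conformal superalgebras that is semilinear with respect to an
endomorphism `γ` of `S`. -/
structure IsSemiHom (γ : S →ₐ[k] S) (SA : ConformalSuperalgebra k δ A)
    (SB : ConformalSuperalgebra k δ B) (f : A →+ B) : Prop where
  map_smul : ∀ (s : S) a, f (s • a) = γ s • f a
  map_even : ∀ a ∈ SA.even, f a ∈ SB.even
  map_odd : ∀ a ∈ SA.odd, f a ∈ SB.odd
  map_der : ∀ a, f (SA.der a) = SB.der (f a)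
  map_prod : ∀ n a b, f (SA.prod n a b) = SB.prod n (f a) (f b)

lemma semilinear_map_smul_base {γ : S →ₐ[k] S} {f : A →+ B}
    (hf : ∀ (s : S) a, f (s • a) = γ s • f a) (c : k) (a : A) : f (c • a) = c • f a := by
  rw [← algebraMap_smul S c a, hf, γ.commutes, algebraMap_smul]

/-- The divided powers of `δ` enter the formula for the products of `s • a`, so compatibility of a
semilinear map with products rests on this. -/
lemma dividedPow_commute {γ : S →ₐ[k] S} (hγ : ∀ s, γ (δ s) = δ (γ s)) (j : ℕ) (s : S) :
    dividedPow (δ : S →ₗ[k] S) j (γ s) = γ (dividedPow (δ : S →ₗ[k] S) j s) := by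
  have h : ∀ s, ((δ : S →ₗ[k] S) ^ j) (γ s) = γ (((δ : S →ₗ[k] S) ^ j) s) := by
    induction j with
    | zero => simp
    | succ j ih => intro s; simp [pow_succ, ← hγ, ih]
  simp only [dividedPow, LinearMap.smul_apply, h, map_smul]

lemma smul_prod_range (SA : ConformalSuperalgebra k δ A) (n : ℕ) (s : S) (a b : A) (M : ℕ)
    (hM : ∀ m, M ≤ m → SA.prod m a b = 0) :
    SA.prod n (s • a) b =
      ∑ j ∈ Finset.range M, dividedPow (δ : S →ₗ[k] S) j s • SA.prod (n + j) a b := by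
  rw [SA.smul_prod, finsum_eq_range _ M]
  intro j hj
  rw [hM _ (by omega), smul_zero]

/-- A semilinear map that commutes with the derivations on a spanning set commutes with them
everywhere. -/
lemma semilinear_map_der {γ : S →ₐ[k] S} (hγ : ∀ s, γ (δ s) = δ (γ s))
    {SA : ConformalSuperalgebra k δ A} {SB : ConformalSuperalgebra k δ B} {f : A →+ B}
    (hf : ∀ (s : S) a, f (s • a) = γ s • f a) {X : Set A} (hX : Submodule.span S X = ⊤)
    (hder : ∀ a ∈ X, f (SA.der a) = SB.der (f a)) (a : A) : f (SA.der a) = SB.der (f a) := by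
  have ha : a ∈ Submodule.span S X := hX ▸ Submodule.mem_top
  induction ha using Submodule.span_induction with
  | mem x h => exact hder x h
  | zero => simp
  | add x y _ _ hx hy => simp only [map_add, hx, hy]
  | smul s x _ hx => rw [SA.der_smul, map_add, hf, hf, hf, SB.der_smul, hx, hγ]

/-- A semilinear map that preserves the `n`-products on a spanning set preserves them
everywhere. -/
lemma semilinear_map_prod {γ : S →ₐ[k] S} (hγ : ∀ s, γ (δ s) = δ (γ s))
    {SA : ConformalSuperalgebra k δ A} {SB : ConformalSuperalgebra k δ B} {f : A →+ B}
    (hf : ∀ (s : S) a, f (s • a) = γ s • f a) {X : Set A} (hX : Submodule.span S X = ⊤)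
    (hprod : ∀ n, ∀ a ∈ X, ∀ b ∈ X, f (SA.prod n a b) = SB.prod n (f a) (f b)) (n : ℕ) (a b : A) :
    f (SA.prod n a b) = SB.prod n (f a) (f b) := by
  have ha : a ∈ Submodule.span S X := hX ▸ Submodule.mem_top
  have hb : b ∈ Submodule.span S X := hX ▸ Submodule.mem_top
  induction ha using Submodule.span_induction generalizing n with
  | mem x h =>
    induction hb using Submodule.span_induction with
    | mem y h' => exact hprod n x h y h'
    | zero => simp
    | add y z _ _ hy hz => simp only [map_add, hy, hz]
    | smul s y _ hy => rw [SA.prod_smul, hf, hf, SB.prod_smul, hy]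
  | zero => simp
  | add x y _ _ hx hy => simp only [map_add, LinearMap.add_apply, hx, hy]
  | smul s x _ hx =>
    -- One bound `M` truncates the sums on both sides, because `f` carries the vanishing products of
    -- `x` and `b` to the products of their images. The products of index `n + j` that occur are the
    -- reason for generalizing over `n`.
    obtain ⟨M, hM⟩ := SA.prod_eventually_zero x b
    rw [smul_prod_range SA n s x b M hM, hf, smul_prod_range SB n (γ s) (f x) (f b) M
      (fun m hm => by rw [← hx, hM m hm, map_zero]), map_sum]
    exact Finset.sum_congr rfl fun j _ => by rw [hf, hx, dividedPow_commute hγ]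

lemma IsSemiHom.comp {γ γ' : S →ₐ[k] S} {SA : ConformalSuperalgebra k δ A}
    {SB : ConformalSuperalgebra k δ B} {SC : ConformalSuperalgebra k δ C} {g : B →+ C}
    {f : A →+ B} (hg : IsSemiHom γ' SB SC g) (hf : IsSemiHom γ SA SB f) :
    IsSemiHom (γ'.comp γ) SA SC (g.comp f) where
  map_smul s a := by simp [hf.map_smul, hg.map_smul]
  map_even a ha := hg.map_even _ (hf.map_even a ha)
  map_odd a ha := hg.map_odd _ (hf.map_odd a ha)
  map_der a := by simp [hf.map_der, hg.map_der]
  map_prod n a b := by simp [hf.map_prod, hg.map_prod]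

lemma _root_.ConformalEquiv.isSemiHom {SA : ConformalSuperalgebra k δ A}
    {SB : ConformalSuperalgebra k δ B} (e : ConformalEquiv SA SB) :
    IsSemiHom (AlgHom.id k S) SA SB (e.toLinearEquiv : A →+ B) where
  map_smul s a := e.toLinearEquiv.map_smul s a
  map_even := e.map_even
  map_odd := e.map_odd
  map_der := e.map_der
  map_prod := e.map_prod

/-- The inverse of an isomorphism of conformal superalgebras. -/
def _root_.ConformalEquiv.symm {SA : ConformalSuperalgebra k δ A}
    {SB : ConformalSuperalgebra k δ B} (e : ConformalEquiv SA SB) : ConformalEquiv SB SA where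
  toLinearEquiv := e.toLinearEquiv.symm
  map_even b hb := by
    -- Parity of the inverse uses the decomposition of the preimage: the image of its odd part is
    -- both odd and even, hence zero.
    have h : e.toLinearEquiv.symm b ∈ SA.even ⊔ SA.odd := by rw [SA.isCompl.sup_eq_top]; trivial
    obtain ⟨x, hx, y, hy, hxy⟩ := Submodule.mem_sup.mp h
    have hb' : b = e.toLinearEquiv x + e.toLinearEquiv y := by rw [← map_add, hxy]; simp
    have hy' : e.toLinearEquiv y = 0 := by
      refine Submodule.disjoint_def.mp SB.isCompl.disjoint _ ?_ (e.map_odd y hy)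
      rw [← add_sub_cancel_left (e.toLinearEquiv x) (e.toLinearEquiv y), ← hb']
      exact sub_mem hb (e.map_even x hx)
    have : e.toLinearEquiv.symm b = x := by rw [hb', hy', add_zero]; simp
    exact (congrArg (· ∈ SA.even) this).mpr hx
  map_odd b hb := by
    have h : e.toLinearEquiv.symm b ∈ SA.even ⊔ SA.odd := by rw [SA.isCompl.sup_eq_top]; trivial
    obtain ⟨x, hx, y, hy, hxy⟩ := Submodule.mem_sup.mp h
    have hb' : b = e.toLinearEquiv x + e.toLinearEquiv y := by rw [← map_add, hxy]; simp
    have hx' : e.toLinearEquiv x = 0 := by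
      refine Submodule.disjoint_def.mp SB.isCompl.disjoint _ (e.map_even x hx) ?_
      rw [← add_sub_cancel_right (e.toLinearEquiv x) (e.toLinearEquiv y), ← hb']
      exact sub_mem hb (e.map_odd y hy)
    have : e.toLinearEquiv.symm b = y := by rw [hb', hx', zero_add]; simp
    exact (congrArg (· ∈ SA.odd) this).mpr hy
  map_prod n a b := by
    apply e.toLinearEquiv.injective
    have := e.map_prod n (e.toLinearEquiv.symm a) (e.toLinearEquiv.symm b)
    refine (LinearEquiv.apply_symm_apply _ _).trans (Eq.trans ?_ this.symm)
    congr 2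
    · exact (e.toLinearEquiv.apply_symm_apply a).symm
    · exact (e.toLinearEquiv.apply_symm_apply b).symm
  map_der a := by
    apply e.toLinearEquiv.injective
    have := e.map_der (e.toLinearEquiv.symm a)
    refine (LinearEquiv.apply_symm_apply _ _).trans (Eq.trans ?_ this.symm)
    exact congrArg SB.der (e.toLinearEquiv.apply_symm_apply a).symm

/-- The composite of two isomorphisms of conformal superalgebras. -/
def _root_.ConformalEquiv.trans {SA : ConformalSuperalgebra k δ A}
    {SB : ConformalSuperalgebra k δ B} {SC : ConformalSuperalgebra k δ C}
    (e : ConformalEquiv SA SB) (e' : ConformalEquiv SB SC) : ConformalEquiv SA SC where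
  toLinearEquiv := e.toLinearEquiv.trans e'.toLinearEquiv
  map_even a ha := e'.map_even _ (e.map_even a ha)
  map_odd a ha := e'.map_odd _ (e.map_odd a ha)
  map_prod n a b := (congrArg e'.toFun (e.map_prod n a b)).trans (e'.map_prod n _ _)
  map_der a := (congrArg e'.toFun (e.map_der a)).trans (e'.map_der _)

/-- Conjugation of an additive endomorphism by an isomorphism of conformal superalgebras. -/
def _root_.ConformalEquiv.conj {SA : ConformalSuperalgebra k δ A}
    {SB : ConformalSuperalgebra k δ B} (φ : ConformalEquiv SA SB) (Γ : A →+ A) : B →+ B :=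
  ((φ.toLinearEquiv : A →+ B).comp Γ).comp (φ.symm.toLinearEquiv : B →+ A)

section Conj

variable {SA : ConformalSuperalgebra k δ A} {SB : ConformalSuperalgebra k δ B}
  (φ : ConformalEquiv SA SB) {Γ : A →+ A}

lemma _root_.ConformalEquiv.isSemiHom_conj {γ : S →ₐ[k] S} (hΓ : IsSemiHom γ SA SA Γ) :
    IsSemiHom γ SB SB (φ.conj Γ) :=
  (φ.isSemiHom.comp hΓ).comp φ.symm.isSemiHom

lemma _root_.ConformalEquiv.conj_apply (x : A) :
    φ.conj Γ (φ.toLinearEquiv x) = φ.toLinearEquiv (Γ x) :=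
  congrArg (fun y => φ.toLinearEquiv (Γ y)) (φ.toLinearEquiv.symm_apply_apply x)

lemma _root_.ConformalEquiv.conj_iterate_apply (n : ℕ) (x : A) :
    (φ.conj Γ)^[n] (φ.toLinearEquiv x) = φ.toLinearEquiv (Γ^[n] x) := by
  induction n with
  | zero => rfl
  | succ n ih =>
    rw [Function.iterate_succ_apply', ih, φ.conj_apply, Function.iterate_succ_apply']

lemma _root_.ConformalEquiv.conj_injective (hΓ : Function.Injective Γ) :
    Function.Injective (φ.conj Γ) :=
  (φ.toLinearEquiv.injective.comp hΓ).comp φ.toLinearEquiv.symm.injective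

end Conj

end SemiHom

/-! ### Semilinear maps on base changes, and transitivity of base change -/

section BaseChangeMaps

variable {k : Type*} [Field k] [CharZero k]
  {R : Type*} [CommRing R] [Algebra k R] {δR : Derivation k R R}
  {S : Type*} [CommRing S] [Algebra k S] {δS : Derivation k S S}
  [Algebra R S] [IsScalarTower k R S]
  {A : Type*} [AddCommGroup A] [Module k A] [Module R A] [IsScalarTower k R A]

lemma span_one_tmul : Submodule.span S (Set.range fun a : A => (1 : S) ⊗ₜ[R] a) = ⊤ := by
  rw [eq_top_iff]
  rintro x -
  induction x using TensorProduct.induction_on with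
  | zero => exact zero_mem _
  | add x y hx hy => exact add_mem hx hy
  | tmul s a =>
    rw [← mul_one s, ← smul_eq_mul, ← TensorProduct.smul_tmul']
    exact Submodule.smul_mem _ _ (Submodule.subset_span ⟨a, rfl⟩)

omit [CharZero k] in
lemma dividedPow_one (δ : Derivation k S S) (j : ℕ) :
    dividedPow (δ : S →ₗ[k] S) (j + 1) 1 = 0 := by
  simp [dividedPow, pow_succ]

/-- The positive divided powers of the derivation kill `1`. Since the elements `1 ⊗ a` span the base
change over `S`, compatibility with products can be tested on the original algebra. -/
lemma baseChange_prod_one_tmul (hδ : ∀ r, δS (algebraMap R S r) = algebraMap R S (δR r))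
    (SA : ConformalSuperalgebra k δR A) (n : ℕ) (a b : A) :
    (SA.baseChange hδ).prod n (1 ⊗ₜ a) (1 ⊗ₜ b) = (1 : S) ⊗ₜ[R] SA.prod n a b := by
  change bcOp δS SA n 1 a (1 ⊗ₜ b) = _
  rw [bcOp_tmul, one_smul, finsum_eq_range _ 1]
  · simp [dividedPow_zero]
  · intro j hj
    obtain ⟨i, rfl⟩ : ∃ i, j = i + 1 := ⟨j - 1, by omega⟩
    rw [dividedPow_one, TensorProduct.zero_tmul]

lemma baseChange_der_one_tmul (hδ : ∀ r, δS (algebraMap R S r) = algebraMap R S (δR r))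
    (SA : ConformalSuperalgebra k δR A) (a : A) :
    (SA.baseChange hδ).der (1 ⊗ₜ a) = (1 : S) ⊗ₜ[R] SA.der a := by
  change bcDer hδ SA _ = _
  rw [bcDer_tmul]
  simp

/-- The semilinear map `γ ⊗ τ` of a base change. -/
def twistMap (γ : S →ₐ[R] S) (τ : A →ₗ[R] A) : S ⊗[R] A →+ S ⊗[R] A :=
  (TensorProduct.map γ.toLinearMap τ).toAddMonoidHom

omit [CharZero k] in
lemma twistMap_tmul (γ : S →ₐ[R] S) (τ : A →ₗ[R] A) (s : S) (a : A) :
    twistMap γ τ (s ⊗ₜ a) = γ s ⊗ₜ[R] τ a := rfl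

omit [CharZero k] in
lemma twistMap_smul (γ : S →ₐ[R] S) (τ : A →ₗ[R] A) (s : S) (x : S ⊗[R] A) :
    twistMap γ τ (s • x) = γ s • twistMap γ τ x := by
  induction x using TensorProduct.induction_on with
  | zero => simp
  | add x y hx hy => simp only [smul_add, map_add, hx, hy]
  | tmul t a => simp only [TensorProduct.smul_tmul', twistMap_tmul, smul_eq_mul, map_mul]

omit [CharZero k] in
lemma twistMap_mem (γ : S →ₐ[R] S) (τ : A →ₗ[R] A) (P : Submodule R A) (hP : ∀ a ∈ P, τ a ∈ P)
    (x : S ⊗[R] A) (hx : x ∈ P.baseChange S) : twistMap γ τ x ∈ P.baseChange S := by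
  rw [Submodule.baseChange_eq_span] at hx
  induction hx using Submodule.span_induction with
  | mem x h =>
    obtain ⟨a, ha, rfl⟩ := h
    exact Submodule.tmul_mem_baseChange_of_mem _ (hP a ha)
  | zero => rw [map_zero]; exact zero_mem _
  | add x y _ _ hx hy => rw [map_add]; exact add_mem hx hy
  | smul c x _ hx => rw [twistMap_smul]; exact Submodule.smul_mem _ _ hx

/-- `γ ⊗ τ` is a semilinear homomorphism if `γ` is an endomorphism of the differential algebra `S`
over `R` and `τ` an endomorphism of the conformal superalgebra. -/
lemma isSemiHom_twistMap (hδ : ∀ r, δS (algebraMap R S r) = algebraMap R S (δR r))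
    (SA : ConformalSuperalgebra k δR A) (γ : S →ₐ[R] S) (hγ : ∀ s, γ (δS s) = δS (γ s))
    (τ : A →ₗ[R] A) (hτ : IsSemiHom (AlgHom.id k R) SA SA (τ : A →+ A)) :
    IsSemiHom (γ.restrictScalars k) (SA.baseChange hδ) (SA.baseChange hδ) (twistMap γ τ) := by
  refine ⟨twistMap_smul γ τ, twistMap_mem γ τ _ hτ.map_even, twistMap_mem γ τ _ hτ.map_odd,
    ?_, ?_⟩
  · refine semilinear_map_der (γ := γ.restrictScalars k) hγ (twistMap_smul γ τ) span_one_tmul ?_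
    rintro _ ⟨a, rfl⟩
    have h : τ (SA.der a) = SA.der (τ a) := hτ.map_der a
    simp only [baseChange_der_one_tmul, twistMap_tmul, map_one, h]
  · refine semilinear_map_prod (γ := γ.restrictScalars k) hγ (twistMap_smul γ τ)
      span_one_tmul ?_
    rintro n _ ⟨a, rfl⟩ _ ⟨b, rfl⟩
    have h : τ (SA.prod n a b) = SA.prod n (τ a) (τ b) := hτ.map_prod n a b
    simp only [baseChange_prod_one_tmul, twistMap_tmul, map_one, h]

/-- Transitivity of base change. -/
def baseChangeTrans {δk : Derivation k k k} {A : Type*} [AddCommGroup A] [Module k A]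
    (hδ : ∀ r, δS (algebraMap R S r) = algebraMap R S (δR r))
    (hR : ∀ c, δR (algebraMap k R c) = algebraMap k R (δk c))
    (hS : ∀ c, δS (algebraMap k S c) = algebraMap k S (δk c))
    (SA : ConformalSuperalgebra k δk A) :
    ConformalEquiv ((SA.baseChange hR).baseChange hδ) (SA.baseChange hS) :=
  let e := TensorProduct.AlgebraTensorModule.cancelBaseChange k R S S A
  have he : ∀ a : A, e (1 ⊗ₜ (1 ⊗ₜ a)) = 1 ⊗ₜ a := fun a => by simp [e]
  -- Transporting the spanning family `1 ⊗ a` back through `e` reduces compatibility with the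
  -- derivation and the products to elements on which both are explicit.
  have hspan : Submodule.span S (Set.range fun a : A => (1 : S) ⊗ₜ[R] ((1 : R) ⊗ₜ[k] a)) = ⊤ := by
    rw [← (Submodule.map_injective_of_injective e.injective).eq_iff, Submodule.map_span,
      ← Set.range_comp]
    have : (⇑e.toLinearMap ∘ fun a : A => (1 : S) ⊗ₜ[R] ((1 : R) ⊗ₜ[k] a)) =
        fun a => 1 ⊗ₜ a := funext he
    simp only [LinearEquiv.coe_coe] at this
    erw [this]
    rw [span_one_tmul, Submodule.map_top, LinearMap.range_eq_top.mpr e.surjective]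
  have hmem : ∀ P : Submodule k A, ∀ x ∈ (P.baseChange R).baseChange S, e x ∈ P.baseChange S := by
    intro P x hx
    rw [Submodule.baseChange_eq_span] at hx
    induction hx using Submodule.span_induction with
    | mem x h =>
      obtain ⟨y, hy, rfl⟩ := h
      change y ∈ P.baseChange R at hy
      rw [Submodule.baseChange_eq_span] at hy
      induction hy using Submodule.span_induction with
      | mem y h =>
        obtain ⟨a, ha, rfl⟩ := h
        have : e (1 ⊗ₜ (1 ⊗ₜ a)) ∈ P.baseChange S := by
          rw [he]; exact Submodule.tmul_mem_baseChange_of_mem _ ha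
        exact this
      | zero => simp
      | add x y _ _ hx hy =>
        simp only [map_add]
        exact add_mem hx hy
      | smul c x _ hx =>
        have : e ((TensorProduct.mk R S (R ⊗[k] A)) 1 (c • x)) =
            algebraMap R S c • e ((TensorProduct.mk R S (R ⊗[k] A)) 1 x) := by
          rw [map_smul, ← algebraMap_smul S, map_smul]
        rw [this]
        exact Submodule.smul_mem _ _ hx
    | zero => rw [map_zero]; exact zero_mem _
    | add x y _ _ hx hy => rw [map_add]; exact add_mem hx hy
    | smul c x _ hx => rw [map_smul]; exact Submodule.smul_mem _ _ hx
  { toLinearEquiv := e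
    map_even := hmem _
    map_odd := hmem _
    map_der := by
      refine semilinear_map_der (γ := AlgHom.id k S) (fun _ => rfl)
        (f := (e : S ⊗[R] (R ⊗[k] A) →+ S ⊗[k] A)) (fun s a => map_smul e s a) hspan ?_
      rintro _ ⟨a, rfl⟩
      change e _ = (SA.baseChange hS).der (e _)
      rw [baseChange_der_one_tmul, baseChange_der_one_tmul, he, he, baseChange_der_one_tmul]
    map_prod := by
      refine semilinear_map_prod (γ := AlgHom.id k S) (fun _ => rfl)
        (f := (e : S ⊗[R] (R ⊗[k] A) →+ S ⊗[k] A)) (fun s a => map_smul e s a) hspan ?_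
      rintro n _ ⟨a, rfl⟩ _ ⟨b, rfl⟩
      change e _ = (SA.baseChange hS).prod n (e _) (e _)
      rw [baseChange_prod_one_tmul, baseChange_prod_one_tmul, he, he, he,
        baseChange_prod_one_tmul] }

end BaseChangeMaps

end ConformalSuperalgebra

end

noncomputable section

open ConformalSuperalgebra

/-! ### The character of ℚ defined by the compatible roots of unity -/

section RootCharacter

variable {k : Type*} [Field k] {ξ : ℕ → k}

/-- Reducing i/m to lowest terms cancels a factor l, and compatibility gives ξ_m^l = ξ_d for the
reduced denominator d. Hence ξ_m^i depends only on the fraction. -/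
lemma root_zpow_den (hcompat : ∀ l m, 0 < l → 0 < m → ξ (l * m) ^ l = ξ m) (m : ℕ) (hm : 0 < m)
    (i : ℤ) : ξ ((i / m : ℚ).den) ^ ((i / m : ℚ).num) = ξ m ^ i := by
  set q : ℚ := i / m with hq
  have hm' : (m : ℚ) ≠ 0 := by exact_mod_cast hm.ne'
  obtain ⟨l, hl⟩ : q.den ∣ m := by
    have h := Rat.den_dvd i m
    rw [Rat.divInt_eq_div, Int.cast_natCast, ← hq] at h
    exact_mod_cast h
  have hl0 : 0 < l := Nat.pos_of_ne_zero (by rintro rfl; simp at hl; omega)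
  have hi : i = l * q.num := by
    have h1 : q * m = i := by rw [hq]; field_simp
    have h2 : q * q.den = q.num := Rat.mul_den_eq_num q
    have h3 : (i : ℚ) = l * q.num := by
      rw [← h1, ← h2]
      conv_lhs => rw [hl]
      push_cast
      ring
    exact_mod_cast h3
  have h := hcompat l q.den hl0 q.den_pos
  rw [mul_comm, ← hl] at h
  rw [hi, zpow_mul, zpow_natCast, h]

/-- The character `i / m ↦ ξ_m ^ i` of `ℚ` attached to a compatible family of primitive roots of
unity. -/
def rootChar (hξ : ∀ m, 0 < m → IsPrimitiveRoot (ξ m) m)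
    (hcompat : ∀ l m, 0 < l → 0 < m → ξ (l * m) ^ l = ξ m) : Multiplicative ℚ →* k where
  toFun q := ξ q.toAdd.den ^ q.toAdd.num
  map_one' := by simp
  map_mul' p q := by
    obtain ⟨p, rfl⟩ := Multiplicative.ofAdd.surjective p
    obtain ⟨q, rfl⟩ := Multiplicative.ofAdd.surjective q
    -- All three values of the character are computed over the common denominator `p.den * q.den`,
    -- where multiplicativity is the addition of exponents.
    have hN : 0 < p.den * q.den := Nat.mul_pos p.den_pos q.den_pos
    have hpd : (p.den : ℚ) ≠ 0 := by exact_mod_cast p.den_ne_zero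
    have hqd : (q.den : ℚ) ≠ 0 := by exact_mod_cast q.den_ne_zero
    have hp : p = ((p.num * q.den : ℤ) : ℚ) / ((p.den * q.den : ℕ) : ℚ) := by
      push_cast
      rw [← Rat.mul_den_eq_num p]
      field_simp
    have hq : q = ((q.num * p.den : ℤ) : ℚ) / ((p.den * q.den : ℕ) : ℚ) := by
      push_cast
      rw [← Rat.mul_den_eq_num q]
      field_simp
    have hpq : p + q = ((p.num * q.den + q.num * p.den : ℤ) : ℚ) / ((p.den * q.den : ℕ) : ℚ) := by
      rw [Int.cast_add, add_div, ← hp, ← hq]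
    have e1 := root_zpow_den hcompat _ hN (p.num * q.den)
    have e2 := root_zpow_den hcompat _ hN (q.num * p.den)
    have e3 := root_zpow_den hcompat _ hN (p.num * q.den + q.num * p.den)
    rw [← hp] at e1
    rw [← hq] at e2
    rw [← hpq] at e3
    simp only [toAdd_mul, toAdd_ofAdd]
    rw [e1, e2, e3, zpow_add₀ ((hξ _ hN).ne_zero hN.ne')]

variable (hξ : ∀ m, 0 < m → IsPrimitiveRoot (ξ m) m)
  (hcompat : ∀ l m, 0 < l → 0 < m → ξ (l * m) ^ l = ξ m)

lemma rootChar_div (m : ℕ) (hm : 0 < m) (i : ℤ) :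
    rootChar hξ hcompat (.ofAdd (i / m : ℚ)) = ξ m ^ i :=
  root_zpow_den hcompat m hm i

lemma rootChar_intCast (n : ℤ) : rootChar hξ hcompat (.ofAdd (n : ℚ)) = 1 := by
  have h := rootChar_div hξ hcompat 1 one_pos n
  have h1 : ξ 1 = 1 := IsPrimitiveRoot.one_right_iff.mp (hξ 1 one_pos)
  simpa [h1] using h

/-- The order of ξ_d is exactly the denominator d of q, so the value 1 forces d to divide the
numerator. Thus the character has kernel ℤ, and γ fixes no monomials beyond those of k[t, t⁻¹]. -/
lemma exists_int_of_rootChar_eq_one {q : ℚ} (h : rootChar hξ hcompat (.ofAdd q) = 1) :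
    ∃ n : ℤ, q = n := by
  have h' : ξ q.den ^ q.num = 1 := h
  obtain ⟨l, hl⟩ := ((hξ q.den q.den_pos).zpow_eq_one_iff_dvd _).mp h'
  refine ⟨l, ?_⟩
  have hd : (q.den : ℚ) ≠ 0 := by exact_mod_cast q.den_ne_zero
  have h2 : q * q.den = q.num := Rat.mul_den_eq_num q
  apply mul_right_cancel₀ hd
  rw [h2, hl]
  push_cast
  ring

end RootCharacter

/-! ### Automorphisms of Ŝ over R, and Ŝ as an extension of R -/

section TwistHom

variable {k : Type*} [Field k]

/-- The automorphism `t^q ↦ χ(q) t^q` of `k[t^q | q ∈ ℚ]` attached to a character `χ` of `ℚ` that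
is trivial on `ℤ`. -/
def twistHom (χ : Multiplicative ℚ →* k) (hχ : ∀ n : ℤ, χ (.ofAdd (n : ℚ)) = 1) :
    RatLaurent k →ₐ[LaurentPolynomial k] RatLaurent k :=
  let f : RatLaurent k →ₐ[k] RatLaurent k := AddMonoidAlgebra.lift k (RatLaurent k) ℚ
    { toFun := fun q => AddMonoidAlgebra.single q.toAdd (χ q)
      map_one' := by rw [map_one χ]; rfl
      map_mul' := fun p q => by
        rw [AddMonoidAlgebra.single_mul_single, map_mul χ]; rfl }
  { f with
    commutes' := fun r => by
      change f _ = _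
      induction r using AddMonoidAlgebra.induction_linear with
      | zero => simp
      | add x y hx hy => simp only [map_add, hx, hy]
      | single n a =>
        rw [algebraMap_ratLaurent_single]
        simp [f, hχ] }

variable (χ : Multiplicative ℚ →* k) (hχ : ∀ n : ℤ, χ (.ofAdd (n : ℚ)) = 1)

lemma twistHom_single (q : ℚ) (c : k) : twistHom χ hχ (AddMonoidAlgebra.single q c) =
    AddMonoidAlgebra.single q (c * χ (.ofAdd q)) := by
  refine (AddMonoidAlgebra.lift_single _ _ _).trans ?_
  simp

lemma twistHom_iterate_single (i : ℕ) (q : ℚ) (c : k) :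
    (twistHom χ hχ)^[i] (AddMonoidAlgebra.single q c) =
      AddMonoidAlgebra.single q (c * χ (.ofAdd q) ^ i) := by
  induction i with
  | zero => simp
  | succ i ih => rw [Function.iterate_succ_apply', ih, twistHom_single, pow_succ, mul_assoc]

/-- Differentiation shifts exponents by 1, and χ(q - 1) = χ(q) because χ is trivial on ℤ. -/
lemma twistHom_der [CharZero k] (s : RatLaurent k) :
    twistHom χ hχ (ratLaurentDer k s) = ratLaurentDer k (twistHom χ hχ s) := by
  induction s using AddMonoidAlgebra.induction_linear with
  | zero => simp
  | add x y hx hy => simp only [map_add, hx, hy]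
  | single q c =>
    have h : χ (.ofAdd (q - 1)) = χ (.ofAdd q) := by
      have := map_mul χ (.ofAdd (q - 1)) (.ofAdd 1)
      have h1 := hχ 1
      rw [Int.cast_one] at h1
      rw [h1, mul_one, ← ofAdd_add, sub_add_cancel] at this
      exact this.symm
    rw [twistHom_single, ratLaurentDer, powerDer_single, powerDer_single, twistHom_single, h]
    congr 1
    ring

/-- The projection of `k[t^q | q ∈ ℚ]` onto `k[t, t⁻¹]` that forgets the nonintegral exponents. -/
def integralPart : RatLaurent k →ₗ[LaurentPolynomial k] LaurentPolynomial k where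
  toFun s := .ofCoeff (Finsupp.comapDomain (Int.cast : ℤ → ℚ) s.coeff Int.cast_injective.injOn)
  map_add' s t := by ext; simp
  map_smul' r s := by
    simp only [RingHom.id_apply]
    induction r using AddMonoidAlgebra.induction_linear with
    | zero => ext; simp
    | add x y hx hy =>
      rw [add_smul, add_smul, ← hx, ← hy]
      ext
      simp
    | single n a =>
      ext m
      rw [Algebra.smul_def, algebraMap_ratLaurent_single, smul_eq_mul,
        AddMonoidAlgebra.coeff_single_mul_apply]
      simp only [Finsupp.comapDomain_apply]
      rw [AddMonoidAlgebra.coeff_single_mul_apply]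
      simp

lemma integralPart_algebraMap (r : LaurentPolynomial k) :
    integralPart (algebraMap (LaurentPolynomial k) (RatLaurent k) r) = r := by
  induction r using AddMonoidAlgebra.induction_linear with
  | zero => simp
  | add x y hx hy => simp only [map_add, hx, hy]
  | single n a =>
    rw [algebraMap_ratLaurent_single]
    ext m
    simp [integralPart]

/-- `integralPart` is an R-linear retraction of R → Ŝ, so R is a direct summand of Ŝ and no flatness
of `F` is needed. -/
lemma one_tmul_injective (F : Type*) [AddCommGroup F] [Module (LaurentPolynomial k) F] :
    Function.Injective fun f : F => (1 : RatLaurent k) ⊗ₜ[LaurentPolynomial k] f := by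
  intro f g h
  have h' := congrArg (fun x => TensorProduct.lid (LaurentPolynomial k) F
    (LinearMap.rTensor F (integralPart (k := k)) x)) h
  have h1 : integralPart (1 : RatLaurent k) = 1 := by
    rw [← map_one (algebraMap (LaurentPolynomial k) (RatLaurent k)), integralPart_algebraMap]
  simpa [h1] using h'

end TwistHom

/-! ### Galois descent from Ŝ to R -/

section Descent

variable {k : Type*} [Field k] {ξ : ℕ → k} (hξ : ∀ m, 0 < m → IsPrimitiveRoot (ξ m) m)
  (hcompat : ∀ l m, 0 < l → 0 < m → ξ (l * m) ^ l = ξ m)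

/-- The topological generator of the Galois group of `k[t^q | q ∈ ℚ]` over `k[t, t⁻¹]`
determined by a compatible family of roots of unity. -/
def galoisGen : RatLaurent k →ₐ[LaurentPolynomial k] RatLaurent k :=
  twistHom (rootChar hξ hcompat) (rootChar_intCast hξ hcompat)

lemma galoisGen_single (q : ℚ) (c : k) : galoisGen hξ hcompat (AddMonoidAlgebra.single q c) =
    AddMonoidAlgebra.single q (c * rootChar hξ hcompat (.ofAdd q)) :=
  twistHom_single _ _ q c

lemma galoisGen_der [CharZero k] (s : RatLaurent k) :
    galoisGen hξ hcompat (ratLaurentDer k s) = ratLaurentDer k (galoisGen hξ hcompat s) :=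
  twistHom_der _ _ s

lemma rootChar_pow_den (q : ℚ) : rootChar hξ hcompat (.ofAdd q) ^ q.den = 1 := by
  have h : rootChar hξ hcompat (.ofAdd q) = ξ q.den ^ q.num := rfl
  rw [h, ← zpow_natCast, ← zpow_mul, mul_comm, zpow_mul, zpow_natCast,
    (hξ q.den q.den_pos).pow_eq_one, one_zpow]

variable {F : Type*} [AddCommGroup F] [Module (LaurentPolynomial k) F]

lemma twistMap_iterate_tmul (i : ℕ) (s : RatLaurent k) (f : F) :
    (twistMap (galoisGen hξ hcompat) LinearMap.id)^[i] (s ⊗ₜ[LaurentPolynomial k] f) =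
      (galoisGen hξ hcompat)^[i] s ⊗ₜ f := by
  induction i with
  | zero => rfl
  | succ i ih =>
    rw [Function.iterate_succ_apply', Function.iterate_succ_apply', ih, twistMap_tmul]
    rfl

/-- The Galois group acts on a base change with finite orbits, and the trace of an element lies
in the original module. -/
lemma exists_period_and_trace (x : RatLaurent k ⊗[LaurentPolynomial k] F) :
    ∃ M, 0 < M ∧ ∀ N, M ∣ N → (twistMap (galoisGen hξ hcompat) LinearMap.id)^[N] x = x ∧
      ∃ f : F, ∑ i ∈ Finset.range N, (twistMap (galoisGen hξ hcompat) LinearMap.id)^[i] x =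
        1 ⊗ₜ f := by
  induction x using TensorProduct.induction_on with
  | zero =>
    refine ⟨1, one_pos, fun N _ => ⟨iterate_map_zero _ _, 0, ?_⟩⟩
    rw [TensorProduct.tmul_zero]
    exact Finset.sum_eq_zero fun i _ => iterate_map_zero _ _
  | add x y hx hy =>
    obtain ⟨M, hM, hx⟩ := hx
    obtain ⟨M', hM', hy⟩ := hy
    -- The claim is stated for all multiples of a period so that two summands can share one.
    refine ⟨M * M', Nat.mul_pos hM hM', fun N hN => ?_⟩
    obtain ⟨h1, f, hf⟩ := hx N (dvd_of_mul_right_dvd hN)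
    obtain ⟨h2, g, hg⟩ := hy N (dvd_of_mul_left_dvd hN)
    refine ⟨by rw [iterate_map_add, h1, h2], f + g, ?_⟩
    simp only [iterate_map_add, Finset.sum_add_distrib, hf, hg, TensorProduct.tmul_add]
  | tmul s f =>
    induction s using AddMonoidAlgebra.induction_linear with
    | zero =>
      rw [TensorProduct.zero_tmul]
      refine ⟨1, one_pos, fun N _ => ⟨iterate_map_zero _ _, 0, ?_⟩⟩
      rw [TensorProduct.tmul_zero]
      exact Finset.sum_eq_zero fun i _ => iterate_map_zero _ _
    | add x y hx hy =>
      obtain ⟨M, hM, hx⟩ := hx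
      obtain ⟨M', hM', hy⟩ := hy
      refine ⟨M * M', Nat.mul_pos hM hM', fun N hN => ?_⟩
      obtain ⟨h1, f, hf⟩ := hx N (dvd_of_mul_right_dvd hN)
      obtain ⟨h2, g, hg⟩ := hy N (dvd_of_mul_left_dvd hN)
      rw [TensorProduct.add_tmul]
      refine ⟨by rw [iterate_map_add, h1, h2], f + g, ?_⟩
      simp only [iterate_map_add, Finset.sum_add_distrib, hf, hg, TensorProduct.tmul_add]
    | single q c =>
      refine ⟨q.den, q.den_pos, fun N hN => ?_⟩
      have hit : ∀ i, (twistMap (galoisGen hξ hcompat) LinearMap.id)^[i]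
          (AddMonoidAlgebra.single q c ⊗ₜ[LaurentPolynomial k] f) =
          AddMonoidAlgebra.single q (c * rootChar hξ hcompat (.ofAdd q) ^ i) ⊗ₜ f := fun i => by
        rw [twistMap_iterate_tmul, galoisGen, twistHom_iterate_single]
      have hone : rootChar hξ hcompat (.ofAdd q) ^ N = 1 := by
        obtain ⟨l, rfl⟩ := hN
        rw [pow_mul, rootChar_pow_den, one_pow]
      refine ⟨by rw [hit, hone, mul_one], ?_⟩
      simp only [hit]
      -- The trace of t^q is t^q times the geometric sum of the powers of χ(q). It is N t^q when q
      -- is an integer and 0 otherwise.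
      by_cases h : rootChar hξ hcompat (.ofAdd q) = 1
      · obtain ⟨n, rfl⟩ := exists_int_of_rootChar_eq_one hξ hcompat h
        refine ⟨(N : LaurentPolynomial k) • (AddMonoidAlgebra.single n c : LaurentPolynomial k) • f,
          ?_⟩
        simp only [h, one_pow, mul_one, Finset.sum_const, Finset.card_range,
          TensorProduct.tmul_smul]
        rw [Nat.cast_smul_eq_nsmul, TensorProduct.smul_tmul' (AddMonoidAlgebra.single n c),
          Algebra.smul_def (AddMonoidAlgebra.single n c), algebraMap_ratLaurent_single, mul_one]
      · refine ⟨0, ?_⟩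
        rw [← TensorProduct.sum_tmul]
        have : ∑ i ∈ Finset.range N, AddMonoidAlgebra.single q
            (c * rootChar hξ hcompat (.ofAdd q) ^ i) =
            AddMonoidAlgebra.single q (c * ∑ i ∈ Finset.range N,
              rootChar hξ hcompat (.ofAdd q) ^ i) := by
          rw [Finset.mul_sum]
          exact (map_sum (AddMonoidAlgebra.singleAddHom q) _ _).symm
        rw [this, geom_sum_eq h, hone]
        simp

/-- Galois descent: the invariants of a base change are the original module. -/
lemma exists_one_tmul_of_twistMap_eq [CharZero k] (x : RatLaurent k ⊗[LaurentPolynomial k] F)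
    (hx : twistMap (galoisGen hξ hcompat) LinearMap.id x = x) : ∃ f : F, x = 1 ⊗ₜ f := by
  obtain ⟨M, hM, h⟩ := exists_period_and_trace hξ hcompat x
  obtain ⟨-, f, hf⟩ := h M dvd_rfl
  -- The trace of an invariant `x` over `M` steps is `M • x`, and `M` is invertible in
  -- characteristic zero.
  simp only [Function.iterate_fixed hx, Finset.sum_const, Finset.card_range] at hf
  have hM' : (M : k) ≠ 0 := by exact_mod_cast hM.ne'
  refine ⟨(algebraMap k (LaurentPolynomial k) (M : k)⁻¹) • f, ?_⟩
  rw [TensorProduct.tmul_smul, ← hf, ← Nat.cast_smul_eq_nsmul (LaurentPolynomial k), smul_smul,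
    ← map_natCast (algebraMap k (LaurentPolynomial k)), ← map_mul, inv_mul_cancel₀ hM', map_one,
    one_smul]

end Descent

/-! ### Units of the group algebra -/

section Units

/-- The units of a group algebra with two unique sums are the monomials. -/
lemma AddMonoidAlgebra.exists_eq_single_of_mul_eq_one {k G : Type*} [Field k] [AddMonoid G]
    [TwoUniqueSums G] {f g : AddMonoidAlgebra k G} (h : f * g = 1) :
    ∃ (q : G) (c : k), c ≠ 0 ∧ f = AddMonoidAlgebra.single q c := by
  have hf : f ≠ 0 := by rintro rfl; simp at h
  have hg : g ≠ 0 := by rintro rfl; simp at h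
  have hf' : f.coeff.support.Nonempty := by simpa [Finsupp.support_nonempty_iff] using hf
  have hg' : g.coeff.support.Nonempty := by simpa [Finsupp.support_nonempty_iff] using hg
  -- Otherwise two distinct pairs of exponents have uniquely represented sums. Each sum carries a
  -- nonzero coefficient of `f * g = 1`, so both sums are 0, and uniqueness makes the pairs equal.
  have hcard : f.coeff.support.card * g.coeff.support.card ≤ 1 := by
    by_contra hc
    obtain ⟨p, hp, q, hq, hpq, up, uq⟩ :=
      TwoUniqueSums.uniqueAdd_of_one_lt_card (not_le.mp hc)
    rw [Finset.mem_product] at hp hq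
    have key : ∀ r : G × G, r.1 ∈ f.coeff.support → r.2 ∈ g.coeff.support →
        UniqueAdd f.coeff.support g.coeff.support r.1 r.2 → r.1 + r.2 = 0 := by
      intro r h1 h2 hu
      by_contra hne
      have := AddMonoidAlgebra.coeff_mul_add_of_uniqueAdd hu
      rw [h, AddMonoidAlgebra.one_def, AddMonoidAlgebra.coeff_single,
        Finsupp.single_eq_of_ne hne] at this
      exact mul_ne_zero (Finsupp.mem_support_iff.mp h1) (Finsupp.mem_support_iff.mp h2) this.symm
    have e := up hq.1 hq.2 ((key q hq.1 hq.2 uq).trans (key p hp.1 hp.2 up).symm)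
    exact hpq (Prod.ext e.1.symm e.2.symm)
  have h1 : f.coeff.support.card = 1 :=
    le_antisymm ((Nat.le_mul_of_pos_right _ hg'.card_pos).trans hcard) hf'.card_pos
  obtain ⟨q, c, hc, e⟩ := Finsupp.card_support_eq_one'.mp h1
  exact ⟨q, c, hc, AddMonoidAlgebra.coeff_injective e⟩

end Units

end

noncomputable section

open ConformalSuperalgebra

instance : DecidableEq N2Gen := Classical.typeDecidableEq N2Gen

/-! ### Coordinates on A ⊗ S, leading coefficients, and the characterization of J -/

section Coordinates

open Polynomial

variable (k : Type*) [Field k]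

/-- The element `∂^i c` of the `N = 2` conformal superalgebra, for a generator `c`. -/
def n2Mono (c : N2Gen) (i : ℕ) : N2 k := Pi.single c (X ^ i)

lemma n2_prod_apply (n : ℕ) (f g : N2 k) (c : N2Gen) :
    (n2Conformal k).prod n f g c = (n.factorial : k) • (n2Bracket k f g c).coeff n := rfl

lemma n2_der_apply (f : N2 k) (c : N2Gen) : (n2Conformal k).der f c = X * f c := rfl

lemma n2_der_mono (c : N2Gen) (i : ℕ) :
    (n2Conformal k).der (n2Mono k c i) = n2Mono k c (i + 1) := by
  funext d
  rw [n2_der_apply]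
  by_cases h : d = c
  · subst h; simp [n2Mono, pow_succ']
  · simp [n2Mono, h]

lemma n2Bracket_mono (a b c : N2Gen) (i j : ℕ) :
    n2Bracket k (n2Mono k a i) (n2Mono k b j) c =
      (-X : Polynomial (Polynomial k)) ^ i * (C X + X) ^ j * n2Struct k a b c := by
  rw [n2Bracket, Finset.sum_eq_single a, Finset.sum_eq_single b]
  · simp [n2Mono]
  · intro b' _ hb; simp [n2Mono, hb]
  · simp
  · intro a' _ ha; simp [n2Mono, ha]
  · simp

variable {k}

/-- The component of [∂^i a_λ ∂^j b] along c is (-λ)^i (∂ + λ)^j p, with p the structure polynomial.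
Its λ-degree is at most i + j + r, and the coefficient of λ^{i+j+r} is the scalar (-1)^i κ, free of
∂. -/
lemma n2_prod_mono_top {a b c : N2Gen} {r : ℕ} {κ : k} (hr : (n2Struct k a b c).natDegree ≤ r)
    (hκ : (n2Struct k a b c).coeff r = C κ) (i j n : ℕ) (hn : i + j + r ≤ n) :
    (n2Conformal k).prod n (n2Mono k a i) (n2Mono k b j) c =
      if i + j + r = n then C ((-1) ^ i * n.factorial * κ) else 0 := by
  rw [n2_prod_apply, n2Bracket_mono]
  have h1 : ((-X : Polynomial (Polynomial k)) ^ i).natDegree ≤ i :=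
    natDegree_pow_le_of_le (m := 1) i (by rw [natDegree_neg]; exact natDegree_X_le) |>.trans (by simp)
  have h2 : ((C X + X : Polynomial (Polynomial k)) ^ j).natDegree ≤ j :=
    natDegree_pow_le_of_le (m := 1) j (by compute_degree) |>.trans (by simp)
  have h12 := natDegree_mul_le_of_le h1 h2
  split_ifs with h
  · subst h
    rw [coeff_mul_add_eq_of_natDegree_le h12 hr, coeff_mul_add_eq_of_natDegree_le h1 h2, hκ]
    have e1 : ((-X : Polynomial (Polynomial k)) ^ i).coeff i = (-1) ^ i := by
      rw [neg_pow (X : Polynomial (Polynomial k)) i, show ((-1 : Polynomial (Polynomial k)) ^ i) = C ((-1) ^ i) by simp,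
        coeff_C_mul, coeff_X_pow_self, mul_one]
    have e2 : ((C X + X : Polynomial (Polynomial k)) ^ j).coeff j = 1 := by
      rw [add_comm, coeff_X_add_C_pow]
      simp
    rw [e1, e2, mul_one, smul_eq_C_mul]
    simp only [map_mul, map_pow, map_neg, map_one]
    ring
  · rw [coeff_eq_zero_of_natDegree_lt, smul_zero]
    exact lt_of_le_of_lt (natDegree_mul_le_of_le h12 hr) (by omega)

variable {S : Type*} [CommRing S] [Algebra k S]

/-- The coordinate of an element of `A ⊗_k S` with respect to a generator, a polynomial in `∂` with
coefficients in `S`. -/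
def n2Coord (S : Type*) [CommRing S] [Algebra k S] (c : N2Gen) : S ⊗[k] N2 k →ₗ[S] S[X] :=
  LinearMap.liftBaseChange S
    ((Polynomial.mapAlgHom (Algebra.ofId k S)).toLinearMap ∘ₗ LinearMap.proj c)

lemma n2Coord_tmul (c : N2Gen) (s : S) (f : N2 k) :
    n2Coord S c (s ⊗ₜ f) = s • (f c).map (algebraMap k S) :=
  LinearMap.liftBaseChange_tmul ..

lemma n2Coord_mono (c d : N2Gen) (s : S) (i : ℕ) :
    n2Coord S c (s ⊗ₜ n2Mono k d i) = if c = d then monomial i s else 0 := by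
  rw [n2Coord_tmul]
  split_ifs with h
  · subst h
    simp [n2Mono, smul_eq_C_mul, C_mul_X_pow_eq_monomial]
  · simp [n2Mono, h]

/-- The elements s ⊗ ∂^i c exhaust A ⊗ S, so an element can be rebuilt from its four coordinate
polynomials; both `n2Coord_ext` and the expansion of products depend on this. -/
lemma sum_n2Coord (x : S ⊗[k] N2 k) :
    ∑ c, (n2Coord S c x).sum (fun i s => s ⊗ₜ n2Mono k c i) = x := by
  have hadd : ∀ (c : N2Gen) (p q : S[X]), (p + q).sum (fun i s => s ⊗ₜ[k] n2Mono k c i) =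
      p.sum (fun i s => s ⊗ₜ n2Mono k c i) + q.sum (fun i s => s ⊗ₜ n2Mono k c i) :=
    fun c p q => sum_add_index p q _ (fun i => TensorProduct.zero_tmul _ _)
      (fun i s t => TensorProduct.add_tmul _ _ _)
  induction x using TensorProduct.induction_on with
  | zero => simp
  | add x y hx hy => simp only [map_add, hadd, Finset.sum_add_distrib, hx, hy]
  | tmul s f =>
    have key : ∀ (c : N2Gen) (p : k[X]), (s • p.map (algebraMap k S)).sum
        (fun i s => s ⊗ₜ[k] n2Mono k c i) = s ⊗ₜ Pi.single c p := by
      intro c p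
      induction p using Polynomial.induction_on' with
      | add p q hp hq =>
        rw [Polynomial.map_add, smul_add, hadd, hp, hq, Pi.single_add, TensorProduct.tmul_add]
      | monomial i r =>
        rw [map_monomial, smul_monomial, sum_monomial_index _ (fun i s => s ⊗ₜ[k] n2Mono k c i) (TensorProduct.zero_tmul _ _),
          smul_eq_mul, mul_comm, ← Algebra.smul_def, TensorProduct.smul_tmul]
        congr 1
        rw [n2Mono, ← Pi.single_smul, smul_X_eq_monomial]
    simp only [n2Coord_tmul, key]
    rw [← TensorProduct.tmul_sum, Finset.univ_sum_single]

lemma n2Coord_ext {x y : S ⊗[k] N2 k} (h : ∀ c, n2Coord S c x = n2Coord S c y) : x = y := by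
  rw [← sum_n2Coord x, ← sum_n2Coord y]
  simp only [h]

variable [CharZero k] {δ : Derivation k S S}

variable (δ) in
/-- The `N = 2` conformal superalgebra over a differential algebra. -/
abbrev n2Over : ConformalSuperalgebra k δ (S ⊗[k] N2 k) :=
  (n2Conformal k).baseChange (der_algebraMap_base δ)

/-- The terms that differentiate `s` involve products of index larger than n, which exceeds the
λ-degree i + j + r. In top degree the derivation of S is therefore invisible. -/
lemma n2Coord_prod_mono_top {a b c : N2Gen} {r : ℕ} {κ : k}
    (hr : (n2Struct k a b c).natDegree ≤ r)
    (hκ : (n2Struct k a b c).coeff r = C κ) (i j n : ℕ) (hn : i + j + r ≤ n) (s t : S) :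
    n2Coord S c ((n2Over δ).prod n (s ⊗ₜ n2Mono k a i) (t ⊗ₜ n2Mono k b j)) =
      if i + j + r = n then C (((-1) ^ i * n.factorial * κ : k) • (s * t)) else 0 := by
  obtain ⟨M, hM⟩ := (n2Conformal k).prod_eventually_zero (n2Mono k a i) (n2Mono k b j)
  change n2Coord S c (bcOp δ (n2Conformal k) n s (n2Mono k a i) (t ⊗ₜ n2Mono k b j)) = _
  rw [bcOp_tmul, finsum_eq_range _ (M + 1)
    (fun l hl => by rw [hM _ (by omega), TensorProduct.tmul_zero]), map_smul, map_sum,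
    Finset.sum_eq_single 0]
  · rw [add_zero, dividedPow_zero, n2Coord_tmul, n2_prod_mono_top hr hκ i j n hn]
    split_ifs
    · rw [map_C, smul_smul, smul_C]
      congr 1
      rw [smul_eq_mul, Algebra.smul_def]
      ring
    · simp
  · intro l _ hl
    rw [n2Coord_tmul, n2_prod_mono_top hr hκ i j (n + l) (by omega), if_neg (by omega)]
    simp
  · simp

lemma n2Coord_prod_mono_eq_zero {a b c : N2Gen} (h : n2Struct k a b c = 0) (i j n : ℕ) (s t : S) :
    n2Coord S c ((n2Over δ).prod n (s ⊗ₜ n2Mono k a i) (t ⊗ₜ n2Mono k b j)) = 0 := by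
  obtain ⟨M, hM⟩ := (n2Conformal k).prod_eventually_zero (n2Mono k a i) (n2Mono k b j)
  change n2Coord S c (bcOp δ (n2Conformal k) n s (n2Mono k a i) (t ⊗ₜ n2Mono k b j)) = _
  rw [bcOp_tmul, finsum_eq_range _ M
    (fun l hl => by rw [hM _ (by omega), TensorProduct.tmul_zero]), map_smul, map_sum,
    Finset.sum_eq_zero, smul_zero]
  intro l _
  rw [n2Coord_tmul, n2_prod_apply, n2Bracket_mono, h]
  simp

lemma n2Coord_prod_sum (n : ℕ) (x y : S ⊗[k] N2 k) (c : N2Gen) :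
    n2Coord S c ((n2Over δ).prod n x y) = ∑ a, ∑ b, (n2Coord S a x).sum fun i s =>
      (n2Coord S b y).sum fun j t =>
        n2Coord S c ((n2Over δ).prod n (s ⊗ₜ n2Mono k a i) (t ⊗ₜ n2Mono k b j)) := by
  conv_lhs => rw [← sum_n2Coord x, ← sum_n2Coord y]
  simp only [Polynomial.sum, map_sum, LinearMap.sum_apply]
  rw [Finset.sum_comm]
  refine Finset.sum_congr rfl fun a _ => ?_
  rw [Finset.sum_comm]
  exact Finset.sum_congr rfl fun b _ => Finset.sum_comm

/-- The top coefficient in `λ` of a component of `[x_λ y]`, when that component involves only the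
components of `x` and `y` along the generators `a` and `b`. -/
lemma n2Coord_prod_top {a b c : N2Gen} {r : ℕ} {κ : k} (hr : (n2Struct k a b c).natDegree ≤ r)
    (hκ : (n2Struct k a b c).coeff r = C κ) {x y : S ⊗[k] N2 k}
    (hxy : ∀ a' b', (a', b') ≠ (a, b) →
      n2Coord S a' x = 0 ∨ n2Coord S b' y = 0 ∨ n2Struct k a' b' c = 0) :
    n2Coord S c ((n2Over δ).prod ((n2Coord S a x).natDegree + (n2Coord S b y).natDegree + r) x y) =
      C (((-1) ^ (n2Coord S a x).natDegree *
        ((n2Coord S a x).natDegree + (n2Coord S b y).natDegree + r).factorial * κ : k) •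
        ((n2Coord S a x).leadingCoeff * (n2Coord S b y).leadingCoeff)) := by
  set d := (n2Coord S a x).natDegree with hd
  set e := (n2Coord S b y).natDegree with he
  have hzero : ∀ a' b', (a', b') ≠ (a, b) → ((n2Coord S a' x).sum fun i s =>
      (n2Coord S b' y).sum fun j t => n2Coord S c ((n2Over δ).prod (d + e + r)
        (s ⊗ₜ n2Mono k a' i) (t ⊗ₜ n2Mono k b' j))) = 0 := by
    intro a' b' hne
    rcases hxy a' b' hne with h | h | h
    · simp [h]
    · simp [h, Polynomial.sum]
    · simp [Polynomial.sum, n2Coord_prod_mono_eq_zero h]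
  have hsum : ∀ i s, ((n2Coord S b y).sum fun j t => n2Coord S c ((n2Over δ).prod (d + e + r)
        (s ⊗ₜ n2Mono k a i) (t ⊗ₜ n2Mono k b j))) =
      ∑ j ∈ Finset.range (e + 1), n2Coord S c ((n2Over δ).prod (d + e + r)
        (s ⊗ₜ n2Mono k a i) ((n2Coord S b y).coeff j ⊗ₜ n2Mono k b j)) :=
    fun i s => sum_over_range _ (by simp)
  rw [n2Coord_prod_sum, Finset.sum_eq_single a, Finset.sum_eq_single b]
  · simp only [hsum]
    rw [sum_over_range _ (by simp), ← hd, Finset.sum_range_succ, Finset.sum_range_succ,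
      n2Coord_prod_mono_top hr hκ d e _ le_rfl, if_pos rfl, Finset.sum_eq_zero, zero_add,
      Finset.sum_eq_zero, zero_add]
    · rfl
    · intro j hj
      rw [Finset.mem_range] at hj
      rw [n2Coord_prod_mono_top hr hκ d j _ (by omega), if_neg (by omega)]
    · intro i hi
      rw [Finset.mem_range] at hi
      refine Finset.sum_eq_zero fun j hj => ?_
      rw [Finset.mem_range] at hj
      rw [n2Coord_prod_mono_top hr hκ i j _ (by omega), if_neg (by omega)]
  · intro b' _ hb
    exact hzero a b' (by simp [hb])
  · simp
  · intro a' _ ha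
    exact Finset.sum_eq_zero fun b' _ => hzero a' b' (by simp [ha])
  · simp

/-- A component of `[x_λ y]` as above vanishes in top degree only if `x` or `y` has no component
along `a` or `b`. -/
lemma n2Coord_prod_top_ne_zero [IsDomain S] {a b c : N2Gen} {r : ℕ} {κ : k} (hκ0 : κ ≠ 0)
    (hr : (n2Struct k a b c).natDegree ≤ r)
    (hκ : (n2Struct k a b c).coeff r = C κ) {x y : S ⊗[k] N2 k}
    (hxy : ∀ a' b', (a', b') ≠ (a, b) →
      n2Coord S a' x = 0 ∨ n2Coord S b' y = 0 ∨ n2Struct k a' b' c = 0)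
    (hx : n2Coord S a x ≠ 0) (hy : n2Coord S b y ≠ 0) :
    (n2Over δ).prod ((n2Coord S a x).natDegree + (n2Coord S b y).natDegree + r) x y ≠ 0 := by
  intro h
  have h' := n2Coord_prod_top (δ := δ) hr hκ hxy
  rw [h, map_zero, eq_comm, C_eq_zero, smul_eq_zero] at h'
  rcases h' with h' | h'
  · have : (((n2Coord S a x).natDegree + (n2Coord S b y).natDegree + r).factorial : k) ≠ 0 := by
      exact_mod_cast Nat.factorial_ne_zero _
    exact mul_ne_zero (mul_ne_zero (pow_ne_zero _ (by simp)) this) hκ0 h'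
  · exact mul_ne_zero (leadingCoeff_ne_zero.mpr hx) (leadingCoeff_ne_zero.mpr hy) h'

lemma n2Coord_of_mem_even {x : S ⊗[k] N2 k} (hx : x ∈ (n2Over δ).even) :
    n2Coord S .Gp x = 0 ∧ n2Coord S .Gm x = 0 := by
  change x ∈ (n2Conformal k).even.baseChange S at hx
  rw [Submodule.baseChange_eq_span] at hx
  induction hx using Submodule.span_induction with
  | mem x h =>
    obtain ⟨f, hf, rfl⟩ := h
    obtain ⟨h1, h2⟩ : f .Gp = 0 ∧ f .Gm = 0 := hf
    simp [n2Coord_tmul, h1, h2]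
  | zero => simp
  | add x y _ _ hx hy => simp [hx, hy]
  | smul s x _ hx => simp [hx]

lemma n2Coord_of_mem_odd {x : S ⊗[k] N2 k} (hx : x ∈ (n2Over δ).odd) :
    n2Coord S .L x = 0 ∧ n2Coord S .J x = 0 := by
  change x ∈ (n2Conformal k).odd.baseChange S at hx
  rw [Submodule.baseChange_eq_span] at hx
  induction hx using Submodule.span_induction with
  | mem x h =>
    obtain ⟨f, hf, rfl⟩ := h
    obtain ⟨h1, h2⟩ : f .L = 0 ∧ f .J = 0 := hf
    simp [n2Coord_tmul, h1, h2]
  | zero => simp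
  | add x y _ _ hx hy => simp [hx, hy]
  | smul s x _ hx => simp [hx]

variable (k S) in
/-- The generators of `A ⊗_k S`. -/
def n2G (c : N2Gen) : S ⊗[k] N2 k := 1 ⊗ₜ n2Mono k c 0

omit [CharZero k] in
lemma n2Coord_smul_n2G (c d : N2Gen) (s : S) :
    n2Coord S c (s • n2G k S d) = if c = d then C s else 0 := by
  rw [n2G, TensorProduct.smul_tmul', smul_eq_mul, mul_one, n2Coord_mono]
  rfl

/-- An abelian even element `x` with an odd eigenvector `[x_λ y] = y` is `J` or `-J`. -/
lemma eq_J_or_eq_neg_J [IsDomain S] {x y : S ⊗[k] N2 k} (hx : x ∈ (n2Over δ).even)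
    (hy : y ∈ (n2Over δ).odd) (hy0 : y ≠ 0) (hxx : ∀ n, (n2Over δ).prod n x x = 0)
    (hxy : (n2Over δ).prod 0 x y = y) (hxy' : ∀ n, (n2Over δ).prod (n + 1) x y = 0) :
    (x = n2G k S .J ∧ ∃ α : S, α ≠ 0 ∧ y = α • n2G k S .Gp) ∨
    (x = -n2G k S .J ∧ ∃ α : S, α ≠ 0 ∧ y = α • n2G k S .Gm) := by
  obtain ⟨hxp, hxm⟩ := n2Coord_of_mem_even hx
  obtain ⟨hyL, hyJ⟩ := n2Coord_of_mem_odd hy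
  -- For even x only the pair (L, L) contributes to the L-component of [x_λ x]. The leading term 2λ
  -- of [L_λ L] would make its top coefficient nonzero.
  have hxL : n2Coord S .L x = 0 := by
    by_contra h
    refine n2Coord_prod_top_ne_zero (δ := δ) (a := .L) (b := .L) (c := .L) (r := 1) (κ := 2)
      two_ne_zero ?_ ?_ ?_ h h (hxx _)
    · simp only [n2Struct]; compute_degree
    · simp only [n2Struct]; simp [coeff_ofNat_mul]; rfl
    · rintro (_ | _ | _ | _) (_ | _ | _ | _) h <;> first
      | with_reducible exact absurd rfl h
      | with_reducible exact Or.inl hxp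
      | with_reducible exact Or.inl hxm
      | exact Or.inr (Or.inr (by simp only [n2Struct]))
  -- Once x has only a J-component and y is odd, only [J_λ G^±] contributes to the G^±-component of
  -- [x_λ y].
  have hGm : ∀ a' b', (a', b') ≠ (N2Gen.J, N2Gen.Gm) →
      n2Coord S a' x = 0 ∨ n2Coord S b' y = 0 ∨ n2Struct k a' b' .Gm = 0 := by
    rintro (_ | _ | _ | _) (_ | _ | _ | _) h <;> first
    | with_reducible exact absurd rfl h
    | with_reducible exact Or.inl hxL
    | with_reducible exact Or.inl hxp
    | with_reducible exact Or.inl hxm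
    | with_reducible exact Or.inr (Or.inl hyL)
    | with_reducible exact Or.inr (Or.inl hyJ)
    | exact Or.inr (Or.inr (by simp only [n2Struct]))
  have hGp : ∀ a' b', (a', b') ≠ (N2Gen.J, N2Gen.Gp) →
      n2Coord S a' x = 0 ∨ n2Coord S b' y = 0 ∨ n2Struct k a' b' .Gp = 0 := by
    rintro (_ | _ | _ | _) (_ | _ | _ | _) h <;> first
    | with_reducible exact absurd rfl h
    | with_reducible exact Or.inl hxL
    | with_reducible exact Or.inl hxp
    | with_reducible exact Or.inl hxm
    | with_reducible exact Or.inr (Or.inl hyL)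
    | with_reducible exact Or.inr (Or.inl hyJ)
    | exact Or.inr (Or.inr (by simp only [n2Struct]))
  have key : ∀ (g : N2Gen) (κ : k), κ ≠ 0 → n2Struct k .J g g = C (C κ) →
      (∀ a' b', (a', b') ≠ (.J, g) →
        n2Coord S a' x = 0 ∨ n2Coord S b' y = 0 ∨ n2Struct k a' b' g = 0) →
      n2Coord S g y ≠ 0 →
      ∃ q u : S, κ • q = 1 ∧ u ≠ 0 ∧ n2Coord S .J x = C q ∧ n2Coord S g y = C u := by
    intro g κ hκ0 hg hne hgy
    have hr : (n2Struct k .J g g).natDegree ≤ 0 := by rw [hg]; simp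
    have hκ : (n2Struct k .J g g).coeff 0 = C κ := by rw [hg]; simp
    have hJ : n2Coord S .J x ≠ 0 := by
      intro h
      have hx0 : x = 0 := n2Coord_ext fun c => by cases c <;> simp [*]
      apply hy0
      rw [← hxy, hx0]
      simp
    -- A positive total degree in ∂ would give a nonzero product of positive index, against `hxy'`.
    -- So both coordinates are constants, and comparing them in x_(0) y = y gives the eigenvalue
    -- equation.
    have hdeg : (n2Coord S .J x).natDegree + (n2Coord S g y).natDegree + 0 = 0 := by
      by_contra hc
      obtain ⟨n, hn⟩ := Nat.exists_eq_succ_of_ne_zero hc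
      refine n2Coord_prod_top_ne_zero (δ := δ) hκ0 hr hκ hne hJ hgy ?_
      rw [hn]
      exact hxy' n
    have htop := n2Coord_prod_top (δ := δ) hr hκ hne
    have hJd : (n2Coord S .J x).natDegree = 0 := by omega
    have hgd : (n2Coord S g y).natDegree = 0 := by omega
    obtain ⟨q, hq⟩ := natDegree_eq_zero.mp hJd
    obtain ⟨u, hu⟩ := natDegree_eq_zero.mp hgd
    rw [hdeg, hxy, hJd, ← hq, ← hu, leadingCoeff_C, leadingCoeff_C] at htop
    have hu0 : u ≠ 0 := by rintro rfl; exact hgy (by rw [← hu, C_0])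
    refine ⟨q, u, ?_, hu0, hq.symm, hu.symm⟩
    have := C_injective htop
    simp only [pow_zero, Nat.factorial_zero, Nat.cast_one, one_mul] at this
    apply mul_right_cancel₀ hu0
    rw [one_mul, smul_mul_assoc, ← this]
  by_cases hp : n2Coord S .Gp y = 0
  · have hm : n2Coord S .Gm y ≠ 0 := fun h =>
      hy0 (n2Coord_ext fun c => by cases c <;> simp [*])
    obtain ⟨q, u, hq, hu0, hxJ, hyu⟩ := key .Gm (-1) (by simp) (by simp [n2Struct])
      hGm hm
    have hq' : q = -1 := by rw [neg_smul, one_smul] at hq; rw [← hq, neg_neg]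
    refine Or.inr ⟨n2Coord_ext fun c => ?_, u, hu0, n2Coord_ext fun c => ?_⟩
    · rw [← neg_one_smul S, n2Coord_smul_n2G]
      cases c <;> simp [*]
    · rw [n2Coord_smul_n2G]
      cases c <;> simp [*]
  · obtain ⟨q, u, hq, hu0, hxJ, hyu⟩ := key .Gp 1 one_ne_zero (by simp [n2Struct])
      hGp hp
    have hq' : q = 1 := by rw [← hq, one_smul]
    -- A vector with components along both G⁺ and G⁻ would force the coefficient of J in x to be
    -- both 1 and -1.
    have hm : n2Coord S .Gm y = 0 := by
      by_contra hm
      obtain ⟨q₂, u₂, hq₂, -, hxJ₂, -⟩ := key .Gm (-1) (by simp) (by simp [n2Struct])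
        hGm hm
      have h1 := C_injective (hxJ.symm.trans hxJ₂)
      rw [← h1, hq', neg_smul, one_smul] at hq₂
      have h2 : (2 : k) • (1 : S) = 0 := by
        rw [two_smul]
        nth_rewrite 1 [← hq₂]
        exact neg_add_cancel 1
      rcases smul_eq_zero.mp h2 with h | h
      · exact two_ne_zero h
      · exact one_ne_zero h
    refine Or.inl ⟨n2Coord_ext fun c => ?_, u, hu0, n2Coord_ext fun c => ?_⟩
    · rw [← one_smul S (n2G k S .J), n2Coord_smul_n2G]
      cases c <;> simp [*]
    · rw [n2Coord_smul_n2G]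
      cases c <;> simp [*]

end Coordinates

end

noncomputable section

open ConformalSuperalgebra

/-! ### Generators and relations of A ⊗ S -/

section Automorphisms

variable {k : Type*} [Field k] [CharZero k] {S : Type*} [CommRing S] [Algebra k S]
  {δ : Derivation k S S}

open N2Gen in
/-- The right-hand sides of the relations for the `0`-products of the generators, evaluated at a
family of elements of `A ⊗_k S`. -/
def n2Rel₀ (δ : Derivation k S S) (v : N2Gen → S ⊗[k] N2 k) : N2Gen → N2Gen → S ⊗[k] N2 k
  | L, L => (n2Over δ).der (v L)
  | L, J => (n2Over δ).der (v J)
  | L, Gp => (n2Over δ).der (v Gp)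
  | L, Gm => (n2Over δ).der (v Gm)
  | J, Gp => v Gp
  | J, Gm => -v Gm
  | Gp, L => (2⁻¹ : k) • (n2Over δ).der (v Gp)
  | Gm, L => (2⁻¹ : k) • (n2Over δ).der (v Gm)
  | Gp, J => -v Gp
  | Gm, J => v Gm
  | Gp, Gm => v L + (2⁻¹ : k) • (n2Over δ).der (v J)
  | Gm, Gp => v L - (2⁻¹ : k) • (n2Over δ).der (v J)
  | _, _ => 0

open N2Gen in
/-- The right-hand sides of the relations for the `1`-products of the generators, evaluated at a
family of elements of `A ⊗_k S`. -/
def n2Rel₁ (v : N2Gen → S ⊗[k] N2 k) : N2Gen → N2Gen → S ⊗[k] N2 k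
  | L, L => (2 : k) • v L
  | L, J => v J
  | L, Gp => (3 / 2 : k) • v Gp
  | L, Gm => (3 / 2 : k) • v Gm
  | J, L => v J
  | Gp, L => (3 / 2 : k) • v Gp
  | Gm, L => (3 / 2 : k) • v Gm
  | Gp, Gm => v J
  | Gm, Gp => -v J
  | _, _ => 0

/-- A family of elements of `A ⊗_k S` satisfying the defining relations of the generators. -/
structure N2Relations (δ : Derivation k S S) (v : N2Gen → S ⊗[k] N2 k) : Prop where
  prod_zero : ∀ a b, (n2Over δ).prod 0 (v a) (v b) = n2Rel₀ δ v a b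
  prod_one : ∀ a b, (n2Over δ).prod 1 (v a) (v b) = n2Rel₁ v a b
  prod_add_two : ∀ n a b, (n2Over δ).prod (n + 2) (v a) (v b) = 0

lemma n2Over_der_mono (c : N2Gen) (i : ℕ) :
    (n2Over δ).der ((1 : S) ⊗ₜ[k] n2Mono k c i) = 1 ⊗ₜ n2Mono k c (i + 1) := by
  rw [baseChange_der_one_tmul, n2_der_mono]

lemma one_tmul_n2Mono (c : N2Gen) (i : ℕ) :
    (1 : S) ⊗ₜ[k] n2Mono k c i = ((n2Over δ).der ^ i) (n2G k S c) := by
  induction i with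
  | zero => rfl
  | succ i ih => rw [pow_succ', Module.End.mul_apply, ← ih, n2Over_der_mono]

lemma n2Coord_prod_n2G (n : ℕ) (a b c : N2Gen) :
    n2Coord S c ((n2Over δ).prod n (n2G k S a) (n2G k S b)) =
      ((n.factorial : k) • (n2Struct k a b c).coeff n).map (algebraMap k S) := by
  rw [n2G, n2G, baseChange_prod_one_tmul, n2Coord_tmul, n2_prod_apply, n2Bracket_mono, one_smul]
  simp

omit [CharZero k] in
lemma n2Coord_n2G (c d : N2Gen) :
    n2Coord S c (n2G k S d) = if c = d then 1 else 0 := by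
  rw [n2G, n2Coord_mono]
  rfl

lemma n2Coord_der_n2G (c d : N2Gen) :
    n2Coord S c ((n2Over δ).der (n2G k S d)) = if c = d then Polynomial.X else 0 := by
  rw [n2G, n2Over_der_mono, n2Coord_mono]
  rfl

open Polynomial in
lemma n2G_relations : N2Relations δ (n2G k S) where
  prod_zero a b := by
    refine n2Coord_ext fun c => ?_
    rw [n2Coord_prod_n2G]
    cases a <;> cases b <;> cases c <;>
    simp [n2Struct, n2Rel₀, n2Coord_n2G, n2Coord_der_n2G, Algebra.smul_def]
  prod_one a b := by
    have h2 : C (algebraMap k S 2) = 2 := by rw [map_ofNat, map_ofNat]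
    have h2' : C (algebraMap k S 2⁻¹) * 2 = 1 := by
      rw [← h2, ← C_mul, ← map_mul, inv_mul_cancel₀ two_ne_zero, map_one, C_1]
    refine n2Coord_ext fun c => ?_
    rw [n2Coord_prod_n2G]
    cases a <;> cases b <;> cases c <;>
    simp [n2Struct, n2Rel₁, n2Coord_n2G, Algebra.smul_def, coeff_one, h2, h2']
  prod_add_two n a b := by
    refine n2Coord_ext fun c => ?_
    rw [n2Coord_prod_n2G, coeff_eq_zero_of_natDegree_lt]
    · simp
    -- Every structure polynomial has degree at most 1 in λ.
    · refine lt_of_le_of_lt (b := 1) ?_ (by omega)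
      cases a <;> cases b <;> cases c <;> simp only [n2Struct] <;> compute_degree <;> exact zero_le_one

/-- This is the spanning set on which the semilinear criteria for derivations and products are
tested below. -/
lemma span_der_pow_n2G : Submodule.span S
    (Set.range fun p : N2Gen × ℕ => ((n2Over δ).der ^ p.2) (n2G k S p.1)) = ⊤ := by
  rw [eq_top_iff]
  rintro x -
  rw [← sum_n2Coord x]
  refine sum_mem fun c _ => ?_
  rw [Polynomial.sum]
  refine sum_mem fun i _ => ?_
  rw [← mul_one ((n2Coord S c x).coeff i), ← smul_eq_mul, ← TensorProduct.smul_tmul']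
  exact Submodule.smul_mem _ _ (Submodule.subset_span ⟨(c, i), (one_tmul_n2Mono c i).symm⟩)

/-- The `S`-linear map commuting with `∂` that has prescribed values on the generators. -/
def n2Lift (δ : Derivation k S S) (v : N2Gen → S ⊗[k] N2 k) : S ⊗[k] N2 k →ₗ[S] S ⊗[k] N2 k :=
  LinearMap.liftBaseChange S
    { toFun := fun f => ∑ c, Polynomial.aeval (n2Over δ).der (f c) (v c)
      map_add' := fun f g => by simp [Finset.sum_add_distrib]
      map_smul' := fun r f => by simp [Finset.smul_sum] }

lemma n2Lift_tmul (v : N2Gen → S ⊗[k] N2 k) (s : S) (f : N2 k) :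
    n2Lift δ v (s ⊗ₜ f) = s • ∑ c, Polynomial.aeval (n2Over δ).der (f c) (v c) :=
  LinearMap.liftBaseChange_tmul ..

lemma n2Lift_der_pow (v : N2Gen → S ⊗[k] N2 k) (c : N2Gen) (i : ℕ) :
    n2Lift δ v (((n2Over δ).der ^ i) (n2G k S c)) = ((n2Over δ).der ^ i) (v c) := by
  rw [← one_tmul_n2Mono, n2Lift_tmul, one_smul, Finset.sum_eq_single c]
  · simp [n2Mono]
  · intro d _ hd; simp [n2Mono, hd]
  · simp

lemma n2Lift_n2G (v : N2Gen → S ⊗[k] N2 k) (c : N2Gen) : n2Lift δ v (n2G k S c) = v c :=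
  n2Lift_der_pow v c 0

/-- The derivation is not S-linear, but it obeys a Leibniz rule, so agreement on the elements ∂^i c
suffices. -/
lemma n2Lift_der (v : N2Gen → S ⊗[k] N2 k) (x : S ⊗[k] N2 k) :
    n2Lift δ v ((n2Over δ).der x) = (n2Over δ).der (n2Lift δ v x) := by
  refine semilinear_map_der (γ := AlgHom.id k S) (fun _ => rfl) (f := (n2Lift δ v).toAddMonoidHom)
    (SA := n2Over δ) (SB := n2Over δ) (fun s a => map_smul (n2Lift δ v) s a)
    (span_der_pow_n2G (δ := δ)) ?_ x
  rintro _ ⟨⟨c, i⟩, rfl⟩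
  change n2Lift δ v ((n2Over δ).der (((n2Over δ).der ^ i) (n2G k S c))) =
    (n2Over δ).der (n2Lift δ v (((n2Over δ).der ^ i) (n2G k S c)))
  rw [n2Lift_der_pow, ← Module.End.mul_apply, ← pow_succ', n2Lift_der_pow, pow_succ',
    Module.End.mul_apply]

lemma n2Lift_smul_base (v : N2Gen → S ⊗[k] N2 k) (r : k) (x : S ⊗[k] N2 k) :
    n2Lift δ v (r • x) = r • n2Lift δ v x := by
  rw [← algebraMap_smul S r x, map_smul, algebraMap_smul]

lemma n2Lift_prod_n2G {v : N2Gen → S ⊗[k] N2 k} (hv : N2Relations δ v) (n : ℕ) (a b : N2Gen) :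
    n2Lift δ v ((n2Over δ).prod n (n2G k S a) (n2G k S b)) = (n2Over δ).prod n (v a) (v b) := by
  match n with
  | 0 =>
    rw [n2G_relations.prod_zero, hv.prod_zero]
    cases a <;> cases b <;>
    simp only [n2Rel₀, map_add, map_sub, map_neg, map_zero, n2Lift_der, n2Lift_smul_base,
      n2Lift_n2G]
  | 1 =>
    rw [n2G_relations.prod_one, hv.prod_one]
    cases a <;> cases b <;>
    simp only [n2Rel₁, map_neg, map_zero, n2Lift_smul_base, n2Lift_n2G]
  | n + 2 => rw [n2G_relations.prod_add_two, hv.prod_add_two, map_zero]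

/-- The extension of a family satisfying the relations of the generators preserves the
`n`-products. -/
lemma n2Lift_prod {v : N2Gen → S ⊗[k] N2 k} (hv : N2Relations δ v) (n : ℕ) (x y : S ⊗[k] N2 k) :
    n2Lift δ v ((n2Over δ).prod n x y) =
      (n2Over δ).prod n (n2Lift δ v x) (n2Lift δ v y) := by
  refine semilinear_map_prod (γ := AlgHom.id k S) (fun _ => rfl)
    (f := (n2Lift δ v).toAddMonoidHom)
    (SA := n2Over δ) (SB := n2Over δ) (fun s a => map_smul (n2Lift δ v) s a)
    (span_der_pow_n2G (δ := δ)) ?_ n x y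
  rintro n _ ⟨⟨a, i⟩, rfl⟩ _ ⟨⟨b, j⟩, rfl⟩
  simp only [LinearMap.toAddMonoidHom_coe]
  -- Sesquilinearity removes one ∂ at a time, first from the left factor and then from the right.
  -- Each removal lowers the product index, so `n` has to vary.
  induction i generalizing n with
  | zero =>
    induction j generalizing n with
    | zero => simpa [n2Lift_n2G] using n2Lift_prod_n2G hv n a b
    | succ j ih =>
      rw [pow_succ', Module.End.mul_apply, (n2Over δ).prod_der, map_add, n2Lift_der,
        n2Lift_smul_base, ih, ih, n2Lift_der, (n2Over δ).prod_der]
  | succ i ih =>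
    rw [pow_succ', Module.End.mul_apply, (n2Over δ).der_prod, map_neg,
      n2Lift_smul_base, ih, n2Lift_der, (n2Over δ).der_prod]

/-- Used for parity, with `P` and `Q` both even or both odd: each generator is either absent from
the elements of `P` or has its prescribed value in `Q`. -/
lemma n2Lift_mem (v : N2Gen → S ⊗[k] N2 k) (P : Submodule k (N2 k)) (Q : Submodule S (S ⊗[k] N2 k))
    (hQ : ∀ x ∈ Q, (n2Over δ).der x ∈ Q) (hP : ∀ f ∈ P, ∀ c, f c = 0 ∨ v c ∈ Q)
    (x : S ⊗[k] N2 k) (hx : x ∈ P.baseChange S) : n2Lift δ v x ∈ Q := by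
  rw [Submodule.baseChange_eq_span] at hx
  induction hx using Submodule.span_induction with
  | mem x h =>
    obtain ⟨f, hf, rfl⟩ := h
    change n2Lift δ v (1 ⊗ₜ f) ∈ Q
    rw [n2Lift_tmul, one_smul]
    refine sum_mem fun c _ => ?_
    rcases hP f hf c with h | h
    · simp [h]
    · have hpow : ∀ i : ℕ, ((n2Over δ).der ^ i) (v c) ∈ Q := by
        intro i
        induction i with
        | zero => simpa using h
        | succ i ih => rw [pow_succ', Module.End.mul_apply]; exact hQ _ ih
      rw [Polynomial.aeval_eq_sum_range, LinearMap.sum_apply]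
      refine sum_mem fun i _ => ?_
      rw [LinearMap.smul_apply]
      exact Submodule.smul_of_tower_mem Q _ (hpow i)
  | zero => rw [map_zero]; exact zero_mem _
  | add x y _ _ hx hy => rw [map_add]; exact add_mem hx hy
  | smul c x _ hx => rw [map_smul]; exact Submodule.smul_mem _ _ hx

lemma n2G_mem_even : n2G k S .L ∈ (n2Over δ).even ∧ n2G k S .J ∈ (n2Over δ).even := by
  constructor <;>
  refine Submodule.tmul_mem_baseChange_of_mem (p := (n2Conformal k).even) _ ⟨?_, ?_⟩ <;>
  simp [n2Mono]

lemma n2G_mem_odd : n2G k S .Gp ∈ (n2Over δ).odd ∧ n2G k S .Gm ∈ (n2Over δ).odd := by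
  constructor <;>
  refine Submodule.tmul_mem_baseChange_of_mem (p := (n2Conformal k).odd) _ ⟨?_, ?_⟩ <;>
  simp [n2Mono]

/-- Semilinear homomorphisms of `A ⊗_k S` are determined by their values on `G⁺` and `G⁻`. -/
lemma isSemiHom_ext {γ : S →ₐ[k] S} {f g : S ⊗[k] N2 k →+ S ⊗[k] N2 k}
    (hf : IsSemiHom γ (n2Over δ) (n2Over δ) f) (hg : IsSemiHom γ (n2Over δ) (n2Over δ) g)
    (hp : f (n2G k S .Gp) = g (n2G k S .Gp)) (hm : f (n2G k S .Gm) = g (n2G k S .Gm)) :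
    f = g := by
  -- G⁺ and G⁻ generate everything: J = G⁺_(1) G⁻ and L = G⁺_(0) G⁻ - ½ ∂J.
  have hJ' : n2G k S .J = (n2Over δ).prod 1 (n2G k S .Gp) (n2G k S .Gm) :=
    (n2G_relations.prod_one .Gp .Gm).symm
  have hL' : n2G k S .L = (n2Over δ).prod 0 (n2G k S .Gp) (n2G k S .Gm) -
      (2⁻¹ : k) • (n2Over δ).der (n2G k S .J) := by
    rw [n2G_relations.prod_zero .Gp .Gm, n2Rel₀]
    abel
  have hJ : f (n2G k S .J) = g (n2G k S .J) := by
    rw [hJ', hf.map_prod, hg.map_prod, hp, hm]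
  have hL : f (n2G k S .L) = g (n2G k S .L) := by
    rw [hL', map_sub, map_sub, semilinear_map_smul_base hf.map_smul,
      semilinear_map_smul_base hg.map_smul, hf.map_der, hg.map_der, hf.map_prod, hg.map_prod,
      hp, hm, hJ]
  have hgen : ∀ c, f (n2G k S c) = g (n2G k S c) := by rintro (_ | _ | _ | _) <;> assumption
  have hpow : ∀ (i : ℕ) c, f (((n2Over δ).der ^ i) (n2G k S c)) =
      g (((n2Over δ).der ^ i) (n2G k S c)) := by
    intro i c
    induction i with
    | zero => simpa using hgen c
    | succ i ih => rw [pow_succ', Module.End.mul_apply, hf.map_der, hg.map_der, ih]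
  ext x
  have hx : x ∈ Submodule.span S
      (Set.range fun p : N2Gen × ℕ => ((n2Over δ).der ^ p.2) (n2G k S p.1)) := by
    rw [span_der_pow_n2G]; trivial
  induction hx using Submodule.span_induction with
  | mem x h =>
    obtain ⟨⟨c, i⟩, rfl⟩ := h
    exact hpow i c
  | zero => simp
  | add x y _ _ hx hy => rw [map_add, map_add, hx, hy]
  | smul s x _ hx => rw [hf.map_smul, hg.map_smul, hx]

/-- The values on the generators of the automorphism of `A ⊗_k S` attached to a unit `β` of `S`
with inverse `β'`. -/
def n2TorusFun (δ : Derivation k S S) (β β' : S) : N2Gen → S ⊗[k] N2 k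
  | .L => n2G k S .L + (δ β * β') • n2G k S .J
  | .J => n2G k S .J
  | .Gp => β • n2G k S .Gp
  | .Gm => β' • n2G k S .Gm

/-- Products of generators vanish from index 2 on, so only `s` and its first derivative survive in
the formula for (s a)_(n) b. -/
lemma prod_smul_n2G (s t : S) (a b : N2Gen) :
    (n2Over δ).prod 0 (s • n2G k S a) (t • n2G k S b) =
      (s * t) • n2Rel₀ δ (n2G k S) a b + (δ s * t) • n2Rel₁ (n2G k S) a b ∧
    (n2Over δ).prod 1 (s • n2G k S a) (t • n2G k S b) = (s * t) • n2Rel₁ (n2G k S) a b ∧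
    ∀ n, (n2Over δ).prod (n + 2) (s • n2G k S a) (t • n2G k S b) = 0 := by
  have h2 : ∀ m, 2 ≤ m → (n2Over δ).prod m (n2G k S a) (n2G k S b) = 0 := by
    intro m hm
    obtain ⟨n, rfl⟩ : ∃ n, m = n + 2 := ⟨m - 2, by omega⟩
    exact n2G_relations.prod_add_two n a b
  have e : ∀ n, (n2Over δ).prod n (s • n2G k S a) (t • n2G k S b) =
      t • (s • (n2Over δ).prod n (n2G k S a) (n2G k S b) +
        δ s • (n2Over δ).prod (n + 1) (n2G k S a) (n2G k S b)) := by
    intro n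
    rw [(n2Over δ).prod_smul, smul_prod_range _ n s _ _ 2 h2, Finset.sum_range_succ,
      Finset.sum_range_one, dividedPow_zero]
    simp [dividedPow]
  refine ⟨?_, ?_, fun n => ?_⟩
  · rw [e, n2G_relations.prod_zero, n2G_relations.prod_one, smul_add, smul_smul, smul_smul,
      mul_comm t, mul_comm t]
  · rw [e, n2G_relations.prod_one, h2 _ le_rfl, smul_zero, add_zero, smul_smul, mul_comm t]
  · rw [e, h2 _ (by omega), h2 _ (by omega)]
    simp

end Automorphisms

end

noncomputable section

open ConformalSuperalgebra

/-! ### The torus automorphisms attached to units -/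

section Torus

variable {k : Type*} [Field k] [CharZero k] {S : Type*} [CommRing S] [Algebra k S]
  {δ : Derivation k S S}

lemma prod_zero_smul_n2G (s t : S) (a b : N2Gen) :
    (n2Over δ).prod 0 (s • n2G k S a) (t • n2G k S b) =
      (s * t) • n2Rel₀ δ (n2G k S) a b + (δ s * t) • n2Rel₁ (n2G k S) a b :=
  (prod_smul_n2G s t a b).1

lemma prod_one_smul_n2G (s t : S) (a b : N2Gen) :
    (n2Over δ).prod 1 (s • n2G k S a) (t • n2G k S b) = (s * t) • n2Rel₁ (n2G k S) a b :=
  (prod_smul_n2G s t a b).2.1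

-- The correction of L is forced by the scaling of G^±: writing β' = β⁻¹, one has (β G⁺)_(0) (β' G⁻)
-- = L + ½ ∂J + δ(β) β' J. The remaining relations are scalar identities in S.
set_option maxHeartbeats 1600000 in
lemma n2TorusFun_relations {β β' : S} (hβ : β * β' = 1) : N2Relations δ (n2TorusFun δ β β') := by
  -- The Leibniz rule applied to β β' = 1 is the only differential input to the scalar identities.
  have hder : β * δ β' + β' * δ β = 0 := by
    have := congrArg δ hβ
    simpa only [Derivation.leibniz, smul_eq_mul, Derivation.map_one_eq_zero] using this
  have h1 : β * (δ β * β') = δ β := by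
    rw [mul_comm (δ β), ← mul_assoc, hβ, one_mul]
  have h2 : β' * (δ β * β') = -δ β' := by
    have : β' * (δ β * β') = β' * (β' * δ β + β * δ β') - (β * β') * δ β' := by ring
    rw [this, add_comm, hder, hβ]
    ring
  have hL : n2TorusFun δ β β' .L =
      (1 : S) • n2G k S .L + (δ β * β') • n2G k S .J := by rw [one_smul]; rfl
  have hJ : n2TorusFun δ β β' .J = (1 : S) • n2G k S .J := by rw [one_smul]; rfl
  have hp : n2TorusFun δ β β' .Gp = β • n2G k S .Gp := rfl
  have hm : n2TorusFun δ β β' .Gm = β' • n2G k S .Gm := rfl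
  set f := δ β * β' with hf
  have hh : algebraMap k S 2⁻¹ * 2 = 1 := by
    rw [← map_ofNat (algebraMap k S) 2, ← map_mul, inv_mul_cancel₀ two_ne_zero, map_one]
  have h32 : algebraMap k S (3 / 2) = 1 + algebraMap k S 2⁻¹ := by
    rw [← map_one (algebraMap k S), ← map_add]
    norm_num
  have hs : ∀ (r : k) (x : S ⊗[k] N2 k), r • x = algebraMap k S r • x :=
    fun r x => (algebraMap_smul S r x).symm
  refine ⟨fun a b => ?_, fun a b => ?_, fun n a b => ?_⟩
  · cases a <;> cases b <;>
    simp only [hL, hJ, hp, hm, map_add, LinearMap.add_apply, prod_zero_smul_n2G, n2Rel₀, n2Rel₁,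
      (n2Over δ).der_smul, Derivation.map_one_eq_zero, hs, h32, map_ofNat] <;>
    match_scalars <;> grind
  · cases a <;> cases b <;>
    simp only [hL, hJ, hp, hm, map_add, LinearMap.add_apply, prod_one_smul_n2G, n2Rel₁, hs, h32,
      map_ofNat] <;>
    match_scalars <;> grind
  · cases a <;> cases b <;>
    simp only [hL, hJ, hp, hm, map_add, LinearMap.add_apply, (prod_smul_n2G _ _ _ _).2.2, add_zero]

end Torus
end

noncomputable section

open ConformalSuperalgebra

/-! ### Classification of injective semilinear endomorphisms -/

section SemiHomClassification

variable {k : Type*} [Field k] [CharZero k] {S : Type*} [CommRing S] [Algebra k S]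
  {δ : Derivation k S S}

lemma isSemiHom_n2Torus {β β' : S} (hβ : β * β' = 1) :
    IsSemiHom (AlgHom.id k S) (n2Over δ) (n2Over δ)
      (n2Lift δ (n2TorusFun δ β β')).toAddMonoidHom where
  map_smul s x := map_smul (n2Lift δ (n2TorusFun δ β β')) s x
  map_even := by
    refine n2Lift_mem _ (n2Conformal k).even _ (n2Over δ).der_even ?_
    rintro f ⟨h1, h2⟩ (_ | _ | _ | _)
    · exact Or.inr (add_mem n2G_mem_even.1 (Submodule.smul_mem _ _ n2G_mem_even.2))
    · exact Or.inr n2G_mem_even.2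
    · exact Or.inl h1
    · exact Or.inl h2
  map_odd := by
    refine n2Lift_mem _ (n2Conformal k).odd _ (n2Over δ).der_odd ?_
    rintro f ⟨h1, h2⟩ (_ | _ | _ | _)
    · exact Or.inl h1
    · exact Or.inl h2
    · exact Or.inr (Submodule.smul_mem _ _ n2G_mem_odd.1)
    · exact Or.inr (Submodule.smul_mem _ _ n2G_mem_odd.2)
  map_der := n2Lift_der _
  map_prod := n2Lift_prod (n2TorusFun_relations hβ)

/-- The composite and the identity are both homomorphisms, so by `isSemiHom_ext` only G⁺ and G⁻ have
to be compared. -/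
lemma n2Lift_n2Torus {β β' : S} (hβ : β * β' = 1) (x : S ⊗[k] N2 k) :
    n2Lift δ (n2TorusFun δ β' β) (n2Lift δ (n2TorusFun δ β β') x) = x := by
  have hβ' : β' * β = 1 := by rw [mul_comm, hβ]
  have h := isSemiHom_ext ((isSemiHom_n2Torus (δ := δ) hβ').comp (isSemiHom_n2Torus (δ := δ) hβ))
    (ConformalEquiv.refl (n2Over (k := k) δ)).isSemiHom ?_ ?_
  · exact DFunLike.congr_fun h x
  · change n2Lift δ (n2TorusFun δ β' β) (n2Lift δ (n2TorusFun δ β β') (n2G k S .Gp)) = n2G k S .Gp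
    rw [n2Lift_n2G, n2TorusFun, map_smul, n2Lift_n2G, n2TorusFun, smul_smul, hβ, one_smul]
  · change n2Lift δ (n2TorusFun δ β' β) (n2Lift δ (n2TorusFun δ β β') (n2G k S .Gm)) = n2G k S .Gm
    rw [n2Lift_n2G, n2TorusFun, map_smul, n2Lift_n2G, n2TorusFun, smul_smul, hβ', one_smul]

/-- The automorphism `G^± ↦ β^{±1} G^±`, `J ↦ J`, `L ↦ L + β⁻¹ δ(β) J` of `A ⊗_k S`. -/
def n2Torus (δ : Derivation k S S) {β β' : S} (hβ : β * β' = 1) :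
    ConformalEquiv (n2Over δ) (n2Over (k := k) δ) where
  toLinearEquiv := LinearEquiv.ofLinearMap (n2Lift δ (n2TorusFun δ β β'))
    (n2Lift δ (n2TorusFun δ β' β))
    (LinearMap.ext fun x => n2Lift_n2Torus (by rw [mul_comm, hβ]) x)
    (LinearMap.ext fun x => n2Lift_n2Torus hβ x)
  map_even := (isSemiHom_n2Torus hβ).map_even
  map_odd := (isSemiHom_n2Torus hβ).map_odd
  map_prod := (isSemiHom_n2Torus hβ).map_prod
  map_der := (isSemiHom_n2Torus hβ).map_der

lemma n2Torus_Gp {β β' : S} (hβ : β * β' = 1) :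
    (n2Torus (k := k) δ hβ).toLinearEquiv (n2G k S .Gp) = β • n2G k S .Gp :=
  n2Lift_n2G (δ := δ) (n2TorusFun δ β β') .Gp

lemma n2Torus_Gm {β β' : S} (hβ : β * β' = 1) :
    (n2Torus (k := k) δ hβ).toLinearEquiv (n2G k S .Gm) = β' • n2G k S .Gm :=
  n2Lift_n2G (δ := δ) (n2TorusFun δ β β') .Gm

omit [CharZero k] in
lemma smul_n2G_injective (c : N2Gen) {s t : S} (h : s • n2G k S c = t • n2G k S c) : s = t := by
  have h' := congrArg (n2Coord S c) h
  rw [n2Coord_smul_n2G, n2Coord_smul_n2G, if_pos rfl, if_pos rfl] at h'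
  exact Polynomial.C_injective h'

lemma n2_prod_J_J (n : ℕ) : (n2Over δ).prod n (n2G k S .J) (n2G k S .J) = 0 := by
  match n with
  | 0 => exact n2G_relations.prod_zero .J .J
  | 1 => exact n2G_relations.prod_one .J .J
  | n + 2 => exact n2G_relations.prod_add_two n .J .J

lemma n2_prod_succ_J_Gp (n : ℕ) : (n2Over δ).prod (n + 1) (n2G k S .J) (n2G k S .Gp) = 0 := by
  match n with
  | 0 => exact n2G_relations.prod_one .J .Gp
  | n + 1 => exact n2G_relations.prod_add_two n .J .Gp

lemma n2_prod_succ_J_Gm (n : ℕ) : (n2Over δ).prod (n + 1) (n2G k S .J) (n2G k S .Gm) = 0 := by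
  match n with
  | 0 => exact n2G_relations.prod_one .J .Gm
  | n + 1 => exact n2G_relations.prod_add_two n .J .Gm

omit [CharZero k] in
lemma n2G_ne_zero [Nontrivial S] (c : N2Gen) : n2G k S c ≠ 0 := by
  intro h
  have h1 : (1 : S) = 0 := smul_n2G_injective (k := k) c (by rw [one_smul, zero_smul, h])
  exact one_ne_zero h1

/-- The sign of J is what tells apart the two cases of the classification, and in the end L(A, id)
from L(A, ω). -/
lemma n2G_J_ne_neg [Nontrivial S] : n2G k S .J ≠ -n2G k S .J := by
  intro h
  have h1 : (2 : k) • n2G k S .J = 0 := by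
    rw [two_smul]
    nth_rewrite 1 [h]
    exact neg_add_cancel _
  exact n2G_ne_zero .J ((smul_eq_zero.mp h1).resolve_left two_ne_zero)

/-- An injective semilinear endomorphism of `A ⊗_k S` permutes the lines of `G⁺` and `G⁻`. -/
lemma isSemiHom_cases [IsDomain S] {γ : S →ₐ[k] S} {T : S ⊗[k] N2 k →+ S ⊗[k] N2 k}
    (hT : IsSemiHom γ (n2Over δ) (n2Over δ) T) (hinj : Function.Injective T) :
    ∃ α α' : S, α * α' = 1 ∧
      ((T (n2G k S .Gp) = α • n2G k S .Gp ∧ T (n2G k S .Gm) = α' • n2G k S .Gm) ∨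
       (T (n2G k S .Gp) = α • n2G k S .Gm ∧ T (n2G k S .Gm) = α' • n2G k S .Gp)) := by
  have hp := eq_J_or_eq_neg_J (δ := δ) (hT.map_even _ n2G_mem_even.2) (hT.map_odd _ n2G_mem_odd.1)
    ((map_ne_zero_iff T hinj).mpr (n2G_ne_zero _))
    (fun n => by rw [← hT.map_prod, n2_prod_J_J, map_zero])
    (by rw [← hT.map_prod, n2G_relations.prod_zero, n2Rel₀])
    (fun n => by rw [← hT.map_prod, n2_prod_succ_J_Gp, map_zero])
  -- G⁻ has eigenvalue -1 under J, so the characterization is applied to -T(J).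
  have hm := eq_J_or_eq_neg_J (δ := δ) (x := -T (n2G k S .J))
    (neg_mem (hT.map_even _ n2G_mem_even.2)) (hT.map_odd _ n2G_mem_odd.2)
    ((map_ne_zero_iff T hinj).mpr (n2G_ne_zero _))
    (fun n => by
      rw [map_neg, map_neg, LinearMap.neg_apply, ← hT.map_prod, n2_prod_J_J, map_zero, neg_zero,
        neg_zero])
    (by
      rw [map_neg, LinearMap.neg_apply, ← hT.map_prod, n2G_relations.prod_zero, n2Rel₀, map_neg,
        neg_neg])
    (fun n => by
      rw [map_neg, LinearMap.neg_apply, ← hT.map_prod, n2_prod_succ_J_Gm, map_zero, neg_zero])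
  -- Applying T to J = G⁺_(1) G⁻ will show that the two coefficients are inverse to each other.
  have hJ : T (n2G k S .J) =
      (n2Over δ).prod 1 (T (n2G k S .Gp)) (T (n2G k S .Gm)) := by
    rw [← hT.map_prod, n2G_relations.prod_one, n2Rel₁]
  rcases hp with ⟨hTJ, α, -, hα⟩ | ⟨hTJ, α, -, hα⟩ <;>
    rcases hm with ⟨hTJ', α', -, hα'⟩ | ⟨hTJ', α', -, hα'⟩
  -- Here both T(J) = J and -T(J) = J. The last case is excluded in the same way, and the two middle
  -- ones are the diagonal and the swapping case.
  · rw [hTJ] at hTJ'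
    exact absurd hTJ'.symm n2G_J_ne_neg
  · refine ⟨α, α', ?_, Or.inl ⟨hα, hα'⟩⟩
    rw [hTJ, hα, hα', prod_one_smul_n2G, n2Rel₁] at hJ
    exact smul_n2G_injective (k := k) .J (by rw [one_smul, ← hJ])
  · refine ⟨α, α', ?_, Or.inr ⟨hα, hα'⟩⟩
    rw [hTJ, hα, hα', prod_one_smul_n2G, n2Rel₁, smul_neg] at hJ
    exact smul_n2G_injective (k := k) .J (by rw [one_smul, ← neg_inj, ← hJ])
  · rw [hTJ, neg_neg] at hTJ'
    exact absurd hTJ' n2G_J_ne_neg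

end SemiHomClassification

/-! ### Normal form of a semilinear automorphism up to conjugacy -/

section Conjugacy

/-- The condition on G⁻ is the inverse of the condition on G⁺, so only the latter has to be solved
for β. -/
lemma mul_eq_of_mul_eq {S : Type*} [CommRing S] {a a' g g' x y : S} (h : g' * a = x)
    (hxy : x * y = 1) (hg : g' * g = 1) (ha : a * a' = 1) : g * a' = y := by
  linear_combination -(g * a') * hxy - g * a' * y * h + g' * g * y * ha + y * hg

variable {k : Type*} [Field k] [CharZero k] {ξ : ℕ → k}
  (hξ : ∀ m, 0 < m → IsPrimitiveRoot (ξ m) m)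
  (hcompat : ∀ l m, 0 < l → 0 < m → ξ (l * m) ^ l = ξ m)

/-- The semilinear map `γ ⊗ τ` of `A ⊗_k k[t^q | q ∈ ℚ]`, for the generator `γ` of the Galois group
and an endomorphism `τ` of `A`. -/
def galoisTwist (τ : N2 k →ₗ[k] N2 k) : RatLaurent k ⊗[k] N2 k →+ RatLaurent k ⊗[k] N2 k :=
  twistMap ((galoisGen hξ hcompat).restrictScalars k) τ

omit [CharZero k] in
lemma galoisTwist_tmul (τ : N2 k →ₗ[k] N2 k) (s : RatLaurent k) (f : N2 k) :
    galoisTwist hξ hcompat τ (s ⊗ₜ f) = galoisGen hξ hcompat s ⊗ₜ τ f := rfl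

lemma isSemiHom_galoisTwist (τ : ConformalEquiv (n2Conformal k) (n2Conformal k)) :
    IsSemiHom ((galoisGen hξ hcompat).restrictScalars k) (n2Over (ratLaurentDer k))
      (n2Over (ratLaurentDer k)) (galoisTwist hξ hcompat τ.toLinearEquiv) :=
  isSemiHom_twistMap _ (n2Conformal k) ((galoisGen hξ hcompat).restrictScalars k)
    (galoisGen_der hξ hcompat) _ τ.isSemiHom

omit [CharZero k] in
lemma galoisTwist_refl_n2G (c : N2Gen) :
    galoisTwist hξ hcompat (ConformalEquiv.refl (n2Conformal k)).toLinearEquiv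
      (n2G k (RatLaurent k) c) = n2G k (RatLaurent k) c := by
  rw [n2G, galoisTwist_tmul, map_one]
  rfl

omit [CharZero k] in
lemma n2Omega_Gp : (n2Omega k).toLinearEquiv (n2Mono k .Gp 0) = n2Mono k .Gm 0 := by
  change n2OmegaFun k _ = _
  funext c
  cases c <;> simp [n2OmegaFun, n2Mono]

omit [CharZero k] in
lemma n2Omega_Gm : (n2Omega k).toLinearEquiv (n2Mono k .Gm 0) = n2Mono k .Gp 0 := by
  change n2OmegaFun k _ = _
  funext c
  cases c <;> simp [n2OmegaFun, n2Mono]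

omit [CharZero k] in
lemma n2Omega_J : (n2Omega k).toLinearEquiv (n2Mono k .J 0) = -n2Mono k .J 0 := by
  change n2OmegaFun k _ = _
  funext c
  cases c <;> simp [n2OmegaFun, n2Mono]

omit [CharZero k] in
lemma galoisTwist_omega_n2G :
    galoisTwist hξ hcompat (n2Omega k).toLinearEquiv (n2G k (RatLaurent k) .Gp) =
      n2G k (RatLaurent k) .Gm ∧
    galoisTwist hξ hcompat (n2Omega k).toLinearEquiv (n2G k (RatLaurent k) .Gm) =
      n2G k (RatLaurent k) .Gp ∧
    galoisTwist hξ hcompat (n2Omega k).toLinearEquiv (n2G k (RatLaurent k) .J) =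
      -n2G k (RatLaurent k) .J := by
  simp only [n2G, galoisTwist_tmul, map_one, LinearEquiv.coe_coe]
  exact ⟨by rw [n2Omega_Gp], by rw [n2Omega_Gm], by rw [n2Omega_J, TensorProduct.tmul_neg]⟩

/-- Both sides are γ-semilinear homomorphisms in `x`, hence determined by their values on G⁺ and G⁻.
-/
lemma conj_eq_of_Gp_Gm {T : RatLaurent k ⊗[k] N2 k →+ RatLaurent k ⊗[k] N2 k}
    (hT : IsSemiHom ((galoisGen hξ hcompat).restrictScalars k) (n2Over (ratLaurentDer k))
      (n2Over (ratLaurentDer k)) T)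
    (θ : ConformalEquiv (n2Over (k := k) (ratLaurentDer k)) (n2Over (ratLaurentDer k)))
    (τ : ConformalEquiv (n2Conformal k) (n2Conformal k))
    (hp : T (θ.toLinearEquiv (n2G k _ .Gp)) =
      θ.toLinearEquiv (galoisTwist hξ hcompat τ.toLinearEquiv (n2G k _ .Gp)))
    (hm : T (θ.toLinearEquiv (n2G k _ .Gm)) =
      θ.toLinearEquiv (galoisTwist hξ hcompat τ.toLinearEquiv (n2G k _ .Gm)))
    (x : RatLaurent k ⊗[k] N2 k) :
    T (θ.toLinearEquiv x) = θ.toLinearEquiv (galoisTwist hξ hcompat τ.toLinearEquiv x) := by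
  have h1 := hT.comp θ.isSemiHom
  have h2 := θ.isSemiHom.comp (isSemiHom_galoisTwist hξ hcompat τ)
  rw [AlgHom.comp_id] at h1
  rw [AlgHom.id_comp] at h2
  exact DFunLike.congr_fun (isSemiHom_ext h1 h2 hp hm) x

open AddMonoidAlgebra in
set_option maxHeartbeats 400000 in
/-- A semilinear automorphism of `A ⊗_k k[t^q | q ∈ ℚ]` for which `G⁺` has finite orbit is
conjugate to `γ ⊗ 1` or to `γ ⊗ ω`. -/
lemma exists_conj [IsAlgClosed k] {T : RatLaurent k ⊗[k] N2 k →+ RatLaurent k ⊗[k] N2 k}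
    (hT : IsSemiHom ((galoisGen hξ hcompat).restrictScalars k) (n2Over (ratLaurentDer k))
      (n2Over (ratLaurentDer k)) T) (hinj : Function.Injective T) {N : ℕ} (hN : 0 < N)
    (hTN : T^[N] (n2G k _ .Gp) = n2G k _ .Gp) :
    ∃ θ : ConformalEquiv (n2Over (k := k) (ratLaurentDer k)) (n2Over (ratLaurentDer k)),
      (∀ x, T (θ.toLinearEquiv x) = θ.toLinearEquiv (galoisTwist hξ hcompat
        (ConformalEquiv.refl (n2Conformal k)).toLinearEquiv x)) ∨
      (∀ x, T (θ.toLinearEquiv x) =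
        θ.toLinearEquiv (galoisTwist hξ hcompat (n2Omega k).toLinearEquiv x)) := by
  obtain ⟨α, α', hα, h⟩ := isSemiHom_cases hT hinj
  obtain ⟨q, c, hc, rfl⟩ := exists_eq_single_of_mul_eq_one hα
  have hTs : ∀ s x, T (s • x) = galoisGen hξ hcompat s • T x := hT.map_smul
  rcases h with ⟨hp, hm⟩ | ⟨hp, hm⟩
  · have hiter : ∀ n : ℕ, ∃ d : k, T^[n] (n2G k _ .Gp) =
        (single (n * q) d : RatLaurent k) • n2G k _ .Gp := by
      intro n
      induction n with
      | zero => exact ⟨1, by simp [← one_def]⟩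
      | succ n ih =>
        obtain ⟨d, hd⟩ := ih
        refine ⟨d * rootChar hξ hcompat (.ofAdd (n * q)) * c, ?_⟩
        rw [Function.iterate_succ_apply', hd, hTs, galoisGen_single, hp, smul_smul,
          single_mul_single]
        congr 2
        push_cast
        ring
    -- The N-th iterate multiplies G⁺ by a monomial of exponent N q, while the finite orbit requires
    -- the factor 1.
    have hq : q = 0 := by
      obtain ⟨d, hd⟩ := hiter N
      rw [hTN] at hd
      have h1 : (1 : RatLaurent k) = single (N * q) d :=
        smul_n2G_injective (k := k) .Gp (by rw [one_smul, ← hd])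
      rw [one_def, single_inj] at h1
      rcases h1 with ⟨h1, -⟩ | ⟨h1, -⟩
      · have : (N : ℚ) ≠ 0 := by exact_mod_cast hN.ne'
        exact (mul_eq_zero.mp h1.symm).resolve_left this
      · exact absurd h1 one_ne_zero
    subst hq
    have hchi0 : rootChar hξ hcompat (.ofAdd (0 : ℚ)) = 1 := by
      rw [ofAdd_zero, map_one]
    have hiter' : ∀ n : ℕ, T^[n] (n2G k _ .Gp) =
        (single 0 (c ^ n) : RatLaurent k) • n2G k _ .Gp := by
      intro n
      induction n with
      | zero => simp [← one_def]
      | succ n ih =>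
        rw [Function.iterate_succ_apply', ih, hTs, galoisGen_single, hp, smul_smul,
          single_mul_single, hchi0, mul_one, add_zero, pow_succ]
    have hcN : c ^ N = 1 := by
      have hd := hiter' N
      rw [hTN] at hd
      have h1 : (1 : RatLaurent k) = single 0 (c ^ N) :=
        smul_n2G_injective (k := k) .Gp (by rw [one_smul, ← hd])
      rw [one_def, single_right_inj] at h1
      exact h1.symm
    have : NeZero N := ⟨hN.ne'⟩
    obtain ⟨j, -, hj⟩ := (hξ N hN).eq_pow_of_pow_eq_one hcN
    -- With c = ξ_N^j, the exponent p = j/N satisfies χ(p) = c. Then β = t^{-p} solves γ(β) c = β,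
    -- and no scalar correction is needed.
    set p : ℚ := ((j : ℤ) : ℚ) / N with hp_def
    have hchi : rootChar hξ hcompat (.ofAdd p) = c := by
      rw [hp_def, rootChar_div hξ hcompat N hN, zpow_natCast, hj]
    have hβ : (single (-p) 1 : RatLaurent k) * single p 1 = 1 := by
      rw [single_mul_single, neg_add_cancel, mul_one, one_def]
    have hβp : galoisGen hξ hcompat (single (-p) 1) * single 0 c = single (-p) 1 := by
      have : rootChar hξ hcompat (.ofAdd (-p)) * c = 1 := by
        rw [← hchi, ← map_mul, ← ofAdd_add, neg_add_cancel, ofAdd_zero, map_one]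
      rw [galoisGen_single, single_mul_single, add_zero, one_mul, this]
    have hγ : galoisGen hξ hcompat (single (-p) 1) * galoisGen hξ hcompat (single p 1) = 1 := by
      rw [← map_mul, hβ, map_one]
    refine ⟨n2Torus (ratLaurentDer k) hβ, Or.inl (conj_eq_of_Gp_Gm hξ hcompat hT _ _ ?_ ?_)⟩
    · rw [galoisTwist_refl_n2G, n2Torus_Gp, hTs, hp, smul_smul, hβp]
    · rw [galoisTwist_refl_n2G, n2Torus_Gm, hTs, hm, smul_smul,
        mul_eq_of_mul_eq hβp hβ hγ hα]
  -- In the swapping case γ(β) α = β⁻¹ is required. Comparing exponents in β = b t^r gives r = -q/2,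
  -- and comparing coefficients gives b² χ(-q/2) c = 1. This is where square roots in k are used.
  · obtain ⟨b, hb⟩ := IsAlgClosed.exists_pow_nat_eq
      (rootChar hξ hcompat (.ofAdd (-(q / 2))) * c)⁻¹ two_pos
    have hχ0 : rootChar hξ hcompat (.ofAdd (-(q / 2))) ≠ 0 := by
      intro h0
      have := map_mul (rootChar hξ hcompat) (.ofAdd (-(q / 2))) (.ofAdd (q / 2))
      rw [h0, zero_mul, ← ofAdd_add, neg_add_cancel, ofAdd_zero, map_one] at this
      exact one_ne_zero this
    have hb0 : b ≠ 0 := by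
      rintro rfl
      rw [zero_pow two_ne_zero, eq_comm, inv_eq_zero] at hb
      exact mul_ne_zero hχ0 hc hb
    have hβ : (single (-(q / 2)) b : RatLaurent k) * single (q / 2) b⁻¹ = 1 := by
      rw [single_mul_single, neg_add_cancel, mul_inv_cancel₀ hb0, one_def]
    have hβp : galoisGen hξ hcompat (single (-(q / 2)) b) * single q c = single (q / 2) b⁻¹ := by
      rw [galoisGen_single, single_mul_single, show -(q / 2) + q = q / 2 by ring]
      congr 1
      apply mul_left_cancel₀ hb0
      rw [mul_inv_cancel₀ hb0, ← mul_inv_cancel₀ (mul_ne_zero hχ0 hc), ← hb]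
      ring
    have hγ : galoisGen hξ hcompat (single (-(q / 2)) b) *
        galoisGen hξ hcompat (single (q / 2) b⁻¹) = 1 := by
      rw [← map_mul, hβ, map_one]
    obtain ⟨e1, e2, -⟩ := galoisTwist_omega_n2G hξ hcompat
    refine ⟨n2Torus (ratLaurentDer k) hβ, Or.inr (conj_eq_of_Gp_Gm hξ hcompat hT _ _ ?_ ?_)⟩
    · rw [e1, n2Torus_Gp, n2Torus_Gm, hTs, hp, smul_smul, hβp]
    · rw [e2, n2Torus_Gp, n2Torus_Gm, hTs, hm, smul_smul,
        mul_eq_of_mul_eq hβp ((mul_comm _ _).trans hβ) hγ hα]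

end Conjugacy

end

noncomputable section

open ConformalSuperalgebra

/-! ### Loop algebras and forms as fixed points, and the final classification -/

section Loop

variable {k : Type*} [Field k] [CharZero k] {ξ : ℕ → k}
  (hξ : ∀ m, 0 < m → IsPrimitiveRoot (ξ m) m)
  (hcompat : ∀ l m, 0 < l → 0 < m → ξ (l * m) ^ l = ξ m)

/-- The twisted loop algebra `L(A, σ)` is the algebra of invariants of `γ ⊗ σ⁻¹`. -/
lemma mem_loopSubmodule_iff (σ : ConformalEquiv (n2Conformal k) (n2Conformal k)) (m : ℕ)
    (hm : 0 < m) (hσ : ∀ a, σ.toLinearEquiv^[m] a = a) (x : RatLaurent k ⊗[k] N2 k) :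
    x ∈ loopSubmodule σ m hm (ξ m) (hξ m hm) ↔
      galoisTwist hξ hcompat σ.symm.toLinearEquiv x = x := by
  have h0 : ξ m ≠ 0 := (hξ m hm).ne_zero hm.ne'
  have hm' : (m : ℚ) ≠ 0 := by exact_mod_cast hm.ne'
  constructor
  · intro hx
    change x ∈ Submodule.span k _ at hx
    induction hx using Submodule.span_induction with
    | mem x h =>
      obtain ⟨i, a, ha, rfl⟩ := h
      rw [galoisTwist_tmul, galoisGen_single, rootChar_div hξ hcompat m hm, one_mul]
      have : σ.symm.toLinearEquiv a = (ξ m ^ i)⁻¹ • a := by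
        apply σ.toLinearEquiv.injective
        rw [map_smul, ha, smul_smul, inv_mul_cancel₀ (zpow_ne_zero _ h0), one_smul]
        exact σ.toLinearEquiv.apply_symm_apply a
      rw [LinearEquiv.coe_coe, this, TensorProduct.tmul_smul, TensorProduct.smul_tmul',
        AddMonoidAlgebra.smul_single, smul_eq_mul, inv_mul_cancel₀ (zpow_ne_zero _ h0)]
    | zero => simp
    | add x y _ _ hx hy => rw [map_add, hx, hy]
    | smul c x _ hx =>
      rw [semilinear_map_smul_base (isSemiHom_galoisTwist hξ hcompat σ.symm).map_smul, hx]
  · intro hx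
    -- The converse expands x in the basis t^q with coefficients in A. Invariance means that each
    -- coefficient x_q satisfies σ(x_q) = χ(q) x_q.
    let B : Module.Basis ℚ k (RatLaurent k) := ⟨AddMonoidAlgebra.coeffLinearEquiv k⟩
    have hB : ∀ q, B q = AddMonoidAlgebra.single q 1 := fun q => rfl
    let e := TensorProduct.equivFinsuppOfBasisLeft (N := N2 k) B
    have he : ∀ (q : ℚ) (c : k) (a : N2 k),
        e (AddMonoidAlgebra.single q c ⊗ₜ a) = Finsupp.single q (c • a) := by
      intro q c a
      have : (AddMonoidAlgebra.single q c : RatLaurent k) = c • B q := by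
        rw [hB, AddMonoidAlgebra.smul_single, smul_eq_mul, mul_one]
      rw [this, TensorProduct.smul_tmul, TensorProduct.equivFinsuppOfBasisLeft_apply_tmul]
      ext q'
      simp [Finsupp.single_apply]
    have hcoord : ∀ (y : RatLaurent k ⊗[k] N2 k) (q : ℚ),
        σ.toLinearEquiv (e (galoisTwist hξ hcompat σ.symm.toLinearEquiv y) q) =
          rootChar hξ hcompat (.ofAdd q) • e y q := by
      intro y q
      induction y using TensorProduct.induction_on with
      | zero => simp
      | add y z hy hz => simp only [map_add, Finsupp.add_apply, hy, hz, smul_add]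
      | tmul s a =>
        induction s using AddMonoidAlgebra.induction_linear with
        | zero => simp
        | add s t hs ht =>
          simp only [TensorProduct.add_tmul, map_add, Finsupp.add_apply, hs, ht, smul_add]
        | single p c =>
          rw [galoisTwist_tmul, galoisGen_single, he, he]
          by_cases h : p = q
          · subst h
            rw [Finsupp.single_eq_same, Finsupp.single_eq_same, map_smul, smul_smul, mul_comm]
            congr 1
            exact σ.toLinearEquiv.apply_symm_apply a
          · rw [Finsupp.single_eq_of_ne' h, Finsupp.single_eq_of_ne' h, map_zero, smul_zero]
    have hσx : ∀ q, σ.toLinearEquiv (e x q) = rootChar hξ hcompat (.ofAdd q) • e x q := by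
      intro q
      rw [← hcoord, hx]
    have hx' : x = (e x).sum fun q a => AddMonoidAlgebra.single q 1 ⊗ₜ a := by
      apply e.injective
      rw [Finsupp.sum, map_sum]
      simp only [he, one_smul]
      exact (Finsupp.sum_single (e x)).symm
    rw [hx']
    refine sum_mem fun q hq => ?_
    have hq0 : e x q ≠ 0 := Finsupp.mem_support_iff.mp hq
    -- Since σ^m = 1, any exponent that occurs has χ(mq) = 1, so mq is an integer and x_q ⊗ t^q is
    -- one of the generators of the loop algebra.
    have hpow : rootChar hξ hcompat (.ofAdd q) ^ m = 1 := by
      have hit : ∀ n : ℕ, σ.toLinearEquiv^[n] (e x q) =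
          rootChar hξ hcompat (.ofAdd q) ^ n • e x q := by
        intro n
        induction n with
        | zero => simp
        | succ n ih =>
          rw [Function.iterate_succ_apply', ih, map_smul, hσx, smul_smul, pow_succ]
      have h1 := hit m
      rw [hσ] at h1
      have h2 : (rootChar hξ hcompat (.ofAdd q) ^ m - 1) • e x q = 0 := by
        rw [sub_smul, one_smul, ← h1, sub_self]
      exact sub_eq_zero.mp ((smul_eq_zero.mp h2).resolve_right hq0)
    obtain ⟨i, hi⟩ : ∃ i : ℤ, (m : ℚ) * q = i := by
      apply exists_int_of_rootChar_eq_one hξ hcompat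
      rw [← nsmul_eq_mul, ofAdd_nsmul, map_pow, hpow]
    have hqi : q = (i : ℚ) / m := by rw [← hi]; field_simp
    refine Submodule.subset_span ⟨i, e x q, ?_, by rw [hqi]⟩
    rw [hσx]
    congr 1
    conv_lhs => rw [hqi]
    exact rootChar_div hξ hcompat m hm i

/-- An `R`-conformal superalgebra that embeds into `A ⊗_k k[t^q | q ∈ ℚ]` with image `L(A, σ)` is
isomorphic to `L(A, σ)`. -/
lemma isoOver_twistedLoop {F : Type*} [AddCommGroup F] [Module k F] [Module (LaurentPolynomial k) F]
    [IsScalarTower k (LaurentPolynomial k) F] (SF : ConformalSuperalgebra k (laurentDer k) F)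
    (g : F →ₗ[LaurentPolynomial k] RatLaurent k ⊗[k] N2 k) (hinj : Function.Injective g)
    (heven : ∀ f ∈ SF.even, g f ∈ (n2Over (ratLaurentDer k)).even)
    (hodd : ∀ f ∈ SF.odd, g f ∈ (n2Over (ratLaurentDer k)).odd)
    (hder : ∀ f, g (SF.der f) = (n2Over (ratLaurentDer k)).der (g f))
    (hprod : ∀ n f f', g (SF.prod n f f') = (n2Over (ratLaurentDer k)).prod n (g f) (g f'))
    (σ : ConformalEquiv (n2Conformal k) (n2Conformal k)) (m : ℕ) (hm : 0 < m)
    (hrange : ∀ x, x ∈ loopSubmodule σ m hm (ξ m) (hξ m hm) ↔ ∃ f, g f = x) :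
    IsoOver SF (twistedLoop σ m hm (ξ m) (hξ m hm)) := by
  let g' : F →ₗ[LaurentPolynomial k] loopSubmodule σ m hm (ξ m) (hξ m hm) :=
    g.codRestrict _ (fun f => (hrange _).mpr ⟨f, rfl⟩)
  have hbij : Function.Bijective g' := by
    refine ⟨fun f f' h => hinj (congrArg Subtype.val h), ?_⟩
    rintro ⟨x, hx⟩
    obtain ⟨f, hf⟩ := (hrange x).mp hx
    exact ⟨f, Subtype.ext hf⟩
  exact ⟨{ toLinearEquiv := LinearEquiv.ofBijective g' hbij
           map_even := heven
           map_odd := hodd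
           map_prod := fun n a b => Subtype.ext (hprod n a b)
           map_der := fun a => Subtype.ext (hder a) }⟩

/-- An `R`-conformal superalgebra that embeds into `A ⊗_k k[t^q | q ∈ ℚ]` as the invariants of a
semilinear automorphism is isomorphic to `L(A, id)` or to `L(A, ω)`. -/
lemma isoOver_id_or_omega [IsAlgClosed k] {F : Type*} [AddCommGroup F] [Module k F]
    [Module (LaurentPolynomial k) F]
    [IsScalarTower k (LaurentPolynomial k) F] (SF : ConformalSuperalgebra k (laurentDer k) F)
    (g : F →ₗ[LaurentPolynomial k] RatLaurent k ⊗[k] N2 k) (hinj : Function.Injective g)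
    (heven : ∀ f ∈ SF.even, g f ∈ (n2Over (ratLaurentDer k)).even)
    (hodd : ∀ f ∈ SF.odd, g f ∈ (n2Over (ratLaurentDer k)).odd)
    (hder : ∀ f, g (SF.der f) = (n2Over (ratLaurentDer k)).der (g f))
    (hprod : ∀ n f f', g (SF.prod n f f') = (n2Over (ratLaurentDer k)).prod n (g f) (g f'))
    {T : RatLaurent k ⊗[k] N2 k →+ RatLaurent k ⊗[k] N2 k}
    (hT : IsSemiHom ((galoisGen hξ hcompat).restrictScalars k) (n2Over (ratLaurentDer k))
      (n2Over (ratLaurentDer k)) T) (hTinj : Function.Injective T) {N : ℕ} (hN : 0 < N)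
    (hTN : T^[N] (n2G k _ .Gp) = n2G k _ .Gp) (hfix : ∀ x, T x = x ↔ ∃ f, g f = x) :
    IsoOver SF
      (twistedLoop (ConformalEquiv.refl (n2Conformal k)) 1 one_pos (ξ 1) (hξ 1 one_pos)) ∨
    IsoOver SF (twistedLoop (n2Omega k) 2 two_pos (ξ 2) (hξ 2 two_pos)) := by
  obtain ⟨θ, hθ⟩ := exists_conj hξ hcompat hT hTinj hN hTN
  -- Moving the embedding by θ⁻¹ replaces the fixed points of T by those of γ ⊗ σ⁻¹, that is, by
  -- L(A, σ).
  let h : F →ₗ[LaurentPolynomial k] RatLaurent k ⊗[k] N2 k :=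
    (θ.toLinearEquiv.symm.toLinearMap.restrictScalars (LaurentPolynomial k)) ∘ₗ g
  have hh : ∀ f, h f = θ.toLinearEquiv.symm (g f) := fun f => rfl
  have main : ∀ (σ : ConformalEquiv (n2Conformal k) (n2Conformal k)) (m : ℕ) (hm : 0 < m),
      (∀ a, σ.toLinearEquiv^[m] a = a) → (∀ x, T (θ.toLinearEquiv x) =
        θ.toLinearEquiv (galoisTwist hξ hcompat σ.symm.toLinearEquiv x)) →
      IsoOver SF (twistedLoop σ m hm (ξ m) (hξ m hm)) := by
    intro σ m hm hσ hconj
    refine isoOver_twistedLoop hξ SF h (θ.toLinearEquiv.symm.injective.comp hinj)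
      (fun f hf => θ.symm.map_even _ (heven f hf)) (fun f hf => θ.symm.map_odd _ (hodd f hf))
      (fun f => ?_) (fun n f f' => ?_) σ m hm (fun x => ?_)
    · rw [hh, hder]; exact θ.symm.map_der _
    · rw [hh, hprod]; exact θ.symm.map_prod n _ _
    · rw [mem_loopSubmodule_iff hξ hcompat σ m hm hσ, ← θ.toLinearEquiv.injective.eq_iff, ← hconj,
        hfix]
      simp only [hh, LinearEquiv.symm_apply_eq]
  rcases hθ with hθ | hθ
  · exact Or.inl (main _ 1 one_pos (fun a => rfl) hθ)
  -- `main` asks for the inverse of ω, which is ω itself by definition; likewise for the identity in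
  -- the first case.
  · exact Or.inr (main _ 2 two_pos (n2Omega_period k) hθ)

omit [CharZero k] in
/-- Isomorphic `R`-conformal superalgebras are isomorphic as `k`-conformal superalgebras. -/
lemma IsoOver.isoOverBase {R : Type*} [CommRing R] [Algebra k R] {δ : Derivation k R R}
    {A : Type*} [AddCommGroup A] [Module k A] [Module R A] [IsScalarTower k R A]
    {B : Type*} [AddCommGroup B] [Module k B] [Module R B] [IsScalarTower k R B]
    {SA : ConformalSuperalgebra k δ A} {SB : ConformalSuperalgebra k δ B} (h : IsoOver SA SB) :
    IsoOverBase SA SB := by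
  obtain ⟨e⟩ := h
  exact ⟨{ toLinearEquiv := e.toLinearEquiv.restrictScalars k
           map_even := e.map_even
           map_odd := e.map_odd
           map_prod := e.map_prod
           map_der := e.map_der }⟩

-- The inverse of γ comes from the inverse character. It serves to show that the semilinear maps γ ⊗
-- τ used for descent are injective.
omit [CharZero k] in
lemma exists_galoisGen_leftInverse : ∃ γ' : RatLaurent k →ₐ[LaurentPolynomial k] RatLaurent k,
    ∀ s, γ' (galoisGen hξ hcompat s) = s := by
  refine ⟨twistHom ((rootChar hξ hcompat).comp invMonoidHom) fun n => ?_, fun s => ?_⟩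
  · rw [MonoidHom.comp_apply, invMonoidHom_apply, ← ofAdd_neg, ← Int.cast_neg, rootChar_intCast]
  · induction s using AddMonoidAlgebra.induction_linear with
    | zero => simp
    | add x y hx hy => simp only [map_add, hx, hy]
    | single q c =>
      rw [galoisGen_single, twistHom_single, MonoidHom.comp_apply, invMonoidHom_apply, mul_assoc,
        ← map_mul, mul_inv_cancel, map_one, mul_one]

omit [CharZero k] in
lemma twistMap_leftInverse {R S A : Type*} [CommRing R] [CommRing S] [Algebra R S] [AddCommGroup A]
    [Module R A] {γ γ' : S →ₐ[R] S} {τ τ' : A →ₗ[R] A} (hγ : ∀ s, γ' (γ s) = s)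
    (hτ : ∀ a, τ' (τ a) = a) : Function.LeftInverse (twistMap γ' τ') (twistMap γ τ) := by
  intro x
  induction x using TensorProduct.induction_on with
  | zero => simp
  | add x y hx hy => simp only [map_add, hx, hy]
  | tmul s a => rw [twistMap_tmul, twistMap_tmul, hγ, hτ]

/-- Every twisted loop algebra of `A` is isomorphic over `R` to `L(A, id)` or to `L(A, ω)`. -/
lemma twistedLoop_isoOver [IsAlgClosed k] (hξ : ∀ m, 0 < m → IsPrimitiveRoot (ξ m) m)
    (hcompat : ∀ l m, 0 < l → 0 < m → ξ (l * m) ^ l = ξ m)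
    (σ : ConformalEquiv (n2Conformal k) (n2Conformal k))
    (m : ℕ) (hm : 0 < m) (hσ : ∀ a, σ.toLinearEquiv^[m] a = a) :
    IsoOver (twistedLoop σ m hm (ξ m) (hξ m hm))
      (twistedLoop (ConformalEquiv.refl (n2Conformal k)) 1 one_pos (ξ 1) (hξ 1 one_pos)) ∨
    IsoOver (twistedLoop σ m hm (ξ m) (hξ m hm))
      (twistedLoop (n2Omega k) 2 two_pos (ξ 2) (hξ 2 two_pos)) := by
  refine isoOver_id_or_omega hξ hcompat _ (loopSubmodule σ m hm (ξ m) (hξ m hm)).subtype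
    Subtype.val_injective (fun f hf => hf) (fun f hf => hf) (fun f => rfl) (fun n f f' => rfl)
    (isSemiHom_galoisTwist hξ hcompat σ.symm) ?_ hm ?_ ?_
  · obtain ⟨γ', hγ'⟩ := exists_galoisGen_leftInverse hξ hcompat
    exact (twistMap_leftInverse (γ' := γ'.restrictScalars k) (τ' := σ.toLinearEquiv.toLinearMap)
      hγ' σ.toLinearEquiv.apply_symm_apply).injective
  -- γ fixes 1, so the orbit of 1 ⊗ G⁺ is governed by σ⁻¹ alone and has period m.
  · have h : ∀ (n : ℕ) (a : N2 k),
        (galoisTwist hξ hcompat σ.symm.toLinearEquiv)^[n] (1 ⊗ₜ a) =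
          1 ⊗ₜ σ.toLinearEquiv.symm^[n] a := by
      intro n a
      induction n with
      | zero => rfl
      | succ n ih =>
        rw [Function.iterate_succ_apply', ih, galoisTwist_tmul, map_one,
          Function.iterate_succ_apply']
        rfl
    have h' : σ.toLinearEquiv.symm^[m] (n2Mono k .Gp 0) = n2Mono k .Gp 0 := by
      have := Function.LeftInverse.iterate (f := σ.toLinearEquiv) (g := σ.toLinearEquiv.symm)
        σ.toLinearEquiv.symm_apply_apply m (n2Mono k .Gp 0)
      rwa [hσ] at this
    rw [n2G, h, h']
  · intro x
    rw [← mem_loopSubmodule_iff hξ hcompat σ m hm hσ]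
    exact ⟨fun h => ⟨⟨x, h⟩, rfl⟩, fun ⟨f, hf⟩ => hf ▸ f.2⟩

/-- `L(A, id)` and `L(A, ω)` are not isomorphic over `k`. -/
lemma not_isoOverBase (hξ : ∀ m, 0 < m → IsPrimitiveRoot (ξ m) m)
    (hcompat : ∀ l m, 0 < l → 0 < m → ξ (l * m) ^ l = ξ m) : ¬ IsoOverBase
    (twistedLoop (ConformalEquiv.refl (n2Conformal k)) 1 one_pos (ξ 1) (hξ 1 one_pos))
    (twistedLoop (n2Omega k) 2 two_pos (ξ 2) (hξ 2 two_pos)) := by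
  rintro ⟨e⟩
  have hmem : ∀ c, n2G k (RatLaurent k) c ∈
      loopSubmodule (ConformalEquiv.refl (n2Conformal k)) 1 one_pos (ξ 1) (hξ 1 one_pos) := by
    intro c
    rw [mem_loopSubmodule_iff hξ hcompat _ 1 one_pos (fun a => rfl)]
    exact galoisTwist_refl_n2G hξ hcompat c
  have hsub : ∀ n c d x (hx : (n2Over (ratLaurentDer k)).prod n (n2G k _ c) (n2G k _ d) = x)
      (hx' : x ∈ loopSubmodule (ConformalEquiv.refl (n2Conformal k)) 1 one_pos (ξ 1)
        (hξ 1 one_pos)),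
      (n2Over (ratLaurentDer k)).prod n (e.toLinearEquiv ⟨_, hmem c⟩).1
        (e.toLinearEquiv ⟨_, hmem d⟩).1 = (e.toLinearEquiv ⟨x, hx'⟩).1 := by
    intro n c d x hx hx'
    subst hx
    exact (congrArg Subtype.val (e.map_prod n ⟨_, hmem c⟩ ⟨_, hmem d⟩)).symm
  have hzero : (e.toLinearEquiv ⟨0, zero_mem _⟩).1 = 0 :=
    congrArg Subtype.val (map_zero e.toLinearEquiv)
  -- Only parity and products occur in the characterization of J, so an isomorphism `e` that is
  -- merely k-linear suffices. The image of J is computed in A ⊗ Ŝ, which contains L(A, ω).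
  have hJ := eq_J_or_eq_neg_J (δ := ratLaurentDer k) (x := (e.toLinearEquiv ⟨_, hmem .J⟩).1)
    (y := (e.toLinearEquiv ⟨_, hmem .Gp⟩).1)
    (e.map_even ⟨_, hmem .J⟩ (n2G_mem_even (δ := ratLaurentDer k)).2)
    (e.map_odd ⟨_, hmem .Gp⟩ (n2G_mem_odd (δ := ratLaurentDer k)).1)
    (fun h => by
      have h1 : e.toLinearEquiv ⟨_, hmem .Gp⟩ = 0 := Subtype.ext h
      rw [LinearEquiv.map_eq_zero_iff] at h1
      exact n2G_ne_zero .Gp (congrArg Subtype.val h1))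
    (fun n => (hsub n .J .J 0 (n2_prod_J_J n) (zero_mem _)).trans hzero)
    (hsub 0 .J .Gp _ (n2G_relations.prod_zero .J .Gp) (hmem .Gp))
    (fun n => (hsub (n + 1) .J .Gp 0 (n2_prod_succ_J_Gp n) (zero_mem _)).trans hzero)
  -- Membership in L(A, ω) means invariance under γ ⊗ ω, which negates J.
  have hfix := (mem_loopSubmodule_iff hξ hcompat (n2Omega k) 2 two_pos (n2Omega_period k) _).mp
    (e.toLinearEquiv ⟨_, hmem .J⟩).2
  have hω : galoisTwist hξ hcompat (n2Omega k).symm.toLinearEquiv (n2G k (RatLaurent k) .J) =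
      -n2G k (RatLaurent k) .J := (galoisTwist_omega_n2G hξ hcompat).2.2
  rcases hJ with ⟨hJ, -⟩ | ⟨hJ, -⟩
  · rw [hJ, hω] at hfix
    exact n2G_J_ne_neg hfix.symm
  · rw [hJ, map_neg, hω, neg_neg] at hfix
    exact n2G_J_ne_neg hfix

set_option maxHeartbeats 1000000 in
/-- A conformal superalgebra that becomes isomorphic to `A ⊗ RatLaurent k` after base change is
isomorphic to `L(A, id)` or to `L(A, ω)`. -/
lemma isoOver_of_baseChange_equiv [IsAlgClosed k] (hξ : ∀ m, 0 < m → IsPrimitiveRoot (ξ m) m)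
    (hcompat : ∀ l m, 0 < l → 0 < m → ξ (l * m) ^ l = ξ m)
    {F : Type*} [AddCommGroup F] [Module k F] [Module (LaurentPolynomial k) F]
    [IsScalarTower k (LaurentPolynomial k) F] (SF : ConformalSuperalgebra k (laurentDer k) F)
    (φ : ConformalEquiv (SF.baseChange (ratLaurentDer_algebraMap (k := k)))
      (n2Over (k := k) (ratLaurentDer k))) :
    IsoOver SF
      (twistedLoop (ConformalEquiv.refl (n2Conformal k)) 1 one_pos (ξ 1) (hξ 1 one_pos)) ∨
    IsoOver SF (twistedLoop (n2Omega k) 2 two_pos (ξ 2) (hξ 2 two_pos)) := by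
  -- The descent datum: γ ⊗ 1 on Ŝ ⊗ F, whose fixed points are F, transported by φ to A ⊗ Ŝ.
  let Γ : RatLaurent k ⊗[LaurentPolynomial k] F →+ RatLaurent k ⊗[LaurentPolynomial k] F :=
    twistMap (galoisGen hξ hcompat) LinearMap.id
  have hΓ : IsSemiHom ((galoisGen hξ hcompat).restrictScalars k)
      (SF.baseChange (ratLaurentDer_algebraMap (k := k)))
      (SF.baseChange (ratLaurentDer_algebraMap (k := k))) Γ :=
    isSemiHom_twistMap _ SF _ (galoisGen_der hξ hcompat) _ (ConformalEquiv.refl SF).isSemiHom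
  have hΓ1 : ∀ f : F, Γ (1 ⊗ₜ f) = 1 ⊗ₜ f := by
    intro f
    change twistMap _ _ _ = _
    rw [twistMap_tmul, map_one]
    rfl
  have hT : IsSemiHom ((galoisGen hξ hcompat).restrictScalars k) (n2Over (ratLaurentDer k))
      (n2Over (ratLaurentDer k)) (φ.conj Γ) := φ.isSemiHom_conj hΓ
  have hΓinj : Function.Injective Γ := by
    obtain ⟨γ', hγ'⟩ := exists_galoisGen_leftInverse hξ hcompat
    exact (twistMap_leftInverse (γ' := γ') (τ' := LinearMap.id) hγ' (fun _ => rfl)).injective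
  -- The finite orbit of G⁺ under the transported map is that of its preimage under γ ⊗ 1, where all
  -- orbits are finite.
  obtain ⟨M, hM, hper⟩ := exists_period_and_trace hξ hcompat
    (φ.toLinearEquiv.symm (n2G k (RatLaurent k) .Gp))
  let g : F →ₗ[LaurentPolynomial k] RatLaurent k ⊗[k] N2 k :=
    (φ.toLinearEquiv.toLinearMap.restrictScalars (LaurentPolynomial k)) ∘ₗ
      TensorProduct.mk (LaurentPolynomial k) (RatLaurent k) F 1
  have hg : ∀ f, g f = φ.toLinearEquiv (1 ⊗ₜ f) := fun f => rfl
  refine isoOver_id_or_omega hξ hcompat SF g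
    (φ.toLinearEquiv.injective.comp (one_tmul_injective F))
    (fun f hf => φ.map_even _ (Submodule.tmul_mem_baseChange_of_mem _ hf))
    (fun f hf => φ.map_odd _ (Submodule.tmul_mem_baseChange_of_mem _ hf))
    (fun f => ?_) (fun n f f' => ?_) hT (φ.conj_injective hΓinj) hM ?_ (fun x => ⟨fun hx => ?_, ?_⟩)
  · rw [hg, ← baseChange_der_one_tmul (ratLaurentDer_algebraMap (k := k))]
    exact φ.map_der _
  · rw [hg, ← baseChange_prod_one_tmul (ratLaurentDer_algebraMap (k := k))]
    exact φ.map_prod n _ _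
  · have := φ.conj_iterate_apply (Γ := Γ) M (φ.toLinearEquiv.symm (n2G k (RatLaurent k) .Gp))
    rw [(hper M dvd_rfl).1, LinearEquiv.apply_symm_apply] at this
    exact this
  · obtain ⟨y, rfl⟩ := φ.toLinearEquiv.surjective x
    rw [φ.conj_apply, φ.toLinearEquiv.injective.eq_iff] at hx
    obtain ⟨f, rfl⟩ := exists_one_tmul_of_twistMap_eq hξ hcompat y hx
    exact ⟨f, rfl⟩
  · rintro ⟨f, rfl⟩
    rw [hg, φ.conj_apply]
    exact congrArg φ.toLinearEquiv (hΓ1 f)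

/-- Every form of `A` is isomorphic to `L(A, id)` or to `L(A, ω)`. -/
lemma isoOver_of_isForm [IsAlgClosed k] (hξ : ∀ m, 0 < m → IsPrimitiveRoot (ξ m) m)
    (hcompat : ∀ l m, 0 < l → 0 < m → ξ (l * m) ^ l = ξ m)
    {F : Type*} [AddCommGroup F] [Module k F] [Module (LaurentPolynomial k) F]
    [IsScalarTower k (LaurentPolynomial k) F] (SF : ConformalSuperalgebra k (laurentDer k) F)
    (hF : IsForm (ratLaurentDer_algebraMap (k := k)) SF
      ((n2Conformal k).baseChange (der_algebraMap_base (laurentDer k)))) :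
    IsoOver SF
      (twistedLoop (ConformalEquiv.refl (n2Conformal k)) 1 one_pos (ξ 1) (hξ 1 one_pos)) ∨
    IsoOver SF (twistedLoop (n2Omega k) 2 two_pos (ξ 2) (hξ 2 two_pos)) := by
  obtain ⟨e⟩ := hF
  exact isoOver_of_baseChange_equiv hξ hcompat SF
    (e.trans (baseChangeTrans _ _ _ (n2Conformal k)))

end Loop

end

theorem theorem4p20 {k : Type*} [Field k] [CharZero k] [IsAlgClosed k]
    (ξ : ℕ → k) (hξ : ∀ m, 0 < m → IsPrimitiveRoot (ξ m) m)
    (hcompat : ∀ l m, 0 < l → 0 < m → ξ (l * m) ^ l = ξ m) :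
    -- every twisted loop algebra is `k`-isomorphic to `L(A, id)` or to `L(A, ω)`
    (∀ (m : ℕ) (hm : 0 < m) (σ : ConformalEquiv (n2Conformal k) (n2Conformal k)),
      (∀ a, σ.toLinearEquiv^[m] a = a) →
        IsoOverBase (twistedLoop σ m hm (ξ m) (hξ m hm))
          (twistedLoop (ConformalEquiv.refl (n2Conformal k)) 1 one_pos (ξ 1) (hξ 1 one_pos)) ∨
        IsoOverBase (twistedLoop σ m hm (ξ m) (hξ m hm))
          (twistedLoop (n2Omega k) 2 two_pos (ξ 2) (hξ 2 two_pos))) ∧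
    -- `L(A, id)` and `L(A, ω)` are not `k`-isomorphic
    (¬ IsoOverBase
        (twistedLoop (ConformalEquiv.refl (n2Conformal k)) 1 one_pos (ξ 1) (hξ 1 one_pos))
        (twistedLoop (n2Omega k) 2 two_pos (ξ 2) (hξ 2 two_pos))) ∧
    -- every `Ŝ/R`-form of `A ⊗_k R` is isomorphic, even over `R`, to one of the two
    (∀ (F : Type*) [AddCommGroup F] [Module k F] [Module (LaurentPolynomial k) F]
        [IsScalarTower k (LaurentPolynomial k) F]
        (SF : ConformalSuperalgebra k (laurentDer k) F),
      IsForm (ratLaurentDer_algebraMap (k := k)) SF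
          ((n2Conformal k).baseChange (der_algebraMap_base (laurentDer k))) →
        IsoOver SF
          (twistedLoop (ConformalEquiv.refl (n2Conformal k)) 1 one_pos (ξ 1) (hξ 1 one_pos)) ∨
        IsoOver SF
          (twistedLoop (n2Omega k) 2 two_pos (ξ 2) (hξ 2 two_pos))) := by
  -- The classification of twisted loop algebras holds already over R; the isomorphisms are then
  -- restricted to k.
  refine ⟨fun m hm σ hσ => ?_, not_isoOverBase hξ hcompat,
    fun F _ _ _ _ SF hF => isoOver_of_isForm hξ hcompat SF hF⟩
  rcases twistedLoop_isoOver hξ hcompat σ m hm hσ with h | h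
  · exact Or.inl h.isoOverBase
  · exact Or.inr h.isoOverBase
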